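/- **Setting.** Let $a_1,\dots,a_N,b_1,\dots,b_N\in\mathbb R$, $|a|^2=\sum_i a_i^2$, and consider the focusing vector nonlinear Schrödinger equation $$\mathrm i\,\mathbf q_t+\tfrac12\mathbf q_{xx}+\mathbf q\mathbf q^\dagger\mathbf q=0,\qquad \mathbf q=(q_1,\dots,q_N)^T, \tag{1}$$ with the plane wave $q_i[0]=a_ie^{\theta_i}$, $\theta_i=\mathrm i\,[b_ix+(|a|^2-\tfrac12b_i^2)t]$. Its Lax pair is $\Phi_x=U\Phi$, $\Phi_t=V\Phi$ with $U=\mathrm i[\frac\lambda2(\sigma_3+I)+Q]$, $V=\mathrm i[\frac{\lambda^2}4(\sigma_3+I)+\frac\lambda2Q-\frac12\sigma_3(Q^2+\mathrm iQ_x)+|a|^2I]$, $Q=\begin{pmatrix}0&\mathbf q^\dagger\\ \mathbf q&0\end{pmatrix}$, $\sigma_3=\mathrm{diag}(1,-I_N)$. Given vectors $y_u=(\phi_u,\boldsymbol\psi_u^T)^T$ and numbers $\lambda_u$, the Darboux-dressing formula is $\mathbf q\mapsto\mathbf q+Y_2M^{-1}Y_1^\dagger$, where $Y_1=(\phi_u)_u$,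 $Y_2=(\boldsymbol\psi_u)_u$, $M=\big(\langle y_u|y_v\rangle/(\lambda_u^*-\lambda_v)\big)_{u,v}$. The characteristic equation is $$\prod_{i=1}^N(\chi+b_i)\Big[\chi-\lambda-\sum_{i=1}^N\frac{a_i^2}{\chi+b_i}\Big]=0. \tag{2}$$ **Data.** Let $\chi_1,\dots,\chi_p$ be distinct roots, with $\operatorname{Im}\chi_j>0$, of the discriminant polynomial $\prod_i(\chi+b_i)^2\big(1+\sum_i\frac{a_i^2}{(\chi+b_i)^2}\big)$, let $\kappa_j\ge1$ be the multiplicity of $\chi_j$, and choose integers $1\le s_j\le\kappa_j+1$, $K_j\ge0$ and complex parameters $\beta_j^{[k]}$, $k\ge0$. Put $$\hat\lambda_j(\epsilon)=\chi_j-\sum_i\frac{a_i^2}{\chi_j+b_i}+\alpha_j\epsilon^{\kappa_j+1},\qquad \alpha_j=\sum_ia_i^2\Big(\frac{-1}{\chi_j+b_i}\Big)^{\kappa_j+2},\qquad \hat\chi_j(\epsilon)=\sum_{m\ge0}\chi_j^{[m]}\epsilon^m,$$ where $\chi_j^{[0]}=\chi_j$, $\chi_j^{[1]}=1$ and, for $m\ge\kappa_j+2$,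 $$\chi_j^{[m-\kappa_j]}=\frac1{(\kappa_j+1)\alpha_j}\sum_{i=1}^N\frac{a_i^2}{\chi_j+b_i}\sum_{\nu=\kappa_j+1}^{m}\Big(\frac{-1}{\chi_j+b_i}\Big)^{\nu}\,[\epsilon^m]\Big(\sum_{\alpha=1}^{m-\kappa_j-1}\chi_j^{[\alpha]}\epsilon^\alpha\Big)^{\nu}.$$ Let $X_j^{[k]}=\mathrm i\big(\chi_j^{[k]}x+\frac12\sum_{l=0}^k\chi_j^{[l]}\chi_j^{[k-l]}t\big)+\beta_j^{[k]}$, let $H_{k,j}^{[m,n]}$ and $H_{k,j}^{[i;m,n]}$ be the coefficients of $\epsilon_k^{*m}\epsilon_j^{n}$ in the formal expansions of $$\frac{\exp\big(\sum_{l\ge1}X_k^{[l]*}\epsilon_k^{*l}+\sum_{l\ge1}X_j^{[l]}\epsilon_j^{l}\big)}{\hat\chi_k(\epsilon_k)^*-\hat\chi_j(\epsilon_j)}\quad\text{and of this series times}\quad\frac{\hat\chi_k(\epsilon_k)^*+b_i}{\hat\chi_j(\epsilon_j)+b_i},$$ (given by explicit finite sums; $\epsilon_k^*$ and $\epsilon_j$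 are treated as independent), and for $m,n\ge1$ set $$G_{k,j}^{[m,n]}=H_{k,j}^{[m(\kappa_k+1)-s_k,\;n(\kappa_j+1)-s_j]},\qquad G_{k,j}^{[i;m,n]}=H_{k,j}^{[i;\,m(\kappa_k+1)-s_k,\;n(\kappa_j+1)-s_j]}.$$ Let $G^{[0]}$ and $G^{[i]}$ be the $K\times K$ block matrices, $K=K_1+\dots+K_p$, with blocks $\big(G_{k,j}^{[r,s]}\big)_{1\le r\le K_k,\,1\le s\le K_j}$ and $\big(G_{k,j}^{[i;r,s]}\big)_{1\le r\le K_k,\,1\le s\le K_j}$, $1\le k,j\le p$, and put $$q_i[K]=a_i\,\frac{\det G^{[i]}}{\det G^{[0]}}\,e^{\theta_i},\qquad i=1,\dots,N. \tag{3}$$ Finally, with $\omega_j(\epsilon)=\mathrm i[\hat\chi_jx+\frac12\hat\chi_j^2t]+\sum_{k\ge0}\beta_j^{[k]}\epsilon^k$, $\mu_j=e^{2\pi\mathrm i/(\kappa_j+1)}$ and $D_{N+1}=\mathrm{diag}(1,a_1e^{\theta_1},\dots,a_Ne^{\theta_N})$, let $$\Phi_j(\epsilon)=D_{N+1}\Big[e^{\omega_j},\frac{e^{\omega_j}}{\hat\chi_j+b_1},\dots,\frac{e^{\omega_j}}{\hat\chi_j+b_N}\Big]^T,\qquad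 \Psi_j(\epsilon)=\frac{1}{(\kappa_j+1)\epsilon^{\kappa_j+1}}\sum_{n=0}^{\kappa_j}(\mu_j^n\epsilon)^{s_j}\Phi_j(\mu_j^n\epsilon)=D_{N+1}[\phi_j,\psi_j^{[1]},\dots,\psi_j^{[N]}]^T ,$$ where in the last average $D_{N+1}$ is the same factor in every term. **Theorem (general rogue-wave solutions).** 1. There is $R>0$ such that for all $j$ and $|\epsilon|<R$ the series $\hat\chi_j(\epsilon)$ converges absolutely, $\hat\chi_j(\epsilon)+b_i\ne0$ for all $i$, and $\chi=\hat\chi_j(\epsilon)$ solves (2) with $\lambda=\hat\lambda_j(\epsilon)$. 2. Suppose that every series $\sum_k\beta_j^{[k]}\epsilon^k$ has a positive radius of convergence. Then there is $R>0$ such that for $0<|\epsilon|<R$ the function $\Psi_j(\epsilon)$ solves the Lax pair of the plane wave at $\lambda=\hat\lambda_j(\epsilon)$, and for $0<|\epsilon_k|,|\epsilon_j|<R$ (where the two small parameters are independent, also if $k=j$) and all $x,t\in\mathbb R$, $\hat\lambda_k(\epsilon_k)^*\ne\hat\lambda_j(\epsilon_j)$ and $$e^{-X_k^{[0]*}-X_j^{[0]}}\frac{\Psi_k^\dagger\Psi_j}{\hat\lambda_k^*-\hat\lambda_j}=\sum_{m,n\ge0}G_{k,j}^{[m+1,n+1]}\epsilon_k^{*\,m(\kappa_k+1)}\epsilon_j^{\,n(\kappa_j+1)},$$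 $$e^{-X_k^{[0]*}-X_j^{[0]}}\Big(\frac{\Psi_k^\dagger\Psi_j}{\hat\lambda_k^*-\hat\lambda_j}+\phi_k^*\psi_j^{[i]}\Big)=\sum_{m,n\ge0}G_{k,j}^{[i;m+1,n+1]}\epsilon_k^{*\,m(\kappa_k+1)}\epsilon_j^{\,n(\kappa_j+1)} .$$ Moreover, for all $x,t\in\mathbb R$ and all $i$, $q_i[K](x,t)$ is the limit, as all $\epsilon_{j,r}\to0$ ($1\le j\le p$, $1\le r\le K_j$) with $\epsilon_{j,r}\neq0$ and, for each $j$, pairwise distinct $\epsilon_{j,r}^{\kappa_j+1}$, of the $i$-th component of the Darboux dressing of the plane wave by the $K$ solutions $\Psi_j(\epsilon_{j,r})$ at the spectral parameters $\hat\lambda_j(\epsilon_{j,r})$. 3. For arbitrary $\beta_j^{[k]}$, $\det G^{[0]}\neq0$ for all $x,t\in\mathbb R$, and $\mathbf q[K]=(q_1[K],\dots,q_N[K])^T$ given by (3) is a smooth solution of (1) on $\mathbb R^2$. -/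

import Mathlib

open Complex Filter Topology
open scoped Matrix ContDiff

noncomputable section

namespace VNLS

variable {N : ℕ}

/-! ### The equation, its Lax pair and the dressing formula -/

/-- `q(x,t) = (q₁,…,q_N)` is a smooth solution of `i q_t + ½ q_xx + q q† q = 0` on the plane. -/
def SolvesVNLSE (q : ℝ → ℝ → Fin N → ℂ) : Prop :=
  (∀ i, ContDiff ℝ ∞ (fun z : ℝ × ℝ => q z.1 z.2 i)) ∧
  ∀ (x t : ℝ) (i : Fin N),
    I * deriv (fun t' => q x t' i) t
      + (1 / 2) * iteratedDeriv 2 (fun x' => q x' t i) x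
      + (∑ l, q x t l * star (q x t l)) * q x t i = 0

/-- `|a|² = ∑ aᵢ²`. -/
def ampSq (a : Fin N → ℝ) : ℝ := ∑ i, a i ^ 2

/-- `exp θᵢ`, with `θᵢ = i [bᵢ x + (|a|² - bᵢ²/2) t]`. -/
def phase (a b : Fin N → ℝ) (x t : ℝ) (i : Fin N) : ℂ :=
  exp (I * ((b i : ℂ) * x + ((ampSq a : ℂ) - (b i : ℂ) ^ 2 / 2) * t))

/-- The plane wave `qᵢ[0] = aᵢ exp θᵢ`. -/
def planeWave (a b : Fin N → ℝ) (x t : ℝ) (i : Fin N) : ℂ :=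
  (a i : ℂ) * phase a b x t i

/-- The matrix `[[0, v†], [v, 0]]`. -/
def matQ (v : Fin N → ℂ) : Matrix (Unit ⊕ Fin N) (Unit ⊕ Fin N) ℂ :=
  Matrix.fromBlocks 0 (Matrix.of fun _ j => star (v j)) (Matrix.of fun i _ => v i) 0

/-- `σ₃ = diag(1, -I_N)`. -/
def sigma3 : Matrix (Unit ⊕ Fin N) (Unit ⊕ Fin N) ℂ :=
  Matrix.fromBlocks 1 0 0 (-1)

/-- `U(λ; Q) = i [λ/2 (σ₃ + I) + Q]`. -/
def laxU (lam : ℂ) (v : Fin N → ℂ) : Matrix (Unit ⊕ Fin N) (Unit ⊕ Fin N) ℂ :=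
  I • ((lam / 2) • (sigma3 + 1) + matQ v)

/-- `V(λ; Q) = i [λ²/4 (σ₃ + I) + λ/2 Q - ½ σ₃ (Q² + i Q_x) + |a|² I]`; here `v`, `vx` are the
values of `q` and `q_x`. -/
def laxV (a : Fin N → ℝ) (lam : ℂ) (v vx : Fin N → ℂ) :
    Matrix (Unit ⊕ Fin N) (Unit ⊕ Fin N) ℂ :=
  I • ((lam ^ 2 / 4) • (sigma3 + 1) + (lam / 2) • matQ v
    - (1 / 2 : ℂ) • (sigma3 * (matQ v * matQ v + I • matQ vx)) + (ampSq a : ℂ) • 1)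

/-- `Φ` solves `Φ_x = U Φ`, `Φ_t = V Φ` for the potential `q` at the spectral parameter `lam`. -/
def SolvesLax (a : Fin N → ℝ) (q : ℝ → ℝ → Fin N → ℂ) (lam : ℂ)
    (Φ : ℝ → ℝ → Unit ⊕ Fin N → ℂ) : Prop :=
  ∀ x t : ℝ,
    HasDerivAt (fun x' => Φ x' t) (laxU lam (q x t) *ᵥ Φ x t) x ∧
    HasDerivAt (fun t' => Φ x t')
      (laxV a lam (q x t) (fun i => deriv (fun x' => q x' t i) x) *ᵥ Φ x t) t

/-- The matrix `M = (⟨yᵢ|yⱼ⟩ / (λᵢ* - λⱼ))`. -/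
def dressM {ι : Type*} (lam : ι → ℂ) (y : ι → Unit ⊕ Fin N → ℂ) : Matrix ι ι ℂ :=
  Matrix.of fun i j => (star (y i) ⬝ᵥ y j) / (star (lam i) - lam j)

/-- The dressed potential `q + Y₂ M⁻¹ Y₁†` (values at one point), where `Y = [Y₁; Y₂]` has the
columns `yⱼ`. -/
def dress {ι : Type*} [Fintype ι] [DecidableEq ι] (q : Fin N → ℂ) (lam : ι → ℂ)
    (y : ι → Unit ⊕ Fin N → ℂ) (i : Fin N) : ℂ :=
  q i + ∑ j, ∑ k, y j (Sum.inr i) * (dressM lam y)⁻¹ j k * star (y k (Sum.inl ()))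

/-! ### Multiple roots of the characteristic equation -/

/-- The left-hand side of the characteristic equation,
`∏ (χ + bᵢ) [χ - λ - ∑ aᵢ² / (χ + bᵢ)]`. -/
def charLHS (a b : Fin N → ℝ) (lam χ : ℂ) : ℂ :=
  (∏ i, (χ + b i)) * (χ - lam - ∑ i, (a i : ℂ) ^ 2 / (χ + b i))

/-- The discriminant polynomial `∏ (χ + bᵢ)² (1 + ∑ aᵢ² / (χ + bᵢ)²)`, multiplied out. -/
def discPoly (a b : Fin N → ℝ) : Polynomial ℂ :=
  (∏ i, (Polynomial.X + Polynomial.C (b i : ℂ)) ^ 2)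
    + ∑ i, Polynomial.C ((a i : ℂ) ^ 2)
        * ∏ l ∈ Finset.univ.erase i, (Polynomial.X + Polynomial.C (b l : ℂ)) ^ 2

/-- The multiplicity `κ` of `z` as a root of the discriminant polynomial. -/
def kappa (a b : Fin N → ℝ) (z : ℂ) : ℕ := (discPoly a b).rootMultiplicity z

/-- `λ^[0] = z - ∑ aᵢ² / (z + bᵢ)`. -/
def lam0 (a b : Fin N → ℝ) (z : ℂ) : ℂ := z - ∑ i, (a i : ℂ) ^ 2 / (z + b i)

/-- `α = ∑ aᵢ² (-1 / (z + bᵢ))^(κ+2)`. -/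
def alpha (a b : Fin N → ℝ) (z : ℂ) : ℂ :=
  ∑ i, (a i : ℂ) ^ 2 * (-1 / (z + b i)) ^ (kappa a b z + 2)

/-- `λ̂(ε) = λ^[0] + α ε^(κ+1)`. -/
def lamHat (a b : Fin N → ℝ) (z ε : ℂ) : ℂ :=
  lam0 a b z + alpha a b z * ε ^ (kappa a b z + 1)

/-- The coefficient of `ε^m` in `(∑_{α ≥ 1} c_α ε^α)^ν`, that is
`∑ ν! ∏_α c_α^{l_α} / l_α!` over all `l` with `∑ l_α = ν` and `∑ α l_α = m`. -/
def powCoeff (c : ℕ → ℂ) (ν m : ℕ) : ℂ :=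
  PowerSeries.coeff m ((PowerSeries.mk fun α => if α = 0 then 0 else c α) ^ ν)

/-- The coefficients `χ^[m]` of `χ̂(ε) = ∑ χ^[m] ε^m`: `χ^[0] = z`, `χ^[1] = 1`, and for `n ≥ 2`,
with `m = n + κ`,
`χ^[n] = 1/((κ+1) α) ∑ᵢ aᵢ²/(z+bᵢ) ∑_{ν=κ+1}^{m} (-1/(z+bᵢ))^ν [ε^m] (∑_{α=1}^{n-1} χ^[α] ε^α)^ν`. -/
def chiCoeff (a b : Fin N → ℝ) (z : ℂ) : ℕ → ℂ
  | 0 => z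
  | 1 => 1
  | n + 2 =>
    (1 / (((kappa a b z : ℂ) + 1) * alpha a b z)) *
      ∑ i, (a i : ℂ) ^ 2 / (z + b i) *
        ∑ ν ∈ Finset.Icc (kappa a b z + 1) (n + 2 + kappa a b z),
          (-1 / (z + b i)) ^ ν *
            powCoeff (fun α => if _h : α < n + 2 then chiCoeff a b z α else 0) ν
              (n + 2 + kappa a b z)
  termination_by n => n

/-- `χ̂(ε) = ∑ χ^[m] ε^m`. -/
def chiHat (a b : Fin N → ℝ) (z ε : ℂ) : ℂ := ∑' m, chiCoeff a b z m * ε ^ m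

/-! ### The solutions of the Lax pair near a multiple root -/

/-- `ω(ε) = i [χ̂ x + ½ χ̂² t] + ∑ β^[k] ε^k`. -/
def omegaHat (a b : Fin N → ℝ) (z : ℂ) (β : ℕ → ℂ) (ε : ℂ) (x t : ℝ) : ℂ :=
  I * (chiHat a b z ε * x + (1 / 2) * chiHat a b z ε ^ 2 * t) + ∑' k, β k * ε ^ k

/-- `[exp ω, exp ω / (χ̂ + b₁), …, exp ω / (χ̂ + b_N)]`, so that `Φ(ε)` is `D_{N+1}` times this. -/
def phiRed (a b : Fin N → ℝ) (z : ℂ) (β : ℕ → ℂ) (ε : ℂ) (x t : ℝ) : Unit ⊕ Fin N → ℂ :=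
  Sum.elim (fun _ => exp (omegaHat a b z β ε x t))
    (fun i => exp (omegaHat a b z β ε x t) / (chiHat a b z ε + b i))

/-- `μ = exp (2πi / (κ+1))`. -/
def muRoot (a b : Fin N → ℝ) (z : ℂ) : ℂ :=
  exp (2 * Real.pi * I / ((kappa a b z : ℂ) + 1))

/-- `[φ, ψ^[1], …, ψ^[N]]`: the average
`1/((κ+1) ε^(κ+1)) ∑_{n=0}^{κ} (μⁿ ε)^s D⁻¹ Φ(μⁿ ε)`. -/
def psiRed (a b : Fin N → ℝ) (z : ℂ) (β : ℕ → ℂ) (s : ℕ) (ε : ℂ) (x t : ℝ) :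
    Unit ⊕ Fin N → ℂ := fun c =>
  (1 / (((kappa a b z : ℂ) + 1) * ε ^ (kappa a b z + 1))) *
    ∑ n ∈ Finset.range (kappa a b z + 1),
      (muRoot a b z ^ n * ε) ^ s * phiRed a b z β (muRoot a b z ^ n * ε) x t c

/-- `Ψ(ε) = D_{N+1} [φ, ψ^[1], …, ψ^[N]]ᵀ` with `D_{N+1} = diag(1, a₁ e^{θ₁}, …, a_N e^{θ_N})`. -/
def Psi (a b : Fin N → ℝ) (z : ℂ) (β : ℕ → ℂ) (s : ℕ) (ε : ℂ) (x t : ℝ) :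
    Unit ⊕ Fin N → ℂ :=
  Sum.elim (fun _ => psiRed a b z β s ε x t (Sum.inl ()))
    (fun i => planeWave a b x t i * psiRed a b z β s ε x t (Sum.inr i))

/-! ### The expansion coefficients -/

/-- `X^[k] = i (χ^[k] x + ½ ∑_{l=0}^{k} χ^[l] χ^[k-l] t) + β^[k]`. -/
def Xcoeff (a b : Fin N → ℝ) (z : ℂ) (β : ℕ → ℂ) (x t : ℝ) (k : ℕ) : ℂ :=
  I * (chiCoeff a b z k * x
    + (1 / 2) * (∑ l ∈ Finset.range (k + 1), chiCoeff a b z l * chiCoeff a b z (k - l)) * t)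
    + β k

/-- `S^[j] = ∑ ∏_k (X^[k])^{l_k} / l_k!` over `∑ k l_k = j`, `k ≥ 1`: the coefficient of `ε^j` in
`exp (∑_{k≥1} X^[k] ε^k)`. -/
def Scoeff (a b : Fin N → ℝ) (z : ℂ) (β : ℕ → ℂ) (x t : ℝ) (j : ℕ) : ℂ :=
  ∑ ν ∈ Finset.range (j + 1), powCoeff (Xcoeff a b z β x t) ν j / (ν.factorial : ℂ)

/-- The coefficient of `ε^m` in `χ̂(ε) + bᵢ`. -/
def shiftCoeff (a b : Fin N → ℝ) (z : ℂ) (i : Fin N) (m : ℕ) : ℂ :=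
  chiCoeff a b z m + if m = 0 then (b i : ℂ) else 0

/-- The coefficient of `ε^m` in `1 / (χ̂(ε) + bᵢ)`. -/
def invCoeff (a b : Fin N → ℝ) (z : ℂ) (i : Fin N) (m : ℕ) : ℂ :=
  (1 / (z + b i)) * ∑ ν ∈ Finset.range (m + 1),
    (-1 / (z + b i)) ^ ν * powCoeff (chiCoeff a b z) ν m

/-- `E_{k,j}^[m,n]`, the coefficient of `ε_k*^m ε_j^n` in `1 / (χ̂_k* - χ̂_j)`, where `χ̂_k`, `χ̂_j`
are the series at `w` and `z`. -/
def Ecoeff (a b : Fin N → ℝ) (w z : ℂ) (m n : ℕ) : ℂ :=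
  (1 / (star w - z)) * ∑ μ ∈ Finset.range (m + 1), ∑ ν ∈ Finset.range (n + 1),
    (-1 / (star w - z)) ^ (μ + ν) * ((μ + ν).choose μ : ℂ) *
      star (powCoeff (chiCoeff a b w) μ m) *
      powCoeff (fun α => -chiCoeff a b z α) ν n

/-- `E_{k,j}^[i;m,n]`, the coefficient of `ε_k*^m ε_j^n` in
`(χ̂_k* + bᵢ) / (χ̂_j + bᵢ) / (χ̂_k* - χ̂_j)`. -/
def EcoeffI (a b : Fin N → ℝ) (w z : ℂ) (i : Fin N) (m n : ℕ) : ℂ :=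
  ∑ l ∈ Finset.range (m + 1), ∑ r ∈ Finset.range (n + 1),
    Ecoeff a b w z l r * star (shiftCoeff a b w i (m - l)) * invCoeff a b z i (n - r)

/-- `H_{k,j}^[m,n] = ∑_{l≤m, r≤n} E_{k,j}^[l,r] S_k^[m-l]* S_j^[n-r]`. -/
def Hcoeff (a b : Fin N → ℝ) (w z : ℂ) (βw βz : ℕ → ℂ) (x t : ℝ) (m n : ℕ) : ℂ :=
  ∑ l ∈ Finset.range (m + 1), ∑ r ∈ Finset.range (n + 1),
    Ecoeff a b w z l r * star (Scoeff a b w βw x t (m - l)) * Scoeff a b z βz x t (n - r)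

/-- `H_{k,j}^[i;m,n] = ∑_{l≤m, r≤n} E_{k,j}^[i;l,r] S_k^[m-l]* S_j^[n-r]`. -/
def HcoeffI (a b : Fin N → ℝ) (w z : ℂ) (βw βz : ℕ → ℂ) (i : Fin N) (x t : ℝ) (m n : ℕ) : ℂ :=
  ∑ l ∈ Finset.range (m + 1), ∑ r ∈ Finset.range (n + 1),
    EcoeffI a b w z i l r * star (Scoeff a b w βw x t (m - l)) * Scoeff a b z βz x t (n - r)

section family

variable {p : ℕ}

/-- `G_{k,j}^[m,n] = H_{k,j}^[m(κ_k+1)-s_k, n(κ_j+1)-s_j]`, used for `m, n ≥ 1` and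
`1 ≤ s_j ≤ κ_j + 1`, where the subtraction does not truncate. -/
def Gcoeff (a b : Fin N → ℝ) (χ : Fin p → ℂ) (β : Fin p → ℕ → ℂ) (s : Fin p → ℕ)
    (k j : Fin p) (x t : ℝ) (m n : ℕ) : ℂ :=
  Hcoeff a b (χ k) (χ j) (β k) (β j) x t
    (m * (kappa a b (χ k) + 1) - s k) (n * (kappa a b (χ j) + 1) - s j)

/-- `G_{k,j}^[i;m,n] = H_{k,j}^[i;m(κ_k+1)-s_k, n(κ_j+1)-s_j]`. -/
def GcoeffI (a b : Fin N → ℝ) (χ : Fin p → ℂ) (β : Fin p → ℕ → ℂ) (s : Fin p → ℕ)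
    (k j : Fin p) (i : Fin N) (x t : ℝ) (m n : ℕ) : ℂ :=
  HcoeffI a b (χ k) (χ j) (β k) (β j) i x t
    (m * (kappa a b (χ k) + 1) - s k) (n * (kappa a b (χ j) + 1) - s j)

/-- The block matrix `G^[0]`, with blocks `(G_{k,j}^[r,s])`, `1 ≤ r ≤ K_k`, `1 ≤ s ≤ K_j`; the
position `(k, r)` is the element `⟨k, r - 1⟩` of the index type. -/
def Gmat (a b : Fin N → ℝ) (χ : Fin p → ℂ) (β : Fin p → ℕ → ℂ) (s K : Fin p → ℕ) (x t : ℝ) :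
    Matrix (Σ j : Fin p, Fin (K j)) (Σ j : Fin p, Fin (K j)) ℂ :=
  Matrix.of fun u v => Gcoeff a b χ β s u.1 v.1 x t (u.2 + 1) (v.2 + 1)

/-- The block matrix `G^[i]`, `1 ≤ i ≤ N`. -/
def GmatI (a b : Fin N → ℝ) (χ : Fin p → ℂ) (β : Fin p → ℕ → ℂ) (s K : Fin p → ℕ) (i : Fin N)
    (x t : ℝ) : Matrix (Σ j : Fin p, Fin (K j)) (Σ j : Fin p, Fin (K j)) ℂ :=
  Matrix.of fun u v => GcoeffI a b χ β s u.1 v.1 i x t (u.2 + 1) (v.2 + 1)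

/-- `qᵢ[K] = aᵢ (det G^[i] / det G^[0]) exp θᵢ`. -/
def rogueWave (a b : Fin N → ℝ) (χ : Fin p → ℂ) (β : Fin p → ℕ → ℂ) (s K : Fin p → ℕ)
    (x t : ℝ) (i : Fin N) : ℂ :=
  (a i : ℂ) * ((GmatI a b χ β s K i x t).det / (Gmat a b χ β s K x t).det) * phase a b x t i

/-- The dressing of the plane wave by the `K = ∑ K_j` Lax solutions `Ψ_j(ε_{j,r})`,
`1 ≤ r ≤ K_j`, taken at the spectral parameters `λ̂_j(ε_{j,r})`. -/
def dressedPlaneWave (a b : Fin N → ℝ) (χ : Fin p → ℂ) (β : Fin p → ℕ → ℂ) (s K : Fin p → ℕ)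
    (ε : (Σ j : Fin p, Fin (K j)) → ℂ) (x t : ℝ) (i : Fin N) : ℂ :=
  dress (planeWave a b x t) (fun u => lamHat a b (χ u.1) (ε u))
    (fun u => Psi a b (χ u.1) (β u.1) (s u.1) (ε u) x t) i

/-- The admissible small parameters: all `ε_{j,r}` are nonzero, and for each `j` the numbers
`ε_{j,r}^(κ_j+1)`, hence the spectral parameters `λ̂_j(ε_{j,r})`, are distinct. -/
def admissible (a b : Fin N → ℝ) (χ : Fin p → ℂ) (K : Fin p → ℕ) :
    Set ((Σ j : Fin p, Fin (K j)) → ℂ) :=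
  {ε | (∀ u, ε u ≠ 0) ∧ ∀ j (r r' : Fin (K j)), r ≠ r' →
    ε ⟨j, r⟩ ^ (kappa a b (χ j) + 1) ≠ ε ⟨j, r'⟩ ^ (kappa a b (χ j) + 1)}

end family

end VNLS

end

open VNLS

/-! Write f(χ) = χ - ∑ aᵢ²/(χ + bᵢ), so that off the poles the characteristic equation reads f(χ) =
λ. The discriminant is f' with its poles cleared, hence f' vanishes to order κ at a root z, and f(z
+ u) = f(z) + u^(κ+1) g(u) with g(0) = α ≠ 0 (`lam0_add`, `alpha_ne_zero`). Extracting a (κ+1)-th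
root of g/α turns f(z + u) = λ̂(ε) into w(u) = ε with w locally invertible. The Taylor series of the
inverse satisfies f = λ̂ formally, and a formal solution with leading coefficient 1 is unique, so
the recursively defined χ̂ is this series and converges (`exists_analytic_root`,
`eq_chiSeries_of_formal`, `chiSeries_spec`).

That the quotients solve the equation needs no convergence of the parameter series: it is an
identity between coefficients of formal series. Let M consist of the coefficients of exp(ω_k* +
ω_j)/(χ̂_k* - χ̂_j) at the positions n(κ+1) - s, and φ, ρᵢ of those of exp ω_j and exp ω_j/(χ̂_j +
bᵢ). The derivatives of exp ω_j cancel the denominator, so M_x = -i φ*φ has rank one. Multiplication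
by λ̂ = λ^[0] + α ε^(κ+1) sends each position to the neighbouring one and acts as a matrix Λ with
Jordan-like blocks. Partial fractions then give the Lyapunov equation Λ†M - MΛ = φ*φ + ∑ aᵢ² ρᵢ*ρᵢ
(`gramMatrix_lyapunov`). These facts suffice for the dressing formula with a matrix spectral
parameter (`dressing_solves`), and the matrix determinant lemma identifies it with the quotient of
determinants (`rogueWave_eq`).

M is invertible because, for Mc = 0 at some x₀, the real part of c†(iM)c has the derivative |φc|² ≥
0, vanishes at x₀, and tends to 0 as x → +∞ since all Im χ_j > 0. Hence φc = 0 beyond x₀, and the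
entries of φ are linearly independent functions of x (`linear_independence`,
`det_gramMatrix_ne_zero`).

For convergent parameters, averaging over the rotations of ε keeps every (κ+1)-th coefficient, so
Ψ_j is a power series in ε^(κ+1) with the entries of φ and aᵢ e^θᵢ ρᵢ as coefficients. The entrywise
Lyapunov equation bounds the entries of M and sums their generating function to Ψ_k†Ψ_j/(λ̂_k* -
λ̂_j) (`PairRadius.hasSum_gramEntry`). At finitely many nodes ε^(κ+1), Newton interpolation writes
the dressing data as a congruence of matrices of divided differences. The dressing formula is
invariant under this congruence, and divided differences tend to coefficients as the nodes merge at
0 (`tendsto_dressedPlaneWave`). -/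

noncomputable section
namespace VNLS

open Finset.HasAntidiagonal (antidiagonal mem_antidiagonal)

/-! ### Absolutely convergent power series -/

open PowerSeries in
/-- The power series `f` converges absolutely at radius `r`. -/
def AbsConv (f : PowerSeries ℂ) (r : ℝ) : Prop := Summable fun n => ‖coeff n f‖ * r ^ n

/-- The majorant `∑ ‖fₙ‖ rⁿ`. -/
def majorant (f : PowerSeries ℂ) (r : ℝ) : ℝ := ∑' n, ‖PowerSeries.coeff n f‖ * r ^ n

/-- The sum of the power series `f` at `ε`. -/
def evalAt (f : PowerSeries ℂ) (ε : ℂ) : ℂ := ∑' n, PowerSeries.coeff n f * ε ^ n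

open PowerSeries (coeff)

section AbsConv

variable {f g : PowerSeries ℂ} {r r' : ℝ} {ε : ℂ}

lemma AbsConv.mono (h : AbsConv f r) (h0 : 0 ≤ r') (hr : r' ≤ r) : AbsConv f r' :=
  Summable.of_nonneg_of_le (fun n => by positivity)
    (fun n => by gcongr) h

lemma AbsConv.summable_norm (h : AbsConv f r) (hε : ‖ε‖ ≤ r) :
    Summable fun n => ‖coeff n f * ε ^ n‖ :=
  Summable.of_nonneg_of_le (fun n => by positivity)
    (fun n => by rw [norm_mul, norm_pow]; gcongr) h

lemma AbsConv.hasSum (h : AbsConv f r) (hε : ‖ε‖ ≤ r) :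
    HasSum (fun n => coeff n f * ε ^ n) (evalAt f ε) :=
  (h.summable_norm hε).of_norm.hasSum

lemma majorant_nonneg (hr : 0 ≤ r) : 0 ≤ majorant f r :=
  tsum_nonneg fun n => by positivity

lemma coeff_mul_mul_pow {R : Type*} [CommSemiring R] (f g : PowerSeries R) (x : R) (n : ℕ) :
    coeff n (f * g) * x ^ n =
      ∑ kl ∈ antidiagonal n, (coeff kl.1 f * x ^ kl.1) * (coeff kl.2 g * x ^ kl.2) := by
  rw [PowerSeries.coeff_mul, Finset.sum_mul]
  refine Finset.sum_congr rfl fun kl hkl => ?_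
  rw [← mem_antidiagonal.1 hkl, pow_add]; ring

lemma norm_coeff_mul_le (f g : PowerSeries ℂ) (hr : 0 ≤ r) (n : ℕ) :
    ‖coeff n (f * g)‖ * r ^ n ≤ ∑ kl ∈ antidiagonal n,
      (‖coeff kl.1 f‖ * r ^ kl.1) * (‖coeff kl.2 g‖ * r ^ kl.2) := by
  rw [PowerSeries.coeff_mul]
  refine (mul_le_mul_of_nonneg_right (norm_sum_le _ _) (by positivity)).trans ?_
  rw [Finset.sum_mul]
  refine Finset.sum_le_sum fun kl hkl => ?_
  rw [← mem_antidiagonal.1 hkl, pow_add, norm_mul]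
  exact le_of_eq (by ring)

lemma AbsConv.summable_antidiagonal (hf : AbsConv f r) (hg : AbsConv g r) (hr : 0 ≤ r) :
    Summable fun n => ∑ kl ∈ antidiagonal n,
      (‖coeff kl.1 f‖ * r ^ kl.1) * (‖coeff kl.2 g‖ * r ^ kl.2) := by
  refine summable_sum_mul_antidiagonal_of_summable_mul (f := fun n => ‖coeff n f‖ * r ^ n)
    (g := fun n => ‖coeff n g‖ * r ^ n) ?_
  exact hf.mul_of_nonneg hg (fun n => by simp; positivity) (fun n => by simp; positivity)

lemma AbsConv.mul (hf : AbsConv f r) (hg : AbsConv g r) (hr : 0 ≤ r) : AbsConv (f * g) r :=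
  Summable.of_nonneg_of_le (fun n => by positivity) (norm_coeff_mul_le f g hr)
    (hf.summable_antidiagonal hg hr)

lemma AbsConv.majorant_mul_le (hf : AbsConv f r) (hg : AbsConv g r) (hr : 0 ≤ r) :
    majorant (f * g) r ≤ majorant f r * majorant g r := by
  refine (Summable.tsum_le_tsum (norm_coeff_mul_le f g hr) (hf.mul hg hr)
    (hf.summable_antidiagonal hg hr)).trans (le_of_eq ?_)
  refine (Summable.tsum_mul_tsum_eq_tsum_sum_antidiagonal hf hg ?_).symm
  exact hf.mul_of_nonneg hg (fun n => by simp; positivity) (fun n => by simp; positivity)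

lemma AbsConv.evalAt_mul (hf : AbsConv f r) (hg : AbsConv g r) (hε : ‖ε‖ ≤ r) :
    evalAt (f * g) ε = evalAt f ε * evalAt g ε := by
  unfold evalAt
  rw [tsum_mul_tsum_eq_tsum_sum_antidiagonal_of_summable_norm (hf.summable_norm hε)
    (hg.summable_norm hε)]
  exact tsum_congr fun n => coeff_mul_mul_pow f g ε n

lemma AbsConv.add (hf : AbsConv f r) (hg : AbsConv g r) (hr : 0 ≤ r) : AbsConv (f + g) r := by
  refine Summable.of_nonneg_of_le (fun n => by positivity) (fun n => ?_) (Summable.add hf hg)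
  rw [map_add, ← add_mul]
  gcongr
  exact norm_add_le _ _

lemma AbsConv.evalAt_add (hf : AbsConv f r) (hg : AbsConv g r) (hε : ‖ε‖ ≤ r) :
    evalAt (f + g) ε = evalAt f ε + evalAt g ε := by
  unfold evalAt
  rw [← (hf.hasSum hε).summable.tsum_add (hg.hasSum hε).summable]
  exact tsum_congr fun n => by rw [map_add, add_mul]

lemma hasSum_monomial (k : ℕ) (c : ℂ) (ε : ℂ) :
    HasSum (fun n => coeff n (PowerSeries.monomial k c) * ε ^ n) (c * ε ^ k) := by
  convert hasSum_ite_eq k (c * ε ^ k) using 2 with n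
  rw [PowerSeries.coeff_monomial]
  split_ifs with h <;> simp [h]

lemma absConv_monomial (k : ℕ) (c : ℂ) (r : ℝ) : AbsConv (PowerSeries.monomial k c) r := by
  refine (hasSum_ite_eq k (‖c‖ * r ^ k)).summable.congr fun n => ?_
  rw [PowerSeries.coeff_monomial]
  split_ifs with h <;> simp [h]

lemma evalAt_monomial (k : ℕ) (c : ℂ) (ε : ℂ) :
    evalAt (PowerSeries.monomial k c) ε = c * ε ^ k := (hasSum_monomial k c ε).tsum_eq

lemma absConv_C (c : ℂ) (r : ℝ) : AbsConv (PowerSeries.C c) r := by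
  rw [← PowerSeries.monomial_zero_eq_C_apply]; exact absConv_monomial 0 c r

lemma evalAt_C (c ε : ℂ) : evalAt (PowerSeries.C c) ε = c := by
  rw [← PowerSeries.monomial_zero_eq_C_apply, evalAt_monomial]; simp

lemma absConv_one (r : ℝ) : AbsConv 1 r := by
  rw [← map_one PowerSeries.C]; exact absConv_C 1 r

lemma evalAt_one (ε : ℂ) : evalAt 1 ε = 1 := by
  rw [← map_one PowerSeries.C, evalAt_C]

lemma absConv_zero (r : ℝ) : AbsConv 0 r := by
  rw [← map_zero PowerSeries.C]; exact absConv_C 0 r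

lemma evalAt_zero (ε : ℂ) : evalAt 0 ε = 0 := by
  rw [← map_zero PowerSeries.C, evalAt_C]

lemma majorant_one (r : ℝ) : majorant 1 r = 1 := by
  unfold majorant
  rw [tsum_eq_single 0 (fun n hn => by simp [PowerSeries.coeff_one, hn])]
  simp

lemma AbsConv.neg (hf : AbsConv f r) : AbsConv (-f) r := by
  refine Summable.congr hf fun n => ?_
  simp

lemma evalAt_neg : evalAt (-f) ε = -evalAt f ε := by
  unfold evalAt; rw [← tsum_neg]; simp

lemma AbsConv.sub (hf : AbsConv f r) (hg : AbsConv g r) (hr : 0 ≤ r) : AbsConv (f - g) r := by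
  rw [sub_eq_add_neg]; exact hf.add hg.neg hr

lemma AbsConv.evalAt_sub (hf : AbsConv f r) (hg : AbsConv g r) (hε : ‖ε‖ ≤ r) :
    evalAt (f - g) ε = evalAt f ε - evalAt g ε := by
  rw [sub_eq_add_neg, hf.evalAt_add hg.neg hε, evalAt_neg, sub_eq_add_neg]

lemma AbsConv.pow (hf : AbsConv f r) (hr : 0 ≤ r) (k : ℕ) : AbsConv (f ^ k) r := by
  induction k with
  | zero => simpa using absConv_one r
  | succ k ih => rw [pow_succ]; exact ih.mul hf hr

lemma AbsConv.majorant_pow_le (hf : AbsConv f r) (hr : 0 ≤ r) (k : ℕ) :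
    majorant (f ^ k) r ≤ majorant f r ^ k := by
  induction k with
  | zero => simp [majorant_one]
  | succ k ih =>
    rw [pow_succ, pow_succ]
    refine ((hf.pow hr k).majorant_mul_le hf hr).trans ?_
    exact mul_le_mul_of_nonneg_right ih (majorant_nonneg hr)

lemma AbsConv.evalAt_pow (hf : AbsConv f r) (hε : ‖ε‖ ≤ r) (k : ℕ) :
    evalAt (f ^ k) ε = evalAt f ε ^ k := by
  have hr : 0 ≤ r := (norm_nonneg _).trans hε
  induction k with
  | zero => simp [evalAt_one]
  | succ k ih => rw [pow_succ, (hf.pow hr k).evalAt_mul hf hε, ih, pow_succ]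

lemma absConv_sum {ι : Type*} (s : Finset ι) {F : ι → PowerSeries ℂ}
    (h : ∀ i ∈ s, AbsConv (F i) r) (hr : 0 ≤ r) : AbsConv (∑ i ∈ s, F i) r := by
  classical
  induction s using Finset.induction_on with
  | empty => simpa using absConv_zero r
  | insert i s hi ih =>
    rw [Finset.sum_insert hi]
    exact (h i (by simp)).add (ih fun j hj => h j (by simp [hj])) hr

lemma evalAt_sum {ι : Type*} (s : Finset ι) {F : ι → PowerSeries ℂ}
    (h : ∀ i ∈ s, AbsConv (F i) r) (hε : ‖ε‖ ≤ r) :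
    evalAt (∑ i ∈ s, F i) ε = ∑ i ∈ s, evalAt (F i) ε := by
  classical
  have hr : 0 ≤ r := (norm_nonneg _).trans hε
  induction s using Finset.induction_on with
  | empty => simpa using evalAt_zero ε
  | insert i s hi ih =>
    rw [Finset.sum_insert hi, Finset.sum_insert hi, (h i (by simp)).evalAt_add
      (absConv_sum s (fun j hj => h j (by simp [hj])) hr) hε, ih fun j hj => h j (by simp [hj])]

/-- A series without constant term has a small majorant at small radii. -/
lemma AbsConv.majorant_le_mul (hf : AbsConv f r) (h0 : PowerSeries.constantCoeff f = 0)
    (hr : 0 < r) (hr0 : 0 ≤ r') (hr' : r' ≤ r) : majorant f r' ≤ r' / r * majorant f r := by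
  unfold majorant
  rw [← tsum_mul_left]
  refine Summable.tsum_le_tsum (fun n => ?_) (hf.mono hr0 hr') (hf.mul_left _)
  rcases n with _ | n
  · simp [h0]
  · have : r' ^ (n + 1) ≤ r' / r * r ^ (n + 1) := by
      rw [pow_succ, pow_succ]
      have : r' / r * (r ^ n * r) = r ^ n * r' := by field_simp
      rw [this]; gcongr
    calc ‖coeff (n+1) f‖ * r' ^ (n + 1) ≤ ‖coeff (n+1) f‖ * (r' / r * r ^ (n + 1)) := by gcongr
      _ = _ := by ring

/-- This provides radii at which the majorant of `χ̂ - z` falls below every `‖z + b i‖`, so that the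
geometric series of `1 / (χ̂ + bᵢ)` converges. -/
lemma AbsConv.tendsto_majorant (hf : AbsConv f r) (h0 : PowerSeries.constantCoeff f = 0)
    (hr : 0 < r) : Tendsto (majorant f) (𝓝[>] 0) (𝓝 0) := by
  have h1 : Tendsto (fun r' : ℝ => r' / r * majorant f r) (𝓝[>] 0) (𝓝 0) := by
    have : Continuous fun r' : ℝ => r' / r * majorant f r := by fun_prop
    simpa using (this.tendsto 0).mono_left nhdsWithin_le_nhds
  refine tendsto_of_tendsto_of_tendsto_of_le_of_le' tendsto_const_nhds h1 ?_ ?_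
  · filter_upwards [self_mem_nhdsWithin] with r' hr' using majorant_nonneg (le_of_lt hr')
  · filter_upwards [Ioc_mem_nhdsGT hr] with r' hr'
    exact hf.majorant_le_mul h0 hr hr'.1.le hr'.2

/-- Absolutely convergent power series are determined by their sums near `0`. -/
lemma AbsConv.ext (hf : AbsConv f r) (hg : AbsConv g r) (hr : 0 < r)
    (h : ∀ᶠ ε in 𝓝 (0 : ℂ), evalAt f ε = evalAt g ε) : f = g := by
  have key : ∀ {f : PowerSeries ℂ}, AbsConv f r → HasFPowerSeriesAt (evalAt f)
      (FormalMultilinearSeries.ofScalars ℂ fun n => coeff n f) 0 := by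
    intro f hf
    rw [hasFPowerSeriesAt_iff]
    filter_upwards [Metric.ball_mem_nhds (0 : ℂ) hr] with ε hε
    rw [mem_ball_zero_iff] at hε
    simpa [FormalMultilinearSeries.coeff_ofScalars, smul_eq_mul, mul_comm] using hf.hasSum hε.le
  have h1 := (key hf).eq_formalMultilinearSeries_of_eventually (key hg) h
  ext n
  simpa [FormalMultilinearSeries.coeff_ofScalars] using congrArg (fun p => p.coeff n) h1

end AbsConv

/-! ### Substitution of a series without constant term -/

/-- `∑_ν a_ν U^ν` for a series `U` without constant term. -/
def seriesComp (a : ℕ → ℂ) (U : PowerSeries ℂ) : PowerSeries ℂ :=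
  PowerSeries.mk fun n => ∑ ν ∈ Finset.range (n + 1), a ν * coeff n (U ^ ν)

lemma coeff_pow_eq_zero_of_lt {R : Type*} [CommSemiring R] {U : PowerSeries R}
    (hU : PowerSeries.constantCoeff U = 0) {n ν : ℕ} (h : n < ν) : coeff n (U ^ ν) = 0 := by
  have : (PowerSeries.X : PowerSeries R) ^ ν ∣ U ^ ν := pow_dvd_pow_of_dvd
    (PowerSeries.X_dvd_iff.2 hU) ν
  exact (PowerSeries.X_pow_dvd_iff.1 this) n h

/-- `U ^ ν` starts at order ν, so any truncation beyond n gives the same coefficient. Identities for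
compositions thereby reduce to identities for finite sums of powers of `U`. -/
lemma coeff_seriesComp {a : ℕ → ℂ} {U : PowerSeries ℂ} (hU : PowerSeries.constantCoeff U = 0)
    {n L : ℕ} (h : n < L) : coeff n (seriesComp a U) =
      coeff n (∑ ν ∈ Finset.range L, PowerSeries.C (a ν) * U ^ ν) := by
  rw [seriesComp, PowerSeries.coeff_mk, map_sum]
  simp_rw [PowerSeries.coeff_C_mul]
  refine Finset.sum_subset (Finset.range_mono h) fun ν _ hν => ?_
  rw [coeff_pow_eq_zero_of_lt hU (by simpa using hν), mul_zero]

lemma coeff_mul_congr {R : Type*} [CommSemiring R] {f g g' : PowerSeries R} {n : ℕ}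
    (h : ∀ m ≤ n, coeff m g = coeff m g') : coeff n (f * g) = coeff n (f * g') := by
  rw [PowerSeries.coeff_mul, PowerSeries.coeff_mul]
  refine Finset.sum_congr rfl fun kl hkl => ?_
  rw [h kl.2 (by have := mem_antidiagonal.1 hkl; omega)]

section

variable {a : ℕ → ℂ} {U : PowerSeries ℂ} {r : ℝ} {ε : ℂ}

/-- The majorant is submultiplicative, so the sum over the second index is at most `‖a ν‖ * majorant
U r ^ ν`. Absolute summability of the double family is what allows the two sums to be exchanged. -/
lemma summable_seriesComp (h : AbsConv U r) (hr : 0 ≤ r)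
    (ha : Summable fun ν => ‖a ν‖ * majorant U r ^ ν) :
    Summable fun e : ℕ × ℕ => ‖a e.1‖ * (‖coeff e.2 (U ^ e.1)‖ * r ^ e.2) := by
  refine (summable_prod_of_nonneg fun e => by simp; positivity).2 ⟨fun ν => ?_, ?_⟩
  · exact Summable.mul_left ‖a ν‖ (h.pow hr ν)
  · refine Summable.of_nonneg_of_le (fun ν => tsum_nonneg fun n => by positivity) (fun ν => ?_) ha
    simp only [tsum_mul_left]
    exact mul_le_mul_of_nonneg_left (h.majorant_pow_le hr ν) (norm_nonneg _)

lemma AbsConv.seriesComp (h : AbsConv U r) (hU : PowerSeries.constantCoeff U = 0) (hr : 0 ≤ r)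
    (ha : Summable fun ν => ‖a ν‖ * majorant U r ^ ν) : AbsConv (seriesComp a U) r := by
  have h1 := (summable_seriesComp h hr ha).prod_symm.prod
  refine Summable.of_nonneg_of_le (fun n => by positivity) (fun n => ?_) h1
  rw [tsum_eq_sum (s := Finset.range (n + 1)) fun ν hν => by
    simp [coeff_pow_eq_zero_of_lt hU (show n < ν by simpa using hν)]]
  rw [VNLS.seriesComp, PowerSeries.coeff_mk]
  refine (mul_le_mul_of_nonneg_right (norm_sum_le _ _) (by positivity)).trans (le_of_eq ?_)
  rw [Finset.sum_mul]
  exact Finset.sum_congr rfl fun ν _ => by simp [mul_assoc]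

/-- The same absolutely summable double family is summed in both orders: first over ν it gives the
coefficients of the composition, first over n it gives the powers of the value of `U`. -/
lemma hasSum_evalAt_seriesComp (h : AbsConv U r) (hU : PowerSeries.constantCoeff U = 0)
    (hε : ‖ε‖ ≤ r) (ha : Summable fun ν => ‖a ν‖ * majorant U r ^ ν) :
    HasSum (fun ν => a ν * evalAt U ε ^ ν) (evalAt (VNLS.seriesComp a U) ε) := by
  have hr : 0 ≤ r := (norm_nonneg _).trans hε
  have h1 : Summable fun e : ℕ × ℕ => a e.1 * (coeff e.2 (U ^ e.1) * ε ^ e.2) := by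
    refine Summable.of_norm_bounded (summable_seriesComp h hr ha) fun e => ?_
    rw [norm_mul, norm_mul, norm_pow]; gcongr
  have h2 : HasSum (fun e : ℕ × ℕ => a e.1 * (coeff e.2 (U ^ e.1) * ε ^ e.2))
      (evalAt (VNLS.seriesComp a U) ε) := by
    have : evalAt (VNLS.seriesComp a U) ε =
        ∑' e : ℕ × ℕ, a e.1 * (coeff e.2 (U ^ e.1) * ε ^ e.2) := by
      rw [← (Equiv.prodComm ℕ ℕ).tsum_eq fun e : ℕ × ℕ => a e.1 * (coeff e.2 (U ^ e.1) * ε ^ e.2)]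
      refine Eq.trans ?_ h1.prod_symm.tsum_prod.symm
      refine tsum_congr fun n => ?_
      rw [VNLS.seriesComp, PowerSeries.coeff_mk, Finset.sum_mul]
      rw [tsum_eq_sum (s := Finset.range (n + 1)) fun ν hν => by
        simp [coeff_pow_eq_zero_of_lt hU (show n < ν by simpa using hν)]]
      exact Finset.sum_congr rfl fun ν _ => by simp [mul_assoc]
    rw [this]; exact h1.hasSum
  refine h2.prod_fiberwise fun ν => ?_
  rw [← h.evalAt_pow hε ν]
  exact ((h.pow hr ν).hasSum hε).mul_left _

end

end VNLS

end

noncomputable section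
namespace VNLS
open Finset.HasAntidiagonal (antidiagonal mem_antidiagonal)
open PowerSeries (coeff)

variable {N : ℕ} {a b : Fin N → ℝ} {z : ℂ}

/-! ### The geometric series -/

/-- Up to order n the composition may be replaced by a finite geometric sum in V = -U/c; the product
telescopes to 1 - V^(n+1), and V^(n+1) does not reach the coefficient n. -/
lemma constantCoeff_mul_seriesComp_geom {c : ℂ} (hc : c ≠ 0) {U : PowerSeries ℂ}
    (hU : PowerSeries.constantCoeff U = 0) :
    (PowerSeries.C c + U) * (PowerSeries.C (1 / c) * seriesComp (fun ν => (-1 / c) ^ ν) U) = 1 := by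
  ext n
  have h : coeff n ((PowerSeries.C c + U) *
      (PowerSeries.C (1 / c) * seriesComp (fun ν => (-1 / c) ^ ν) U)) =
      coeff n ((PowerSeries.C c + U) * (PowerSeries.C (1 / c) *
        ∑ ν ∈ Finset.range (n + 1), PowerSeries.C ((-1 / c) ^ ν) * U ^ ν)) := by
    refine coeff_mul_congr fun m hm => ?_
    rw [PowerSeries.coeff_C_mul, PowerSeries.coeff_C_mul,
      coeff_seriesComp hU (Nat.lt_succ_of_le hm)]
  rw [h]
  set V : PowerSeries ℂ := PowerSeries.C (-1 / c) * U with hV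
  have h1 : (∑ ν ∈ Finset.range (n + 1), PowerSeries.C ((-1 / c) ^ ν) * U ^ ν) =
      ∑ ν ∈ Finset.range (n + 1), V ^ ν :=
    Finset.sum_congr rfl fun ν _ => by rw [hV, mul_pow, map_pow]
  have h2 : (PowerSeries.C c + U) * PowerSeries.C (1 / c) = 1 - V := by
    rw [hV, add_mul, ← map_mul, mul_one_div_cancel hc, map_one, neg_div, map_neg]; ring
  rw [h1, ← mul_assoc, h2, mul_neg_geom_sum, map_sub,
    coeff_pow_eq_zero_of_lt (by simp [hV, hU]) (Nat.lt_succ_self n), sub_zero]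

lemma AbsConv.geom {c : ℂ} {U : PowerSeries ℂ} {r : ℝ} (h : AbsConv U r)
    (hU : PowerSeries.constantCoeff U = 0) (hr : 0 ≤ r) (hc : majorant U r < ‖c‖) :
    AbsConv (PowerSeries.C (1 / c) * VNLS.seriesComp (fun ν => (-1 / c) ^ ν) U) r := by
  refine (absConv_C _ r).mul (h.seriesComp hU hr ?_) hr
  have hc0 : 0 < ‖c‖ := (majorant_nonneg hr).trans_lt hc
  have : (fun ν : ℕ => ‖(-1 / c) ^ ν‖ * majorant U r ^ ν) = fun ν => (majorant U r / ‖c‖) ^ ν := by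
    funext ν
    rw [norm_pow, ← mul_pow, norm_div, norm_neg, norm_one]; congr 1; ring
  rw [this]
  exact summable_geometric_of_lt_one (div_nonneg (majorant_nonneg hr) hc0.le)
    ((div_lt_one hc0).2 hc)

/-! ### Formal description of `χ̂` -/

/-- `∑ aᵢ² (-1 / (z + bᵢ))^m`. -/
def poleSum (a b : Fin N → ℝ) (z : ℂ) (m : ℕ) : ℂ := ∑ i, (a i : ℂ) ^ 2 * (-1 / (z + b i)) ^ m

lemma add_ofReal_ne_zero (hz : 0 < z.im) (x : ℝ) : z + x ≠ 0 := fun h => by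
  have := congrArg Complex.im h
  simp at this
  exact hz.ne' this

/-- The product of all the squares is monic of degree 2N and every other summand has smaller degree.
Without this, a root would not be known to have positive `rootMultiplicity`. -/
lemma discPoly_ne_zero (a b : Fin N → ℝ) : discPoly a b ≠ 0 := by
  open Polynomial in
  have hm : (∏ i, (X + C (b i : ℂ)) ^ 2).Monic := monic_prod_of_monic _ _ fun i _ =>
    (monic_X_add_C _).pow 2
  have hd : (∏ i, (X + C (b i : ℂ)) ^ 2).natDegree = 2 * N := by
    rw [natDegree_prod_of_monic _ _ fun i _ => (monic_X_add_C _).pow 2]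
    simp [mul_comm]
  rcases Nat.eq_zero_or_pos N with rfl | hN
  · simp [discPoly]
  have hlt : (∑ i, C ((a i : ℂ) ^ 2) * ∏ l ∈ Finset.univ.erase i, (X + C (b l : ℂ)) ^ 2).degree <
      (∏ i, (X + C (b i : ℂ)) ^ 2).degree := by
    rw [degree_eq_natDegree hm.ne_zero, hd]
    refine (degree_sum_le _ _).trans_lt ?_
    rw [Finset.sup_lt_iff (by exact WithBot.bot_lt_coe _)]
    intro i _
    rw [← smul_eq_C_mul]
    refine (degree_smul_le _ _).trans_lt ?_
    have hmi : (∏ l ∈ Finset.univ.erase i, (X + C (b l : ℂ)) ^ 2).Monic :=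
      monic_prod_of_monic _ _ fun i _ => (monic_X_add_C _).pow 2
    rw [degree_eq_natDegree hmi.ne_zero,
      natDegree_prod_of_monic _ _ fun i _ => (monic_X_add_C _).pow 2]
    simp [Finset.card_erase_of_mem]
    norm_cast
    try omega
  have := hm.add_of_left hlt
  exact this.ne_zero

lemma one_le_kappa (h : (discPoly a b).IsRoot z) : 1 ≤ kappa a b z :=
  (Polynomial.rootMultiplicity_pos (discPoly_ne_zero a b)).2 h

/-! ### Taylor coefficients of the discriminant at a multiple root -/

/-- `1 / (c + X)` as a power series. -/
def invLin (c : ℂ) : PowerSeries ℂ := PowerSeries.mk fun n => -(-1 / c) ^ (n + 1)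

lemma mul_invLin {c : ℂ} (hc : c ≠ 0) : (PowerSeries.C c + PowerSeries.X) * invLin c = 1 := by
  ext n
  rw [add_mul, map_add, PowerSeries.coeff_C_mul, invLin, PowerSeries.coeff_mk]
  have hc1 : c * (-1 / c) = -1 := by field_simp
  rcases n with _ | n
  · simp [hc1]
  · rw [PowerSeries.coeff_succ_X_mul, PowerSeries.coeff_mk, PowerSeries.coeff_one,
      if_neg (Nat.succ_ne_zero n)]
    linear_combination (-(-1 / c) ^ (n + 1)) * hc1

lemma coeff_invLin_sq {c : ℂ} (n : ℕ) : coeff n (invLin c ^ 2) = (n + 1) * (-1 / c) ^ (n + 2) := by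
  rw [sq, PowerSeries.coeff_mul]
  have : ∀ kl ∈ antidiagonal n, coeff kl.1 (invLin c) * coeff kl.2 (invLin c) =
      (-1 / c) ^ (n + 2) := by
    intro kl hkl
    rw [invLin, PowerSeries.coeff_mk, PowerSeries.coeff_mk, ← mem_antidiagonal.1 hkl]; ring
  rw [Finset.sum_congr rfl this]
  simp

/-- The Taylor coefficients at `z` of `1 + ∑ aᵢ² / (χ + bᵢ)²` vanish up to order `κ`. -/
lemma discriminant_series (hb : ∀ i, z + b i ≠ 0) :
    ∃ q : PowerSeries ℂ, PowerSeries.constantCoeff q ≠ 0 ∧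
      1 + ∑ i, PowerSeries.C ((a i : ℂ) ^ 2) * invLin (z + b i) ^ 2 =
        PowerSeries.X ^ kappa a b z * q := by
  obtain ⟨q, hq, hq0⟩ := Polynomial.exists_eq_pow_rootMultiplicity_mul_and_not_dvd (discPoly a b)
    (discPoly_ne_zero a b) z
  have hqz : q.eval z ≠ 0 := fun h => hq0 (Polynomial.dvd_iff_isRoot.2 h)
  -- `T` is the Taylor expansion at z, that is, the substitution of z + X for the variable.
  let T : Polynomial ℂ →+* PowerSeries ℂ :=
    Polynomial.eval₂RingHom PowerSeries.C (PowerSeries.C z + PowerSeries.X)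
  have hTX : T Polynomial.X = PowerSeries.C z + PowerSeries.X := by simp [T]
  have hTC : ∀ c, T (Polynomial.C c) = PowerSeries.C c := by simp [T]
  have hT0 : ∀ p : Polynomial ℂ, PowerSeries.constantCoeff (T p) = p.eval z := by
    intro p
    have : (PowerSeries.constantCoeff (R := ℂ)).comp T = Polynomial.evalRingHom z := by
      ext <;> simp [T]
    exact RingHom.congr_fun this p
  have hlin : ∀ i, T (Polynomial.X + Polynomial.C (b i : ℂ)) * invLin (z + b i) = 1 := by
    intro i
    rw [map_add, hTX, hTC, ← mul_invLin (hb i), map_add]; ring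
  -- The discriminant polynomial has to be divided by the squares of its linear factors, which are
  -- units in the ring of power series as z is not a pole.
  refine ⟨T q * ∏ i, invLin (z + b i) ^ 2, ?_, ?_⟩
  · rw [map_mul, hT0]
    refine mul_ne_zero hqz ?_
    rw [map_prod, Finset.prod_ne_zero_iff]
    intro i _ h0
    have h1 := congrArg (PowerSeries.constantCoeff (R := ℂ)) (hlin i)
    rw [map_pow] at h0
    rw [map_mul, pow_eq_zero_iff (by norm_num) |>.1 h0] at h1
    simp at h1
  · have h1 : T (discPoly a b) = PowerSeries.X ^ kappa a b z * T q := by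
      conv_lhs => rw [hq]
      rw [map_mul, map_pow, map_sub, hTX, hTC, kappa]; ring
    rw [← mul_assoc, ← h1, discPoly, map_add, map_sum, add_mul, Finset.sum_mul]
    congr 1
    · rw [map_prod, ← Finset.prod_mul_distrib]
      symm
      refine Finset.prod_eq_one fun i _ => ?_
      rw [map_pow, ← mul_pow, hlin, one_pow]
    · refine Finset.sum_congr rfl fun i _ => ?_
      rw [map_mul, hTC, mul_assoc, map_prod, ← Finset.mul_prod_erase _ _ (Finset.mem_univ i),
        mul_left_comm (∏ l ∈ Finset.univ.erase i, _), ← Finset.prod_mul_distrib,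
        Finset.prod_eq_one, mul_one]
      intro l _
      rw [map_pow, ← mul_pow, hlin, one_pow]

/-- Comparing these coefficients with the factor X^κ gives the cancellations 1 + P₂ = 0 and P₃ = … =
P_(κ+1) = 0 of the pole sums, and P_(κ+2) = α ≠ 0. -/
lemma coeff_discriminant (n : ℕ) :
    coeff n (1 + ∑ i, PowerSeries.C ((a i : ℂ) ^ 2) * invLin (z + b i) ^ 2) =
      (if n = 0 then 1 else 0) + (n + 1) * poleSum a b z (n + 2) := by
  rw [map_add, PowerSeries.coeff_one, map_sum, poleSum, Finset.mul_sum]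
  congr 1
  refine Finset.sum_congr rfl fun i _ => ?_
  rw [PowerSeries.coeff_C_mul, coeff_invLin_sq]; ring

lemma poleSum_two (hb : ∀ i, z + b i ≠ 0) (hκ : 1 ≤ kappa a b z) : 1 + poleSum a b z 2 = 0 := by
  obtain ⟨q, -, hq⟩ := discriminant_series (a := a) hb
  have h := coeff_discriminant (a := a) (b := b) (z := z) 0
  rw [hq, PowerSeries.coeff_X_pow_mul', if_neg (by omega)] at h
  simpa using h.symm

lemma poleSum_eq_zero (hb : ∀ i, z + b i ≠ 0) {n : ℕ} (hn : 1 ≤ n) (hκ : n < kappa a b z) :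
    poleSum a b z (n + 2) = 0 := by
  obtain ⟨q, -, hq⟩ := discriminant_series (a := a) hb
  have h := coeff_discriminant (a := a) (b := b) (z := z) n
  rw [hq, PowerSeries.coeff_X_pow_mul', if_neg (by omega), if_neg (by omega), zero_add] at h
  have h2 : (n + 1 : ℂ) ≠ 0 := by exact_mod_cast Nat.succ_ne_zero n
  exact (mul_eq_zero.1 h.symm).resolve_left h2

/-- As κ ≥ 1, the summand 1 does not contribute at order κ, where the coefficient (κ+1)α equals the
nonzero constant term of the cofactor. -/
lemma alpha_ne_zero (hb : ∀ i, z + b i ≠ 0) (hκ : 1 ≤ kappa a b z) : alpha a b z ≠ 0 := by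
  obtain ⟨q, hq0, hq⟩ := discriminant_series (a := a) hb
  have h := coeff_discriminant (a := a) (b := b) (z := z) (kappa a b z)
  rw [hq, PowerSeries.coeff_X_pow_mul', if_pos le_rfl, if_neg (by omega), zero_add,
    Nat.sub_self, PowerSeries.coeff_zero_eq_constantCoeff_apply] at h
  intro h0
  change poleSum a b z (kappa a b z + 2) = 0 at h0
  rw [h0, mul_zero] at h
  exact hq0 h

/-! ### Uniqueness of the formal root -/

/-- The first-order effect on the powers of a change of a coefficient. -/
lemma coeff_pow_of_coeff_eq {U V : PowerSeries ℂ} (h0 : PowerSeries.constantCoeff U = 0)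
    (h1 : coeff 1 U = 1) {n : ℕ} (hV : ∀ m, coeff m V = if m < n + 2 then coeff m U else 0)
    {κ ν : ℕ} (hν : κ + 1 ≤ ν) :
    coeff (n + 2 + κ) (U ^ ν) = coeff (n + 2 + κ) (V ^ ν) +
      if ν = κ + 1 then (κ + 1) * coeff (n + 2) U else 0 := by
  obtain ⟨W, hW⟩ : ∃ W, V = PowerSeries.X * W := PowerSeries.X_dvd_iff.2 (by
    rw [← PowerSeries.coeff_zero_eq_constantCoeff_apply, hV,
      PowerSeries.coeff_zero_eq_constantCoeff_apply, h0]; simp)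
  obtain ⟨Y, hY⟩ : (PowerSeries.X : PowerSeries ℂ) ^ (n + 2) ∣ U - V :=
    PowerSeries.X_pow_dvd_iff.2 fun m hm => by rw [map_sub, hV, if_pos hm, sub_self]
  have hW0 : PowerSeries.constantCoeff W = 1 := by
    have h := hV 1
    rw [if_pos (by omega), h1, hW, ← zero_add 1, PowerSeries.coeff_succ_X_mul] at h
    simpa using h
  have hY0 : PowerSeries.constantCoeff Y = coeff (n + 2) U := by
    have h := congrArg (coeff (n + 2)) hY
    rw [PowerSeries.coeff_X_pow_mul', if_pos le_rfl, Nat.sub_self, map_sub, hV,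
      if_neg (by omega), sub_zero, PowerSeries.coeff_zero_eq_constantCoeff_apply] at h
    exact h.symm
  have hU : U = PowerSeries.X * (W + PowerSeries.X ^ (n + 1) * Y) := by
    rw [← sub_add_cancel U V, hY, hW]; ring
  -- With `V = X W` and `U = V + X^(n+2) Y`, the part of `U ^ ν` linear in Y starts at order ν + n +
  -- 1 and the rest at order ν + 2n + 2. For ν ≥ κ + 1, only the linear part with ν = κ + 1 reaches
  -- the order n + 2 + κ.
  obtain ⟨k, hk⟩ := Polynomial.powAddExpansion W (PowerSeries.X ^ (n + 1) * Y) ν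
  have hpow : U ^ ν = V ^ ν + PowerSeries.X ^ (ν + (n + 1)) * ((ν : PowerSeries ℂ) * W ^ (ν - 1) * Y) +
      PowerSeries.X ^ (ν + (n + 1) + (n + 1)) * (k * Y ^ 2) := by
    rw [hU, hW, mul_pow, hk]; ring
  rw [hpow, map_add, map_add, PowerSeries.coeff_X_pow_mul', PowerSeries.coeff_X_pow_mul',
    if_neg (show ¬ (ν + (n + 1) + (n + 1) ≤ n + 2 + κ) by omega), add_zero]
  congr 1
  split_ifs with h2 h3 h3
  · subst h3
    rw [show n + 2 + κ - (κ + 1 + (n + 1)) = 0 by omega,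
      PowerSeries.coeff_zero_eq_constantCoeff_apply]
    simp [hW0, hY0]
  · omega
  · omega
  · rfl

/-- The series `χ̂`. -/
def chiSeries (a b : Fin N → ℝ) (z : ℂ) : PowerSeries ℂ := PowerSeries.mk (chiCoeff a b z)

/-- The series `χ̂ - z`. -/
def chiTail (a b : Fin N → ℝ) (z : ℂ) : PowerSeries ℂ :=
  PowerSeries.mk fun α => if α = 0 then 0 else chiCoeff a b z α

/-- The series `1 / (χ̂ + bᵢ)`. -/
def invSeries (a b : Fin N → ℝ) (z : ℂ) (i : Fin N) : PowerSeries ℂ :=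
  PowerSeries.mk (invCoeff a b z i)

/-- The series `λ̂`. -/
def lamSeries (a b : Fin N → ℝ) (z : ℂ) : PowerSeries ℂ :=
  PowerSeries.C (lam0 a b z) + PowerSeries.monomial (kappa a b z + 1) (alpha a b z)

lemma constantCoeff_chiTail : PowerSeries.constantCoeff (chiTail a b z) = 0 := by
  rw [← PowerSeries.coeff_zero_eq_constantCoeff_apply, chiTail]; simp

lemma chiSeries_eq : chiSeries a b z = PowerSeries.C z + chiTail a b z := by
  ext n
  rw [chiSeries, chiTail, map_add, PowerSeries.coeff_mk, PowerSeries.coeff_mk,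
    PowerSeries.coeff_C]
  rcases n with _ | n <;> simp [chiCoeff]

lemma invSeries_eq (i : Fin N) : invSeries a b z i =
    PowerSeries.C (1 / (z + b i)) * seriesComp (fun ν => (-1 / (z + b i)) ^ ν) (chiTail a b z) := by
  ext n
  rw [PowerSeries.coeff_C_mul, invSeries, seriesComp, PowerSeries.coeff_mk, PowerSeries.coeff_mk]
  rfl

/-- A series with the right two leading coefficients is `χ̂` as soon as it satisfies
`T - ∑ aᵢ² / (T + bᵢ) = λ̂`. -/
lemma eq_chiSeries_of_formal (hb : ∀ i, z + b i ≠ 0) (hκ : 1 ≤ kappa a b z)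
    {U : PowerSeries ℂ} (h0 : PowerSeries.constantCoeff U = 0) (h1 : coeff 1 U = 1)
    (h : PowerSeries.C z + U - ∑ i, PowerSeries.C ((a i : ℂ) ^ 2) *
      (PowerSeries.C (1 / (z + b i)) * seriesComp (fun ν => (-1 / (z + b i)) ^ ν) U) =
        lamSeries a b z) : U = chiTail a b z := by
  have hα := alpha_ne_zero (a := a) hb hκ
  have hcoef : ∀ m, 0 < m → coeff m U + ∑ ν ∈ Finset.range (m + 1),
      poleSum a b z (ν + 1) * coeff m (U ^ ν) =
        if m = kappa a b z + 1 then alpha a b z else 0 := by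
    intro m hm
    have h2 := congrArg (coeff m) h
    rw [lamSeries, map_add, map_sub, map_add, map_sum, PowerSeries.coeff_monomial,
      PowerSeries.coeff_C, PowerSeries.coeff_C, if_neg hm.ne', if_neg hm.ne', zero_add,
      zero_add] at h2
    rw [← h2, sub_eq_add_neg, ← Finset.sum_neg_distrib]
    congr 1
    simp_rw [PowerSeries.coeff_C_mul, seriesComp, PowerSeries.coeff_mk, poleSum, Finset.sum_mul]
    rw [Finset.sum_comm]
    refine Finset.sum_congr rfl fun i _ => ?_
    rw [Finset.mul_sum, Finset.mul_sum, ← Finset.sum_neg_distrib]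
    refine Finset.sum_congr rfl fun ν _ => ?_
    ring
  have key : ∀ m, coeff m U = coeff m (chiTail a b z) := by
    intro m
    induction m using Nat.strong_induction_on with
    | _ m ih =>
      rcases m with _ | _ | n
      · rw [PowerSeries.coeff_zero_eq_constantCoeff_apply,
          PowerSeries.coeff_zero_eq_constantCoeff_apply, h0, constantCoeff_chiTail]
      · rw [zero_add, h1, chiTail]; simp [chiCoeff]
      · set κ := kappa a b z with hκd
        set V : PowerSeries ℂ := PowerSeries.mk fun α => if α = 0 then 0 else
          if _h : α < n + 2 then chiCoeff a b z α else 0 with hVd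
        -- By the induction hypothesis, the truncated series of the recursion is the truncation of
        -- `U` below order n + 2.
        have hV : ∀ m, coeff m V = if m < n + 2 then coeff m U else 0 := by
          intro m
          rw [hVd, PowerSeries.coeff_mk]
          split_ifs with h3 h4 h4
          · rw [h3, PowerSeries.coeff_zero_eq_constantCoeff_apply, h0]
          · rfl
          · rw [ih m h4, chiTail, PowerSeries.coeff_mk, if_neg h3]
          · rfl
        -- The coefficient n + 2 of `U` is not determined at order n + 2, where it cancels, but at
        -- order n + 2 + κ, where it enters linearly with the factor (κ+1)α through the power ν = κ
        -- + 1.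
        have h2 := hcoef (n + 2 + κ) (by omega)
        rw [if_neg (by omega), ← Nat.Ico_zero_eq_range, ← Finset.sum_Ico_consecutive _
          (Nat.zero_le (κ + 1)) (show κ + 1 ≤ n + 2 + κ + 1 by omega), ← add_assoc] at h2
        -- The powers 2 ≤ ν ≤ κ have vanishing pole sums, and ν = 1 cancels the isolated coefficient
        -- by 1 + P₂ = 0.
        have h3 : coeff (n + 2 + κ) U + ∑ ν ∈ Finset.Ico 0 (κ + 1),
            poleSum a b z (ν + 1) * coeff (n + 2 + κ) (U ^ ν) = 0 := by
          rw [Finset.sum_eq_single 1]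
          · have := poleSum_two (a := a) hb hκ
            rw [pow_one]
            linear_combination (coeff (n + 2 + κ) U) * this
          · intro ν hν hν1
            rw [Finset.mem_Ico] at hν
            rcases Nat.eq_zero_or_pos ν with rfl | hν0
            · rw [pow_zero, PowerSeries.coeff_one, if_neg (by omega), mul_zero]
            · obtain ⟨ν, rfl⟩ : ∃ μ, ν = μ + 1 := ⟨ν - 1, by omega⟩
              rw [show ν + 1 + 1 = ν + 2 by ring, poleSum_eq_zero hb (by omega) (by omega),
                zero_mul]
          · intro h; simp at h; omega
        rw [h3, zero_add] at h2
        have h4 : ∀ ν ∈ Finset.Ico (κ + 1) (n + 2 + κ + 1),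
            poleSum a b z (ν + 1) * coeff (n + 2 + κ) (U ^ ν) =
            poleSum a b z (ν + 1) * coeff (n + 2 + κ) (V ^ ν) +
              if ν = κ + 1 then alpha a b z * ((κ + 1) * coeff (n + 2) U) else 0 := by
          intro ν hν
          rw [coeff_pow_of_coeff_eq h0 h1 hV (Finset.mem_Ico.1 hν).1, mul_add]
          congr 1
          split_ifs with h5
          · rw [h5]; rfl
          · rw [mul_zero]
        rw [Finset.sum_congr rfl h4, Finset.sum_add_distrib, Finset.sum_ite_eq',
          if_pos (Finset.mem_Ico.2 ⟨le_rfl, by omega⟩)] at h2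
        have h5 : coeff (n + 2) (chiTail a b z) = (1 / (((κ : ℂ) + 1) * alpha a b z)) *
            -∑ ν ∈ Finset.Ico (κ + 1) (n + 2 + κ + 1),
              poleSum a b z (ν + 1) * coeff (n + 2 + κ) (V ^ ν) := by
          rw [chiTail, PowerSeries.coeff_mk, if_neg (by omega), chiCoeff]
          congr 1
          rw [show Finset.Icc (kappa a b z + 1) (n + 2 + kappa a b z) =
            Finset.Ico (κ + 1) (n + 2 + κ + 1) by ext; simp; omega]
          simp_rw [poleSum, Finset.sum_mul, ← Finset.sum_neg_distrib, Finset.mul_sum]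
          rw [Finset.sum_comm]
          refine Finset.sum_congr rfl fun ν _ => Finset.sum_congr rfl fun i _ => ?_
          rw [powCoeff, ← hVd]
          ring
        have hκ1 : (κ + 1 : ℂ) ≠ 0 := by exact_mod_cast Nat.succ_ne_zero κ
        rw [h5]
        field_simp
        linear_combination h2
  ext m
  exact key m

end VNLS

end

noncomputable section
namespace VNLS
open Finset.HasAntidiagonal (antidiagonal mem_antidiagonal)
open PowerSeries (coeff)

variable {N : ℕ} {a b : Fin N → ℝ} {z : ℂ}

/-! ### Convergence of `χ̂` -/

/-- The factor `g` in `f(z + u) - f(z) = u^(κ+1) g(u)`, `f(χ) = χ - ∑ aᵢ² / (χ + bᵢ)`. -/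
def contactFactor (a b : Fin N → ℝ) (z u : ℂ) : ℂ :=
  -∑ i, (a i : ℂ) ^ 2 * ((-1 / (z + b i)) ^ (kappa a b z + 1) / (z + b i + u))

lemma one_div_add_eq {c u : ℂ} (hc : c ≠ 0) (hu : c + u ≠ 0) (n : ℕ) :
    1 / (c + u) = (∑ ν ∈ Finset.range n, 1 / c * (-1 / c) ^ ν * u ^ ν) +
      u ^ n * ((-1 / c) ^ n / (c + u)) := by
  induction n with
  | zero => simp
  | succ n ih =>
    rw [ih, Finset.sum_range_succ, add_assoc]
    congr 1
    rw [pow_succ, pow_succ]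
    field_simp
    ring

/-- Each pole is expanded to order κ with an exact remainder. The linear term in u cancels and the
terms of degree 2, …, κ vanish by the identities for the pole sums, so only the remainders are left
and they carry the factor u^(κ+1). -/
lemma lam0_add (hb : ∀ i, z + b i ≠ 0) (hκ : 1 ≤ kappa a b z) {u : ℂ}
    (hu : ∀ i, z + b i + u ≠ 0) :
    z + u - ∑ i, (a i : ℂ) ^ 2 / (z + b i + u) =
      lam0 a b z + u ^ (kappa a b z + 1) * contactFactor a b z u := by
  have h1 : ∑ i, (a i : ℂ) ^ 2 / (z + b i + u) = -(∑ ν ∈ Finset.range (kappa a b z + 1),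
      poleSum a b z (ν + 1) * u ^ ν) - u ^ (kappa a b z + 1) * contactFactor a b z u := by
    simp_rw [poleSum, contactFactor, Finset.sum_mul]
    rw [Finset.sum_comm, mul_neg, sub_neg_eq_add, Finset.mul_sum, ← Finset.sum_neg_distrib,
      ← Finset.sum_add_distrib]
    refine Finset.sum_congr rfl fun i _ => ?_
    rw [div_eq_mul_one_div, one_div_add_eq (hb i) (hu i) (kappa a b z + 1), mul_add,
      Finset.mul_sum, ← Finset.sum_neg_distrib]
    congr 1
    · refine Finset.sum_congr rfl fun ν _ => ?_
      ring
    · ring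
  have h2 : ∑ ν ∈ Finset.range (kappa a b z + 1), poleSum a b z (ν + 1) * u ^ ν =
      poleSum a b z 1 + poleSum a b z 2 * u := by
    obtain ⟨k, hk⟩ : ∃ k, kappa a b z = k + 1 := ⟨kappa a b z - 1, by omega⟩
    rw [hk, Finset.sum_range_succ', Finset.sum_range_succ', Finset.sum_eq_zero]
    · simp; ring
    · intro ν hν
      rw [Finset.mem_range] at hν
      rw [show ν + 1 + 1 + 1 = ν + 1 + 2 by ring, poleSum_eq_zero hb (by omega) (by omega),
        zero_mul]
  have h3 : poleSum a b z 1 = -∑ i, (a i : ℂ) ^ 2 / (z + b i) := by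
    rw [poleSum, ← Finset.sum_neg_distrib]
    exact Finset.sum_congr rfl fun i _ => by ring
  rw [h1, h2, h3, lam0]
  linear_combination (u) * poleSum_two (a := a) hb hκ

/-- Near u = 0 the equation becomes u^(κ+1) g(u) = α ε^(κ+1). It suffices to solve w(u) := u
(g(u)/α)^(1/(κ+1)) = ε, and w'(0) = 1, so v is the local inverse of w. -/
lemma exists_analytic_root (hb : ∀ i, z + b i ≠ 0) (hκ : 1 ≤ kappa a b z) :
    ∃ v : ℂ → ℂ, AnalyticAt ℂ v 0 ∧ v 0 = 0 ∧ deriv v 0 = 1 ∧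
      ∀ᶠ ε in 𝓝 (0 : ℂ), (∀ i, z + b i + v ε ≠ 0) ∧
        z + v ε - ∑ i, (a i : ℂ) ^ 2 / (z + b i + v ε) = lamHat a b z ε := by
  have hα := alpha_ne_zero (a := a) hb hκ
  set κ := kappa a b z with hκd
  have hg0 : contactFactor a b z 0 = alpha a b z := by
    rw [contactFactor, alpha, ← Finset.sum_neg_distrib]
    refine Finset.sum_congr rfl fun i _ => ?_
    rw [pow_succ _ (κ + 1)]; ring
  have hga : AnalyticAt ℂ (contactFactor a b z) 0 := by
    unfold contactFactor
    refine (Finset.analyticAt_fun_sum _ fun i _ => ?_).neg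
    refine analyticAt_const.mul (analyticAt_const.div (analyticAt_const.add analyticAt_id) ?_)
    simpa using hb i
  -- The branch of the root is chosen by the principal logarithm, which is analytic here because g/α
  -- equals 1 at u = 0.
  set h : ℂ → ℂ := fun u => exp (log (contactFactor a b z u / alpha a b z) / (κ + 1)) with hh
  have hgdiv : AnalyticAt ℂ (fun u => contactFactor a b z u / alpha a b z) 0 :=
    hga.div analyticAt_const hα
  have hha : AnalyticAt ℂ h 0 := by
    refine AnalyticAt.cexp (AnalyticAt.div (hgdiv.clog ?_) analyticAt_const ?_)
    · rw [hg0, div_self hα]; exact one_mem_slitPlane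
    · exact_mod_cast Nat.succ_ne_zero κ
  have hh0 : h 0 = 1 := by simp [hh, hg0, div_self hα]
  set w : ℂ → ℂ := fun u => u * h u with hw
  have hwa : AnalyticAt ℂ w 0 := analyticAt_id.mul hha
  have hw0 : w 0 = 0 := by simp [hw]
  have hwd : HasDerivAt w 1 0 := by
    have : HasDerivAt w (1 * h 0 + 0 * deriv h 0) 0 :=
      (hasDerivAt_id (0 : ℂ)).mul hha.differentiableAt.hasDerivAt
    simpa [hh0] using this
  have hwf : HasFDerivAt w ((ContinuousLinearEquiv.refl ℂ ℂ : ℂ ≃L[ℂ] ℂ) : ℂ →L[ℂ] ℂ) 0 := by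
    have h1 : ((ContinuousLinearEquiv.refl ℂ ℂ : ℂ ≃L[ℂ] ℂ) : ℂ →L[ℂ] ℂ) =
        ContinuousLinearMap.toSpanSingleton ℂ 1 := by ext; simp
    rw [h1]
    exact hwd.hasFDerivAt
  have hwc : ContDiffAt ℂ ω w 0 := hwa.contDiffAt
  set v := hwc.localInverse hwf (by simp) with hv
  have hva : AnalyticAt ℂ v 0 := by
    have := hwc.to_localInverse hwf (by simp)
    rw [hw0] at this
    exact this.analyticAt
  have hstrict := hwc.hasStrictFDerivAt' hwf (by simp)
  have hv0 : v 0 = 0 := by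
    have := hstrict.localInverse_apply_image
    rwa [hw0] at this
  have hwv : ∀ᶠ ε in 𝓝 (0 : ℂ), w (v ε) = ε := by
    have := hstrict.eventually_right_inverse
    rwa [hw0] at this
  have hvd : deriv v 0 = 1 := by
    have h1 : HasDerivAt (w ∘ v) (1 * deriv v 0) 0 :=
      HasDerivAt.comp 0 (by rw [hv0]; exact hwd) hva.differentiableAt.hasDerivAt
    have h2 : HasDerivAt (w ∘ v) 1 0 := (hasDerivAt_id (0 : ℂ)).congr_of_eventuallyEq hwv
    simpa using h1.unique h2
  refine ⟨v, hva, hv0, hvd, ?_⟩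
  have hvt : Tendsto v (𝓝 0) (𝓝 0) := by
    have := hva.continuousAt.tendsto
    rwa [hv0] at this
  have hne : ∀ᶠ u in 𝓝 (0 : ℂ), (∀ i, z + b i + u ≠ 0) ∧ contactFactor a b z u ≠ 0 := by
    refine Filter.Eventually.and (eventually_all.2 fun i => ?_)
      (hga.continuousAt.eventually_ne (by rwa [hg0]))
    have : ContinuousAt (fun u => z + b i + u) 0 := by fun_prop
    exact this.eventually_ne (by simpa using hb i)
  filter_upwards [hvt.eventually hne, hwv] with ε h1 h2
  refine ⟨h1.1, ?_⟩
  rw [lam0_add hb hκ h1.1, lamHat]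
  congr 1
  rw [← hκd]
  have h3 : h (v ε) ^ (κ + 1) = contactFactor a b z (v ε) / alpha a b z := by
    rw [hh]
    simp only
    rw [← exp_nat_mul, Nat.cast_add, Nat.cast_one, mul_div_cancel₀ _
      (by exact_mod_cast Nat.succ_ne_zero κ), exp_log (div_ne_zero h1.2 hα)]
  conv_rhs => rw [← h2, hw]
  simp only
  rw [mul_pow, h3]
  field_simp

/-- `χ̂` converges, and `χ̂ - ∑ aᵢ² / (χ̂ + bᵢ) = λ̂` as formal power series. -/
theorem chiSeries_spec (hb : ∀ i, z + b i ≠ 0) (hκ : 1 ≤ kappa a b z) :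
    (∃ r > 0, AbsConv (chiTail a b z) r) ∧
      chiSeries a b z - ∑ i, PowerSeries.C ((a i : ℂ) ^ 2) * invSeries a b z i =
        lamSeries a b z := by
  obtain ⟨v, hva, hv0, hvd, hv⟩ := exists_analytic_root hb hκ
  obtain ⟨p, hp⟩ := hva
  set U : PowerSeries ℂ := PowerSeries.mk p.coeff with hU
  obtain ⟨r, hr0, hr⟩ : ∃ r : NNReal, 0 < r ∧ (r : ENNReal) < p.radius :=
    ENNReal.lt_iff_exists_nnreal_btwn.1 hp.radius_pos |>.imp fun r h => ⟨by exact_mod_cast h.1, h.2⟩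
  have hAC : AbsConv U r := by
    refine (p.summable_norm_mul_pow hr).congr fun n => ?_
    rw [hU, PowerSeries.coeff_mk, FormalMultilinearSeries.norm_apply_eq_norm_coef]
  have hev : ∀ᶠ ε in 𝓝 (0 : ℂ), evalAt U ε = v ε := by
    filter_upwards [hasFPowerSeriesAt_iff.1 hp] with ε hε
    rw [zero_add] at hε
    rw [← hε.tsum_eq, evalAt]
    exact tsum_congr fun n => by rw [hU, PowerSeries.coeff_mk, smul_eq_mul, mul_comm]
  have hU0 : PowerSeries.constantCoeff U = 0 := by
    rw [← PowerSeries.coeff_zero_eq_constantCoeff_apply, hU, PowerSeries.coeff_mk, ← hv0]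
    exact hp.coeff_zero _
  have hU1 : coeff 1 U = 1 := by
    rw [hU, PowerSeries.coeff_mk, ← hvd, hp.deriv]
    rfl
  -- The radius is shrunk until the geometric series of all the 1/(z + bᵢ + U) converge absolutely.
  have hev2 : ∀ᶠ r' in 𝓝[>] (0 : ℝ), ∀ i, majorant U r' < ‖z + b i‖ :=
    eventually_all.2 fun i => (hAC.tendsto_majorant hU0 (by exact_mod_cast hr0)).eventually_lt_const
      (norm_pos_iff.2 (hb i))
  obtain ⟨r', hr'1, hr'2⟩ := (hev2.and (Ioc_mem_nhdsGT (show (0 : ℝ) < r by exact_mod_cast hr0))).exists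
  have hAC' := hAC.mono hr'2.1.le hr'2.2
  set G := fun i => PowerSeries.C (1 / (z + b i)) *
    seriesComp (fun ν => (-1 / (z + b i)) ^ ν) U with hG
  have hGC : ∀ i, AbsConv (G i) r' := fun i => hAC'.geom hU0 hr'2.1.le (hr'1 i)
  have hsum : ∀ i ∈ (Finset.univ : Finset (Fin N)),
      AbsConv (PowerSeries.C ((a i : ℂ) ^ 2) * G i) r' :=
    fun i _ => (absConv_C _ _).mul (hGC i) hr'2.1.le
  have hform : PowerSeries.C z + U - ∑ i, PowerSeries.C ((a i : ℂ) ^ 2) * G i =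
      lamSeries a b z := by
    -- Both sides have the same sums near 0, because v solves the equation analytically; hence they
    -- agree as formal series.
    refine AbsConv.ext (((absConv_C z r').add hAC' hr'2.1.le).sub
      (absConv_sum _ hsum hr'2.1.le) hr'2.1.le)
      ((absConv_C _ r').add (absConv_monomial _ _ _) hr'2.1.le) hr'2.1 ?_
    filter_upwards [hev, hv, Metric.ball_mem_nhds (0 : ℂ) hr'2.1] with ε h1 h2 h3
    have h3 : ‖ε‖ ≤ r' := by rw [mem_ball_zero_iff] at h3; exact h3.le
    rw [((absConv_C z r').add hAC' hr'2.1.le).evalAt_sub (absConv_sum _ hsum hr'2.1.le) h3,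
      (absConv_C z r').evalAt_add hAC' h3, evalAt_C, evalAt_sum _ hsum h3, lamSeries,
      (absConv_C _ r').evalAt_add (absConv_monomial _ _ _) h3, evalAt_C, evalAt_monomial, h1]
    change _ = lamHat a b z ε
    rw [← h2.2]
    congr 1
    refine Finset.sum_congr rfl fun i _ => ?_
    rw [(absConv_C _ r').evalAt_mul (hGC i) h3, evalAt_C, div_eq_mul_inv]
    congr 1
    have h4 := congrArg (evalAt · ε) (constantCoeff_mul_seriesComp_geom (hb i) hU0)
    rw [((absConv_C _ r').add hAC' hr'2.1.le).evalAt_mul (hGC i) h3,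
      (absConv_C _ r').evalAt_add hAC' h3, evalAt_C, evalAt_one, h1] at h4
    exact eq_inv_of_mul_eq_one_right h4
  -- Formal uniqueness identifies the recursively defined series with a Taylor series, and this is
  -- what makes it converge.
  have hfin := eq_chiSeries_of_formal hb hκ hU0 hU1 hform
  refine ⟨⟨r, by exact_mod_cast hr0, hfin ▸ hAC⟩, ?_⟩
  rw [chiSeries_eq, ← hform, hfin]
  congr 1
  refine Finset.sum_congr rfl fun i _ => ?_
  rw [invSeries_eq, hG, hfin]

end VNLS

end

noncomputable section
namespace VNLS
open Finset.HasAntidiagonal (antidiagonal mem_antidiagonal)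
open PowerSeries (coeff)

variable {N : ℕ} {a b : Fin N → ℝ} {w z : ℂ}

/-! ### Formal power series in two variables -/

/-- Formal power series in `ε*` (inner variable) and `ε` (outer variable). -/
abbrev BiSeries := PowerSeries (PowerSeries ℂ)

/-- The coefficient of `ε*^m ε^n`. -/
def coeff2 (m n : ℕ) (F : BiSeries) : ℂ := coeff m (coeff n F)

/-- A series in `ε*`. -/
def inner1 : PowerSeries ℂ →+* BiSeries := PowerSeries.C

/-- A series in `ε`. -/
def outer2 : PowerSeries ℂ →+* BiSeries := PowerSeries.map PowerSeries.C

/-- Complex conjugation of the coefficients. -/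
def bar : PowerSeries ℂ →+* PowerSeries ℂ := PowerSeries.map (starRingEnd ℂ)

lemma coeff_bar (f : PowerSeries ℂ) (n : ℕ) : coeff n (bar f) = star (coeff n f) := by
  simp [bar]

lemma constantCoeff_bar {f : PowerSeries ℂ} (hf : PowerSeries.constantCoeff f = 0) :
    PowerSeries.constantCoeff (bar f) = 0 := by
  rw [← PowerSeries.coeff_zero_eq_constantCoeff_apply, coeff_bar,
    PowerSeries.coeff_zero_eq_constantCoeff_apply, hf, star_zero]

lemma coeff2_ext {F G : BiSeries} (h : ∀ m n, coeff2 m n F = coeff2 m n G) : F = G := by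
  ext n m; exact h m n

@[simp] lemma coeff2_add (m n : ℕ) (F G : BiSeries) :
    coeff2 m n (F + G) = coeff2 m n F + coeff2 m n G := by simp [coeff2]

@[simp] lemma coeff2_sub (m n : ℕ) (F G : BiSeries) :
    coeff2 m n (F - G) = coeff2 m n F - coeff2 m n G := by simp [coeff2]

lemma coeff2_sum {ι : Type*} (s : Finset ι) (m n : ℕ) (F : ι → BiSeries) :
    coeff2 m n (∑ i ∈ s, F i) = ∑ i ∈ s, coeff2 m n (F i) := by simp [coeff2]

lemma coeff2_inner1_mul (m n : ℕ) (f : PowerSeries ℂ) (F : BiSeries) :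
    coeff2 m n (inner1 f * F) = coeff m (f * coeff n F) := by
  rw [coeff2, inner1, PowerSeries.coeff_C_mul]

lemma coeff2_C_mul (m n : ℕ) (c : ℂ) (F : BiSeries) :
    coeff2 m n (inner1 (PowerSeries.C c) * F) = c * coeff2 m n F := by
  rw [coeff2_inner1_mul, PowerSeries.coeff_C_mul, coeff2]

lemma outer2_C (c : ℂ) : outer2 (PowerSeries.C c) = inner1 (PowerSeries.C c) := by
  simp [outer2, inner1]

lemma coeff2_inner1_mul_outer2 (m n : ℕ) (f g : PowerSeries ℂ) :
    coeff2 m n (inner1 f * outer2 g) = coeff m f * coeff n g := by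
  rw [coeff2_inner1_mul, outer2, PowerSeries.coeff_map, mul_comm, PowerSeries.coeff_C_mul, mul_comm]

lemma coeff2_mul_congr {F G G' : BiSeries} {m n : ℕ}
    (h : ∀ m' ≤ m, ∀ n' ≤ n, coeff2 m' n' G = coeff2 m' n' G') :
    coeff2 m n (F * G) = coeff2 m n (F * G') := by
  rw [coeff2, coeff2, PowerSeries.coeff_mul, PowerSeries.coeff_mul, map_sum, map_sum]
  refine Finset.sum_congr rfl fun kl hkl => coeff_mul_congr fun m' hm' => ?_
  exact h m' hm' kl.2 (by have := mem_antidiagonal.1 hkl; omega)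

lemma coeff2_mul_inner1_mul_outer2 (m n : ℕ) (F : BiSeries) (f g : PowerSeries ℂ) :
    coeff2 m n (F * inner1 f * outer2 g) = ∑ l ∈ Finset.range (m + 1),
      ∑ r ∈ Finset.range (n + 1), coeff2 l r F * coeff (m - l) f * coeff (n - r) g := by
  rw [coeff2, PowerSeries.coeff_mul, Finset.Nat.sum_antidiagonal_eq_sum_range_succ
    (fun r s => coeff r (F * inner1 f) * coeff s (outer2 g)), map_sum, Finset.sum_comm]
  refine Finset.sum_congr rfl fun r _ => ?_


  rw [outer2, PowerSeries.coeff_map, PowerSeries.coeff_mul_C, inner1, PowerSeries.coeff_mul_C,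
    PowerSeries.coeff_mul, Finset.Nat.sum_antidiagonal_eq_sum_range_succ
    (fun l s => coeff l (coeff r F) * coeff s f), Finset.sum_mul]
  rfl

/-! ### The kernel `1 / (χ̂_k* - χ̂_j)` -/

/-- The series with the coefficients `E^[m,n]`. -/
def kernelSeries (a b : Fin N → ℝ) (w z : ℂ) : BiSeries :=
  PowerSeries.mk fun n => PowerSeries.mk fun m => Ecoeff a b w z m n

lemma coeff2_kernelSeries (m n : ℕ) : coeff2 m n (kernelSeries a b w z) = Ecoeff a b w z m n := by
  simp [coeff2, kernelSeries]

lemma coeff2_add_pow (f g : PowerSeries ℂ) (m n L : ℕ) :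
    coeff2 m n ((inner1 f + outer2 g) ^ L) = ∑ kl ∈ antidiagonal L,
      (L.choose kl.1 : ℂ) * (coeff m (f ^ kl.1) * coeff n (g ^ kl.2)) := by
  rw [(Commute.all _ _).add_pow', coeff2_sum]
  refine Finset.sum_congr rfl fun kl _ => ?_
  rw [← map_pow, ← map_pow, nsmul_eq_mul, ← coeff2_inner1_mul_outer2, ← coeff2_C_mul]
  simp

/-- The terms of the binomial expansions are regrouped by the total degree μ + ν. Pairs with μ > m
or ν > n do not contribute, since f and g have no constant term, and L > m + n leaves room for all
the remaining pairs. -/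
lemma coeff2_geom (f g : PowerSeries ℂ) (hf : PowerSeries.constantCoeff f = 0)
    (hg : PowerSeries.constantCoeff g = 0) {m n L : ℕ} (hL : m + n < L) :
    coeff2 m n (∑ M ∈ Finset.range L, (inner1 f + outer2 g) ^ M) =
      ∑ μ ∈ Finset.range (m + 1), ∑ ν ∈ Finset.range (n + 1),
        ((μ + ν).choose μ : ℂ) * (coeff m (f ^ μ) * coeff n (g ^ ν)) := by
  rw [coeff2_sum, ← Finset.sum_product', ← Finset.sum_fiberwise_of_maps_to
    (s := Finset.range (m + 1) ×ˢ Finset.range (n + 1)) (t := Finset.range L)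
    (g := fun e => e.1 + e.2) (fun e he => by
      simp only [Finset.mem_product, Finset.mem_range] at he ⊢; omega)]
  refine Finset.sum_congr rfl fun M _ => ?_
  rw [coeff2_add_pow]
  symm
  have hsub : (Finset.range (m + 1) ×ˢ Finset.range (n + 1)).filter (fun e => e.1 + e.2 = M) ⊆
      antidiagonal M := fun e he => mem_antidiagonal.2 (Finset.mem_filter.1 he).2
  rw [Finset.sum_congr rfl (g := fun e : ℕ × ℕ => (M.choose e.1 : ℂ) *
    (coeff m (f ^ e.1) * coeff n (g ^ e.2))) fun e he => by rw [(Finset.mem_filter.1 he).2]]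
  refine Finset.sum_subset hsub fun e he he2 => ?_
  have h1 : m < e.1 ∨ n < e.2 := by
    by_contra h
    refine he2 (Finset.mem_filter.2 ⟨?_, mem_antidiagonal.1 he⟩)
    simp only [Finset.mem_product, Finset.mem_range]; omega
  rcases h1 with h1 | h1
  · rw [coeff_pow_eq_zero_of_lt hf h1]; ring
  · rw [coeff_pow_eq_zero_of_lt hg h1]; ring

/-- With d = w* - z one has χ̂_k* - χ̂_j = d (1 - (f + g)), where f and g have no constant term, and
the numbers `Ecoeff` are the coefficients of the geometric series of the inverse. Truncation at
total degree m + n leaves the telescoping remainder (f + g)^(m+n+1), which has no coefficient at (m,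
n). -/
lemma kernelSeries_spec (hwz : star w - z ≠ 0) :
    (inner1 (bar (chiSeries a b w)) - outer2 (chiSeries a b z)) * kernelSeries a b w z = 1 := by
  set d := star w - z with hd
  set f : PowerSeries ℂ := PowerSeries.C (-1 / d) * bar (chiTail a b w) with hf
  set g : PowerSeries ℂ := PowerSeries.C (-1 / d) * (-chiTail a b z) with hg
  have hf0 : PowerSeries.constantCoeff f = 0 := by
    rw [hf, map_mul, constantCoeff_bar constantCoeff_chiTail, mul_zero]
  have hg0 : PowerSeries.constantCoeff g = 0 := by
    rw [hg, map_mul, map_neg, constantCoeff_chiTail, neg_zero, mul_zero]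
  have h1 : inner1 (bar (chiSeries a b w)) - outer2 (chiSeries a b z) =
      inner1 (PowerSeries.C d) * (1 - (inner1 f + outer2 g)) := by
    have h2 : inner1 (PowerSeries.C d) * inner1 (PowerSeries.C (-1 / d)) = -1 := by
      rw [← map_mul, ← map_mul, mul_div_cancel₀ _ hwz]; simp
    rw [chiSeries_eq, chiSeries_eq, map_add, map_add, map_add, hf, hg, map_mul, map_mul,
      outer2_C, outer2_C, map_neg]
    have h3 : inner1 (bar (PowerSeries.C w)) = inner1 (PowerSeries.C d) + inner1 (PowerSeries.C z) := by
      rw [← map_add, ← map_add, hd, sub_add_cancel]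
      simp [bar]
    rw [h3]
    linear_combination (inner1 (bar (chiTail a b w)) - outer2 (chiTail a b z)) * h2
  have h4 : ∀ m n L, m + n < L → coeff2 m n (kernelSeries a b w z) = coeff2 m n
      (inner1 (PowerSeries.C (1 / d)) * ∑ M ∈ Finset.range L, (inner1 f + outer2 g) ^ M) := by
    intro m n L hL
    rw [coeff2_kernelSeries, coeff2_C_mul, coeff2_geom f g hf0 hg0 hL, Ecoeff]
    congr 1
    refine Finset.sum_congr rfl fun μ _ => Finset.sum_congr rfl fun ν _ => ?_
    rw [hf, hg, mul_pow, mul_pow, ← map_pow PowerSeries.C, ← map_pow PowerSeries.C,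
      PowerSeries.coeff_C_mul, PowerSeries.coeff_C_mul, ← map_pow bar, coeff_bar, pow_add, powCoeff, powCoeff]
    have h5 : (PowerSeries.mk fun α => if α = 0 then 0 else -chiCoeff a b z α) =
        -chiTail a b z := by
      ext n; rw [chiTail, map_neg, PowerSeries.coeff_mk, PowerSeries.coeff_mk]; split_ifs <;> simp
    rw [h5]
    change _ * _ * star (coeff m (chiTail a b w ^ μ)) * _ = _
    rw [← hd]
    ring
  refine coeff2_ext fun m n => ?_
  rw [coeff2_mul_congr fun m' hm' n' hn' => h4 m' n' (m + n + 1) (by omega), h1]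
  have h6 : inner1 (PowerSeries.C d) * inner1 (PowerSeries.C (1 / d)) = 1 := by
    rw [← map_mul, ← map_mul, mul_div_cancel₀ _ hwz]; simp
  have h7 : inner1 (PowerSeries.C d) * (1 - (inner1 f + outer2 g)) *
      (inner1 (PowerSeries.C (1 / d)) *
        ∑ M ∈ Finset.range (m + n + 1), (inner1 f + outer2 g) ^ M) =
      1 - (inner1 f + outer2 g) ^ (m + n + 1) := by
    rw [← mul_neg_geom_sum]
    linear_combination (1 - (inner1 f + outer2 g)) *
      (∑ M ∈ Finset.range (m + n + 1), (inner1 f + outer2 g) ^ M) * h6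
  rw [h7, coeff2_sub, coeff2_add_pow, Finset.sum_eq_zero, sub_zero]
  intro e he
  have he := mem_antidiagonal.1 he
  rcases (show m < e.1 ∨ n < e.2 by omega) with h1 | h1
  · rw [coeff_pow_eq_zero_of_lt hf0 h1]; ring
  · rw [coeff_pow_eq_zero_of_lt hg0 h1]; ring

lemma powCoeff_neg (c : ℕ → ℂ) (ν m : ℕ) :
    powCoeff (fun α => -c α) ν m = (-1) ^ ν * powCoeff c ν m := by
  rw [powCoeff, powCoeff]
  have h5 : (PowerSeries.mk fun α => if α = 0 then 0 else -c α) =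
      PowerSeries.C (-1) * (PowerSeries.mk fun α => if α = 0 then 0 else c α) := by
    ext n; rw [PowerSeries.coeff_C_mul, PowerSeries.coeff_mk, PowerSeries.coeff_mk]
    split_ifs <;> simp
  rw [h5, mul_pow, ← map_pow, PowerSeries.coeff_C_mul]

/-- Conjugating 1/(χ̂_k* - χ̂_j) and exchanging the roles of the two series changes the sign. This
makes the Gram matrix skew-Hermitian. -/
lemma star_Ecoeff (m n : ℕ) : star (Ecoeff a b w z m n) = -Ecoeff a b z w n m := by
  have h1 : star (1 / (star w - z)) = -(1 / (star z - w)) := by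
    simp only [star_div₀, star_one, star_sub, star_star]
    rw [← neg_sub, div_neg]
  have h2 : star (-1 / (star w - z)) = 1 / (star z - w) := by
    rw [neg_div, star_neg, h1, neg_neg]
  rw [Ecoeff, Ecoeff, star_mul', h1, neg_mul]
  congr 2
  simp only [star_sum]
  rw [Finset.sum_comm]
  refine Finset.sum_congr rfl fun ν _ => Finset.sum_congr rfl fun μ _ => ?_
  rw [star_mul', star_mul', star_mul', star_pow, h2, star_star, powCoeff_neg, powCoeff_neg,
    star_mul', star_natCast, star_pow, star_neg, star_one, add_comm μ ν, Nat.choose_symm_add,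
    neg_div, neg_pow (1 / (star z - w))]
  have h3 : ((-1 : ℂ) ^ ν) * (-1) ^ ν = 1 := by rw [← mul_pow]; simp
  have h4 : ((-1 : ℂ) ^ (ν + μ)) = (-1) ^ ν * (-1) ^ μ := pow_add _ _ _
  rw [h4]
  have h5 : ((-1 : ℂ) ^ μ) * (-1) ^ μ = 1 := by rw [← mul_pow]; simp
  linear_combination (- (1 / (star z - w)) ^ (ν + μ) * ((ν + μ).choose μ : ℂ) *
    powCoeff (chiCoeff a b w) μ m * star (powCoeff (chiCoeff a b z) ν n) * (-1) ^ ν) * h5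

end VNLS

end

noncomputable section
namespace VNLS
open Finset.HasAntidiagonal (antidiagonal mem_antidiagonal)
open PowerSeries (coeff)

variable {N : ℕ} {a b : Fin N → ℝ} {w z : ℂ}

/-! ### Coefficientwise derivatives -/

/-- Coefficientwise differentiability of a family of power series. -/
def HasCoeffDeriv (F : ℝ → PowerSeries ℂ) (F' : PowerSeries ℂ) (x : ℝ) : Prop :=
  ∀ n, HasDerivAt (fun y => coeff n (F y)) (coeff n F') x

section

variable {F G : ℝ → PowerSeries ℂ} {F' G' : PowerSeries ℂ} {x : ℝ}

lemma hasCoeffDeriv_const (f : PowerSeries ℂ) : HasCoeffDeriv (fun _ => f) 0 x := fun n => by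
  simpa using hasDerivAt_const x (coeff n f)

lemma HasCoeffDeriv.mul (hF : HasCoeffDeriv F F' x) (hG : HasCoeffDeriv G G' x) :
    HasCoeffDeriv (fun y => F y * G y) (F' * G x + F x * G') x := fun n => by
  simp only [map_add, PowerSeries.coeff_mul, ← Finset.sum_add_distrib]
  exact HasDerivAt.fun_sum fun kl _ => (hF kl.1).mul (hG kl.2)

lemma HasCoeffDeriv.const_mul (c : PowerSeries ℂ) (hF : HasCoeffDeriv F F' x) :
    HasCoeffDeriv (fun y => c * F y) (c * F') x := by
  simpa using (hasCoeffDeriv_const c).mul hF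

lemma HasCoeffDeriv.pow (hF : HasCoeffDeriv F F' x) (ν : ℕ) :
    HasCoeffDeriv (fun y => F y ^ (ν + 1)) (((ν + 1 : ℕ) : PowerSeries ℂ) * F x ^ ν * F') x := by
  induction ν with
  | zero => simpa using hF
  | succ ν ih =>
    have := ih.mul hF
    simp only [← pow_succ] at this
    convert this using 1
    push_cast; ring

/-- Termwise differentiation lowers the factorial. Because `F'` has no constant term, the
coefficient n of the derivative involves only the powers below n, and the truncations of the two
sides match. -/
lemma HasCoeffDeriv.seriesComp_exp (hF : HasCoeffDeriv F F' x)
    (h0 : ∀ y, PowerSeries.constantCoeff (F y) = 0) (h0' : PowerSeries.constantCoeff F' = 0) :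
    HasCoeffDeriv (fun y => seriesComp (fun ν => 1 / (ν.factorial : ℂ)) (F y))
      (F' * seriesComp (fun ν => 1 / (ν.factorial : ℂ)) (F x)) x := fun n => by
  have h1 : HasDerivAt (fun y => coeff n (seriesComp (fun ν => 1 / (ν.factorial : ℂ)) (F y)))
      (∑ ν ∈ Finset.range n, 1 / ((ν + 1).factorial : ℂ) *
        coeff n (((ν + 1 : ℕ) : PowerSeries ℂ) * F x ^ ν * F')) x := by
    simp only [seriesComp, PowerSeries.coeff_mk, Finset.sum_range_succ' _ n, pow_zero]
    exact (HasDerivAt.fun_sum fun ν _ => (hF.pow ν n).const_mul _).add_const _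
  convert h1 using 1
  obtain ⟨V, rfl⟩ := PowerSeries.X_dvd_iff.2 h0'
  rcases n with _ | n
  · simp
  · rw [mul_assoc, PowerSeries.coeff_succ_X_mul, coeff_mul_congr (g' := ∑ ν ∈ Finset.range (n + 1),
      PowerSeries.C (1 / (ν.factorial : ℂ)) * F x ^ ν)
      fun m hm => coeff_seriesComp (h0 x) (Nat.lt_succ_of_le hm), Finset.mul_sum, map_sum]
    refine Finset.sum_congr rfl fun ν _ => ?_
    have h2 : ((ν + 1 : ℕ) : PowerSeries ℂ) * F x ^ ν * (PowerSeries.X * V) =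
        PowerSeries.X * (PowerSeries.C ((ν + 1 : ℕ) : ℂ) * (V * F x ^ ν)) := by
      rw [map_natCast]; ring
    rw [h2, PowerSeries.coeff_succ_X_mul, PowerSeries.coeff_C_mul, mul_left_comm,
      PowerSeries.coeff_C_mul, ← mul_assoc, Nat.factorial_succ]
    congr 1
    push_cast
    have h3 : (ν.factorial : ℂ) ≠ 0 := by exact_mod_cast ν.factorial_ne_zero
    have h4 : (ν + 1 : ℂ) ≠ 0 := by exact_mod_cast Nat.succ_ne_zero ν
    field_simp

end

/-! ### The exponential factor -/

/-- The series `∑_{k≥1} X^[k] ε^k`. -/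
def phaseTail (a b : Fin N → ℝ) (z : ℂ) (β : ℕ → ℂ) (x t : ℝ) : PowerSeries ℂ :=
  PowerSeries.mk fun k => if k = 0 then 0 else Xcoeff a b z β x t k

/-- The series `∑ S^[j] ε^j`. -/
def expSeries (a b : Fin N → ℝ) (z : ℂ) (β : ℕ → ℂ) (x t : ℝ) : PowerSeries ℂ :=
  PowerSeries.mk (Scoeff a b z β x t)

/-- The series of `exp ω`. -/
def fullSeries (a b : Fin N → ℝ) (z : ℂ) (β : ℕ → ℂ) (x t : ℝ) : PowerSeries ℂ :=
  PowerSeries.C (exp (Xcoeff a b z β x t 0)) * expSeries a b z β x t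

variable {β : ℕ → ℂ} {x t : ℝ}

lemma constantCoeff_phaseTail : PowerSeries.constantCoeff (phaseTail a b z β x t) = 0 := by
  rw [← PowerSeries.coeff_zero_eq_constantCoeff_apply, phaseTail]; simp

lemma expSeries_eq : expSeries a b z β x t =
    seriesComp (fun ν => 1 / (ν.factorial : ℂ)) (phaseTail a b z β x t) := by
  ext n
  rw [expSeries, seriesComp, PowerSeries.coeff_mk, PowerSeries.coeff_mk, Scoeff]
  exact Finset.sum_congr rfl fun ν _ => by rw [powCoeff, phaseTail]; ring

/-- The inner sum in `Xcoeff` is the Cauchy product, so the X^[k] are the formal coefficients of ω.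
-/
lemma mk_Xcoeff : PowerSeries.mk (Xcoeff a b z β x t) =
    PowerSeries.C (I * x) * chiSeries a b z + PowerSeries.C (I / 2 * t) * chiSeries a b z ^ 2 +
      PowerSeries.mk β := by
  ext n
  rw [map_add, map_add, PowerSeries.coeff_C_mul, PowerSeries.coeff_C_mul, PowerSeries.coeff_mk,
    PowerSeries.coeff_mk, sq, PowerSeries.coeff_mul,
    Finset.Nat.sum_antidiagonal_eq_sum_range_succ_mk, Xcoeff]
  simp only [chiSeries, PowerSeries.coeff_mk]
  ring

lemma phaseTail_eq : phaseTail a b z β x t =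
    PowerSeries.mk (Xcoeff a b z β x t) - PowerSeries.C (Xcoeff a b z β x t 0) := by
  ext n
  rw [phaseTail, map_sub, PowerSeries.coeff_mk, PowerSeries.coeff_mk, PowerSeries.coeff_C]
  split_ifs with h <;> simp [h]

lemma hasDerivAt_Xcoeff_x (k : ℕ) : HasDerivAt (fun y => Xcoeff a b z β y t k)
    (I * chiCoeff a b z k) x := by
  unfold Xcoeff
  have h := (Complex.ofRealCLM.hasDerivAt (x := x)).const_mul (chiCoeff a b z k)
  simp only [Complex.ofRealCLM_apply, Complex.ofReal_one, mul_one] at h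
  exact ((h.add_const _).const_mul I).add_const _

lemma hasDerivAt_Xcoeff_t (k : ℕ) : HasDerivAt (fun y => Xcoeff a b z β x y k)
    (I / 2 * coeff k (chiSeries a b z ^ 2)) t := by
  have h1 : ∀ y, Xcoeff a b z β x y k = (I * x * coeff k (chiSeries a b z) + coeff k (PowerSeries.mk β)) +
      I / 2 * coeff k (chiSeries a b z ^ 2) * y := by
    intro y
    have := congrArg (coeff k) (mk_Xcoeff (a := a) (b := b) (z := z) (β := β) (x := x) (t := y))
    rw [PowerSeries.coeff_mk, map_add, map_add, PowerSeries.coeff_C_mul,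
      PowerSeries.coeff_C_mul] at this
    rw [this]; ring
  simp only [h1]
  have h := (Complex.ofRealCLM.hasDerivAt (x := t)).const_mul
    (I / 2 * coeff k (chiSeries a b z ^ 2))
  simp only [Complex.ofRealCLM_apply, Complex.ofReal_one, mul_one] at h
  exact h.const_add _

/-- This is (e^X)' = X' e^X for formal series. The constant term of X has to be exponentiated as a
number, because only the tail may be substituted into a series; D is split accordingly. -/
lemma hasCoeffDeriv_fullSeries_aux {X : ℝ → ℕ → ℂ} {D : PowerSeries ℂ} {y : ℝ}
    (h : ∀ k, HasDerivAt (fun y => X y k) (coeff k D) y) :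
    HasCoeffDeriv (fun y => PowerSeries.C (exp (X y 0)) *
        seriesComp (fun ν => 1 / (ν.factorial : ℂ))
          (PowerSeries.mk fun k => if k = 0 then 0 else X y k))
      (D * (PowerSeries.C (exp (X y 0)) * seriesComp (fun ν => 1 / (ν.factorial : ℂ))
          (PowerSeries.mk fun k => if k = 0 then 0 else X y k))) y := by
  have h0 : ∀ y, PowerSeries.constantCoeff
      (PowerSeries.mk fun k => if k = 0 then 0 else X y k) = 0 := fun y => by
    rw [← PowerSeries.coeff_zero_eq_constantCoeff_apply]; simp
  set D' := D - PowerSeries.C (PowerSeries.constantCoeff D) with hD'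
  have h0' : PowerSeries.constantCoeff D' = 0 := by simp [hD']
  have h1 : HasCoeffDeriv (fun y => PowerSeries.mk fun k => if k = 0 then 0 else X y k) D' y := by
    intro n
    simp only [PowerSeries.coeff_mk]
    split_ifs with hn
    · rw [hn, PowerSeries.coeff_zero_eq_constantCoeff_apply, h0']
      exact hasDerivAt_const _ _
    · rw [hD', map_sub, PowerSeries.coeff_C, if_neg hn, sub_zero]; exact h n
  have h2 : HasCoeffDeriv (fun y => PowerSeries.C (exp (X y 0)))
      (PowerSeries.C (exp (X y 0) * PowerSeries.constantCoeff D)) y := by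
    intro n
    simp only [PowerSeries.coeff_C]
    split_ifs with hn
    · rw [← PowerSeries.coeff_zero_eq_constantCoeff_apply]; exact (h 0).cexp
    · exact hasDerivAt_const _ _
  have h3 := h2.mul (h1.seriesComp_exp h0 h0')
  have h4 : D = D' + PowerSeries.C (PowerSeries.constantCoeff D) := by rw [hD']; ring
  convert h3 using 1
  conv_lhs => rw [h4]
  rw [map_mul]; ring

lemma fullSeries_eq : fullSeries a b z β x t = PowerSeries.C (exp (Xcoeff a b z β x t 0)) *
    seriesComp (fun ν => 1 / (ν.factorial : ℂ))
      (PowerSeries.mk fun k => if k = 0 then 0 else Xcoeff a b z β x t k) := by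
  rw [fullSeries, expSeries_eq, phaseTail]

lemma hasCoeffDeriv_fullSeries_x : HasCoeffDeriv (fun y => fullSeries a b z β y t)
    (PowerSeries.C I * chiSeries a b z * fullSeries a b z β x t) x := by
  simp only [fullSeries_eq]
  refine hasCoeffDeriv_fullSeries_aux (X := fun y => Xcoeff a b z β y t) fun k => ?_
  rw [PowerSeries.coeff_C_mul, chiSeries, PowerSeries.coeff_mk]
  exact hasDerivAt_Xcoeff_x k

lemma hasCoeffDeriv_fullSeries_t : HasCoeffDeriv (fun y => fullSeries a b z β x y)
    (PowerSeries.C (I / 2) * chiSeries a b z ^ 2 * fullSeries a b z β x t) t := by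
  simp only [fullSeries_eq]
  refine hasCoeffDeriv_fullSeries_aux (X := fun y => Xcoeff a b z β x y) fun k => ?_
  rw [PowerSeries.coeff_C_mul]
  exact hasDerivAt_Xcoeff_t k

/-! ### The kernel with exponential factors -/

variable {βw βz : ℕ → ℂ}

/-- The series with the coefficients `exp (X_k^[0]* + X_j^[0]) H_{k,j}^[m,n]`. -/
def gramSeries (a b : Fin N → ℝ) (w z : ℂ) (βw βz : ℕ → ℂ) (x t : ℝ) : BiSeries :=
  kernelSeries a b w z * inner1 (bar (fullSeries a b w βw x t)) * outer2 (fullSeries a b z βz x t)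

lemma coeff2_expSeries (F : BiSeries) (m n : ℕ) :
    coeff2 m n (F * inner1 (bar (fullSeries a b w βw x t)) * outer2 (fullSeries a b z βz x t)) =
      star (exp (Xcoeff a b w βw x t 0)) * exp (Xcoeff a b z βz x t 0) *
        ∑ l ∈ Finset.range (m + 1), ∑ r ∈ Finset.range (n + 1), coeff2 l r F *
          star (Scoeff a b w βw x t (m - l)) * Scoeff a b z βz x t (n - r) := by
  rw [coeff2_mul_inner1_mul_outer2, Finset.mul_sum]
  refine Finset.sum_congr rfl fun l _ => ?_
  rw [Finset.mul_sum]
  refine Finset.sum_congr rfl fun r _ => ?_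
  rw [coeff_bar, fullSeries, fullSeries, PowerSeries.coeff_C_mul, PowerSeries.coeff_C_mul,
    star_mul', expSeries, expSeries, PowerSeries.coeff_mk, PowerSeries.coeff_mk]
  ring

lemma coeff2_gramSeries (m n : ℕ) : coeff2 m n (gramSeries a b w z βw βz x t) =
    star (exp (Xcoeff a b w βw x t 0)) * exp (Xcoeff a b z βz x t 0) *
      Hcoeff a b w z βw βz x t m n := by
  rw [gramSeries, coeff2_expSeries, Hcoeff]
  simp only [coeff2_kernelSeries]

lemma hasDerivAt_coeff2 {F : ℝ → PowerSeries ℂ} {G : ℝ → PowerSeries ℂ} {F' G' : PowerSeries ℂ}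
    {y : ℝ} (hF : HasCoeffDeriv F F' y) (hG : HasCoeffDeriv G G' y) (E : BiSeries) (m n : ℕ) :
    HasDerivAt (fun y => coeff2 m n (E * inner1 (bar (F y)) * outer2 (G y)))
      (coeff2 m n (E * inner1 (bar F') * outer2 (G y) + E * inner1 (bar (F y)) * outer2 G')) y := by
  simp only [coeff2_add, coeff2_mul_inner1_mul_outer2, coeff_bar, ← Finset.sum_add_distrib]
  refine HasDerivAt.fun_sum fun l _ => HasDerivAt.fun_sum fun r _ => ?_
  exact (((hF (m - l)).star).const_mul _).mul (hG (n - r))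

/-- Differentiation multiplies by -i (χ̂_k* - χ̂_j), which cancels the kernel and leaves a product
of a series in ε* and a series in ε. -/
lemma hasDerivAt_gramSeries_x (hwz : star w - z ≠ 0) (m n : ℕ) :
    HasDerivAt (fun y => coeff2 m n (gramSeries a b w z βw βz y t))
      (-I * (star (coeff m (fullSeries a b w βw x t)) * coeff n (fullSeries a b z βz x t))) x := by
  have h2 := hasDerivAt_coeff2 (hasCoeffDeriv_fullSeries_x (a := a) (b := b) (z := w) (β := βw)
    (x := x) (t := t)) (hasCoeffDeriv_fullSeries_x (a := a) (b := b) (z := z) (β := βz)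
    (x := x) (t := t)) (kernelSeries a b w z) m n
  refine h2.congr_deriv ?_
  have h := kernelSeries_spec (a := a) (b := b) hwz
  rw [← coeff_bar, ← coeff2_inner1_mul_outer2, neg_mul, ← coeff2_C_mul, ← neg_one_mul,
    ← coeff2_C_mul]
  congr 1
  have h1 : bar (PowerSeries.C I) = -PowerSeries.C I := by simp [bar]
  simp only [map_mul, h1, outer2_C, map_neg, map_one]
  linear_combination (-inner1 (PowerSeries.C I) * inner1 (bar (fullSeries a b w βw x t)) *
    outer2 (fullSeries a b z βz x t)) * h

/-- The factor is now -(i/2)(χ̂_k*² - χ̂_j²); after cancellation of the kernel, χ̂_k* + χ̂_j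
remains, which produces one x-derivative on either exponential. -/
lemma hasDerivAt_gramSeries_t (hwz : star w - z ≠ 0) (m n : ℕ) :
    HasDerivAt (fun y => coeff2 m n (gramSeries a b w z βw βz x y))
      (1 / 2 * (star (coeff m (PowerSeries.C I * chiSeries a b w * fullSeries a b w βw x t)) *
          coeff n (fullSeries a b z βz x t) -
        star (coeff m (fullSeries a b w βw x t)) *
          coeff n (PowerSeries.C I * chiSeries a b z * fullSeries a b z βz x t))) t := by
  have h2 := hasDerivAt_coeff2 (hasCoeffDeriv_fullSeries_t (a := a) (b := b) (z := w) (β := βw)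
    (x := x) (t := t)) (hasCoeffDeriv_fullSeries_t (a := a) (b := b) (z := z) (β := βz)
    (x := x) (t := t)) (kernelSeries a b w z) m n
  refine h2.congr_deriv ?_
  have h := kernelSeries_spec (a := a) (b := b) hwz
  rw [← coeff_bar, ← coeff2_inner1_mul_outer2, ← coeff_bar, ← coeff2_inner1_mul_outer2,
    ← coeff2_sub, ← coeff2_C_mul]
  congr 1
  have h1 : bar (PowerSeries.C I) = -PowerSeries.C I := by simp [bar]
  have h3 : PowerSeries.C (I / 2) = PowerSeries.C (1 / 2) * PowerSeries.C I := by
    rw [← map_mul]; congr 1; ring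
  have h4 : bar (PowerSeries.C (1 / 2)) = PowerSeries.C (1 / 2) := by
    have h5 : (starRingEnd ℂ) (1 / 2) = 1 / 2 := by simp [map_ofNat]
    rw [bar, PowerSeries.map_C, h5]
  simp only [h3, map_mul, map_pow, h1, h4, outer2_C, map_neg]
  linear_combination (-inner1 (PowerSeries.C (1 / 2)) * inner1 (PowerSeries.C I) *
    inner1 (bar (fullSeries a b w βw x t)) * outer2 (fullSeries a b z βz x t) *
    (inner1 (bar (chiSeries a b w)) + outer2 (chiSeries a b z))) * h

/-! ### The Lyapunov equation for formal series -/

lemma chiSeries_add_mul_invSeries {i : Fin N} (hb : z + b i ≠ 0) :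
    (chiSeries a b z + PowerSeries.C (b i : ℂ)) * invSeries a b z i = 1 := by
  rw [← constantCoeff_mul_seriesComp_geom hb (constantCoeff_chiTail (a := a) (b := b) (z := z)),
    invSeries_eq, chiSeries_eq, map_add]
  ring

lemma bar_C_ofReal (x : ℝ) : bar (PowerSeries.C (x : ℂ)) = PowerSeries.C (x : ℂ) := by simp [bar]

/-- The Lyapunov equation of the kernel. -/
lemma lamSeries_mul_gramSeries (hb : ∀ i, w + b i ≠ 0) (hκ : 1 ≤ kappa a b w)
    (hb' : ∀ i, z + b i ≠ 0) (hκ' : 1 ≤ kappa a b z) (hwz : star w - z ≠ 0) :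
    (inner1 (bar (lamSeries a b w)) - outer2 (lamSeries a b z)) * gramSeries a b w z βw βz x t =
      inner1 (bar (fullSeries a b w βw x t)) * outer2 (fullSeries a b z βz x t) +
      ∑ i, inner1 (PowerSeries.C ((a i : ℂ) ^ 2)) *
        (inner1 (bar (invSeries a b w i * fullSeries a b w βw x t)) *
        outer2 (invSeries a b z i * fullSeries a b z βz x t)) := by
  have h := kernelSeries_spec (a := a) (b := b) hwz
  rw [← (chiSeries_spec hb hκ).2, ← (chiSeries_spec hb' hκ').2, gramSeries]
  -- From λ̂ = χ̂ - ∑ aᵢ²/(χ̂ + bᵢ) and 1/(χ̂_k* + bᵢ) - 1/(χ̂_j + bᵢ) = -(χ̂_k* - χ̂_j)/((χ̂_k* +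
  -- bᵢ)(χ̂_j + bᵢ)), the difference λ̂_k* - λ̂_j contains the factor χ̂_k* - χ̂_j, which the kernel
  -- inverts.
  have h2 : inner1 (bar (chiSeries a b w - ∑ i, PowerSeries.C ((a i : ℂ) ^ 2) *
        invSeries a b w i)) - outer2 (chiSeries a b z - ∑ i, PowerSeries.C ((a i : ℂ) ^ 2) *
        invSeries a b z i) = (inner1 (bar (chiSeries a b w)) - outer2 (chiSeries a b z)) *
      (1 + ∑ i, inner1 (PowerSeries.C ((a i : ℂ) ^ 2)) * (inner1 (bar (invSeries a b w i)) *
        outer2 (invSeries a b z i))) := by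
    simp only [map_sub, map_sum, map_mul, outer2_C, mul_add, mul_one, Finset.mul_sum]
    rw [sub_sub_sub_comm, sub_eq_add_neg, ← Finset.sum_sub_distrib, ← Finset.sum_neg_distrib]
    congr 1
    refine Finset.sum_congr rfl fun i _ => ?_
    have h3 := congrArg (fun f => inner1 (bar f)) (chiSeries_add_mul_invSeries (a := a) (hb i))
    have h4 := congrArg outer2 (chiSeries_add_mul_invSeries (a := a) (hb' i))
    simp only [map_mul, map_add, map_one, bar_C_ofReal, outer2_C] at h3 h4
    have h5 : bar (PowerSeries.C ((a i : ℂ) ^ 2)) = PowerSeries.C ((a i : ℂ) ^ 2) := by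
      simp [bar]
    rw [h5]
    linear_combination (-inner1 (PowerSeries.C ((a i : ℂ) ^ 2)) * outer2 (invSeries a b z i)) * h3
      + (inner1 (PowerSeries.C ((a i : ℂ) ^ 2)) * inner1 (bar (invSeries a b w i))) * h4
  rw [h2]
  have h6 : ∀ i, inner1 (PowerSeries.C ((a i : ℂ) ^ 2)) *
        (inner1 (bar (invSeries a b w i * fullSeries a b w βw x t)) *
        outer2 (invSeries a b z i * fullSeries a b z βz x t)) =
      inner1 (PowerSeries.C ((a i : ℂ) ^ 2)) * (inner1 (bar (invSeries a b w i)) *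
        outer2 (invSeries a b z i)) * (inner1 (bar (fullSeries a b w βw x t)) *
          outer2 (fullSeries a b z βz x t)) := fun i => by simp only [map_mul]; ring
  simp only [h6, ← Finset.sum_mul]
  linear_combination ((1 + ∑ i, inner1 (PowerSeries.C ((a i : ℂ) ^ 2)) *
    (inner1 (bar (invSeries a b w i)) * outer2 (invSeries a b z i))) *
    inner1 (bar (fullSeries a b w βw x t)) * outer2 (fullSeries a b z βz x t)) * h

lemma lamSeries_eq : lamSeries a b z = PowerSeries.C (lam0 a b z) +
    PowerSeries.C (alpha a b z) * PowerSeries.X ^ (kappa a b z + 1) := by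
  ext n
  rw [lamSeries, map_add, map_add, PowerSeries.coeff_monomial, PowerSeries.coeff_C_mul,
    PowerSeries.coeff_X_pow]
  simp

/-- λ̂ is a constant plus a single monomial of degree κ + 1, so multiplication by it is a scalar
plus a shift of the index by κ + 1. -/
lemma coeff2_lamSeries_inner (m n : ℕ) (F : BiSeries) :
    coeff2 m n (inner1 (bar (lamSeries a b w)) * F) = star (lam0 a b w) * coeff2 m n F +
      star (alpha a b w) *
        if kappa a b w + 1 ≤ m then coeff2 (m - (kappa a b w + 1)) n F else 0 := by
  have h1 : bar (lamSeries a b w) = PowerSeries.C (star (lam0 a b w)) +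
      PowerSeries.C (star (alpha a b w)) * PowerSeries.X ^ (kappa a b w + 1) := by
    rw [lamSeries_eq, map_add, map_mul]
    simp [bar]
  rw [coeff2_inner1_mul, h1, add_mul, map_add, PowerSeries.coeff_C_mul, mul_assoc,
    PowerSeries.coeff_C_mul, PowerSeries.coeff_X_pow_mul']
  rfl

lemma coeff2_lamSeries_outer (m n : ℕ) (F : BiSeries) :
    coeff2 m n (outer2 (lamSeries a b z) * F) = lam0 a b z * coeff2 m n F +
      alpha a b z *
        if kappa a b z + 1 ≤ n then coeff2 m (n - (kappa a b z + 1)) F else 0 := by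
  have h1 : outer2 (lamSeries a b z) = inner1 (PowerSeries.C (lam0 a b z)) +
      inner1 (PowerSeries.C (alpha a b z)) * PowerSeries.X ^ (kappa a b z + 1) := by
    rw [lamSeries_eq, map_add, map_mul, outer2_C, outer2_C]
    simp [outer2]
  rw [h1, add_mul, coeff2_add, coeff2_C_mul, mul_assoc, coeff2_C_mul]
  congr 2
  rw [coeff2, PowerSeries.coeff_X_pow_mul']
  split_ifs <;> simp [coeff2]

lemma coeff_lamSeries (n : ℕ) (F : PowerSeries ℂ) :
    coeff n (lamSeries a b z * F) = lam0 a b z * coeff n F +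
      alpha a b z * if kappa a b z + 1 ≤ n then coeff (n - (kappa a b z + 1)) F else 0 := by
  rw [lamSeries_eq, add_mul, map_add, PowerSeries.coeff_C_mul, mul_assoc,
    PowerSeries.coeff_C_mul, PowerSeries.coeff_X_pow_mul']

lemma coeff2_EcoeffI (i : Fin N) (m n : ℕ) : coeff2 m n (kernelSeries a b w z *
      inner1 (bar (chiSeries a b w + PowerSeries.C (b i : ℂ))) * outer2 (invSeries a b z i)) =
    EcoeffI a b w z i m n := by
  rw [coeff2_mul_inner1_mul_outer2, EcoeffI]
  refine Finset.sum_congr rfl fun l _ => Finset.sum_congr rfl fun r _ => ?_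
  rw [coeff2_kernelSeries, coeff_bar, invSeries, PowerSeries.coeff_mk, shiftCoeff, map_add,
    chiSeries, PowerSeries.coeff_mk, PowerSeries.coeff_C]

/-- `H^[i;m,n]` differs from `H^[m,n]` by a product. -/
lemma coeff2_gramSeriesI (i : Fin N) (hb : z + b i ≠ 0) (hwz : star w - z ≠ 0) (m n : ℕ) :
    star (exp (Xcoeff a b w βw x t 0)) * exp (Xcoeff a b z βz x t 0) *
        HcoeffI a b w z βw βz i x t m n =
      coeff2 m n (gramSeries a b w z βw βz x t) + star (coeff m (fullSeries a b w βw x t)) *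
        coeff n (invSeries a b z i * fullSeries a b z βz x t) := by
  rw [HcoeffI]
  simp only [← coeff2_EcoeffI]
  rw [← coeff2_expSeries, ← coeff_bar, ← coeff2_inner1_mul_outer2, ← coeff2_add]
  congr 1
  have h := kernelSeries_spec (a := a) (b := b) hwz
  have h4 := congrArg outer2 (chiSeries_add_mul_invSeries (a := a) hb)
  simp only [map_mul, map_add, map_one, bar_C_ofReal, outer2_C] at h4 ⊢
  rw [gramSeries]
  -- The reason is (χ̂_k* + bᵢ)/(χ̂_j + bᵢ) = 1 + (χ̂_k* - χ̂_j)/(χ̂_j + bᵢ): the second summand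
  -- cancels the kernel.
  linear_combination (inner1 (bar (fullSeries a b w βw x t)) *
    outer2 (fullSeries a b z βz x t) * outer2 (invSeries a b z i)) * h +
    (kernelSeries a b w z * inner1 (bar (fullSeries a b w βw x t)) *
    outer2 (fullSeries a b z βz x t)) * h4

lemma star_coeff2_gramSeries (m n : ℕ) :
    star (coeff2 m n (gramSeries a b w z βw βz x t)) =
      -coeff2 n m (gramSeries a b z w βz βw x t) := by
  rw [coeff2_gramSeries, coeff2_gramSeries, Hcoeff, Hcoeff, star_mul', star_mul', star_star]
  simp only [star_sum]
  rw [Finset.sum_comm, ← mul_neg, mul_comm (exp _), ← Finset.sum_neg_distrib]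
  congr 1
  refine Finset.sum_congr rfl fun r _ => ?_
  rw [← Finset.sum_neg_distrib]
  refine Finset.sum_congr rfl fun l _ => ?_
  rw [star_mul', star_mul', star_star, star_Ecoeff]
  ring

end VNLS

end

noncomputable section
namespace VNLS
open Finset.HasAntidiagonal (antidiagonal mem_antidiagonal)
open PowerSeries (coeff)

variable {N : ℕ}

/-! ### Dressing with a matrix spectral parameter -/

section Dressing

variable {ι : Type*} [Fintype ι]

/-- The bilinear form `p W qᵀ`. -/
def bracket (W : Matrix ι ι ℂ) (p q : ι → ℂ) : ℂ := p ⬝ᵥ W *ᵥ q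

lemma bracket_add_left (W : Matrix ι ι ℂ) (p p' q : ι → ℂ) :
    bracket W (p + p') q = bracket W p q + bracket W p' q := add_dotProduct _ _ _

lemma bracket_sub_left (W : Matrix ι ι ℂ) (p p' q : ι → ℂ) :
    bracket W (p - p') q = bracket W p q - bracket W p' q := sub_dotProduct _ _ _

lemma bracket_smul_left (W : Matrix ι ι ℂ) (c : ℂ) (p q : ι → ℂ) :
    bracket W (c • p) q = c * bracket W p q := smul_dotProduct _ _ _

lemma bracket_sum_left {κ : Type*} (s : Finset κ) (W : Matrix ι ι ℂ) (p : κ → ι → ℂ) (q : ι → ℂ) :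
    bracket W (∑ i ∈ s, p i) q = ∑ i ∈ s, bracket W (p i) q := sum_dotProduct _ _ _

lemma bracket_add_right (W : Matrix ι ι ℂ) (p q q' : ι → ℂ) :
    bracket W p (q + q') = bracket W p q + bracket W p q' := by
  rw [bracket, Matrix.mulVec_add, dotProduct_add]; rfl

lemma bracket_sub_right (W : Matrix ι ι ℂ) (p q q' : ι → ℂ) :
    bracket W p (q - q') = bracket W p q - bracket W p q' := by
  rw [bracket, Matrix.mulVec_sub, dotProduct_sub]; rfl

lemma bracket_smul_right (W : Matrix ι ι ℂ) (c : ℂ) (p q : ι → ℂ) :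
    bracket W p (c • q) = c * bracket W p q := by
  rw [bracket, Matrix.mulVec_smul, dotProduct_smul]; rfl

lemma bracket_sum_right {κ : Type*} (s : Finset κ) (W : Matrix ι ι ℂ) (p : ι → ℂ) (q : κ → ι → ℂ) :
    bracket W p (∑ i ∈ s, q i) = ∑ i ∈ s, bracket W p (q i) := by
  rw [bracket, Matrix.mulVec_sum, dotProduct_sum]; rfl

lemma vecMulVec_mulVec' (u v w : ι → ℂ) : Matrix.vecMulVec u v *ᵥ w = (v ⬝ᵥ w) • u := by
  ext i
  simp only [Matrix.mulVec, dotProduct, Matrix.vecMulVec_apply, Pi.smul_apply, smul_eq_mul,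
    Finset.sum_mul]
  exact Finset.sum_congr rfl fun _ _ => by ring

lemma star_bracket {W : Matrix ι ι ℂ} (hW : Wᴴ = -W) (p q : ι → ℂ) :
    star (bracket W p q) = -bracket W (star q) (star p) := by
  rw [bracket, ← Matrix.star_dotProduct_star, Matrix.star_mulVec, hW, bracket, Matrix.vecMul_neg,
    neg_dotProduct, Matrix.dotProduct_mulVec]

variable [DecidableEq ι]

lemma differentiableAt_det {M : ℝ → Matrix ι ι ℂ} {x : ℝ}
    (h : ∀ r s, DifferentiableAt ℝ (fun y => M y r s) x) :
    DifferentiableAt ℝ (fun y => (M y).det) x := by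
  simp only [Matrix.det_apply']
  exact DifferentiableAt.fun_sum fun σ _ => (DifferentiableAt.fun_finsetProd fun i _ => h _ _).const_mul _

lemma differentiableAt_inv {M : ℝ → Matrix ι ι ℂ} {x : ℝ}
    (h : ∀ r s, DifferentiableAt ℝ (fun y => M y r s) x) (hdet : (M x).det ≠ 0) (r s : ι) :
    DifferentiableAt ℝ (fun y => (M y)⁻¹ r s) x := by
  simp only [Matrix.inv_def, Matrix.smul_apply, smul_eq_mul, Ring.inverse_eq_inv', Matrix.adjugate_apply]
  refine ((differentiableAt_det h).fun_inv hdet).mul (differentiableAt_det fun r' s' => ?_)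
  by_cases hr : r' = s
  · subst hr; simp
  · simpa [Matrix.updateRow_ne hr] using h r' s'

/-- Differentiability comes from the adjugate formula; the value of the derivative is then forced by
differentiating M M⁻¹ = 1. -/
lemma hasDerivAt_inv {M : ℝ → Matrix ι ι ℂ} {M' : Matrix ι ι ℂ} {x : ℝ}
    (h : ∀ r s, HasDerivAt (fun y => M y r s) (M' r s) x) (hdet : ∀ y, (M y).det ≠ 0) (r s : ι) :
    HasDerivAt (fun y => (M y)⁻¹ r s) ((-((M x)⁻¹ * M' * (M x)⁻¹)) r s) x := by
  set W' : Matrix ι ι ℂ := Matrix.of fun r s => deriv (fun y => (M y)⁻¹ r s) x with hW'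
  have hd : ∀ r s, HasDerivAt (fun y => (M y)⁻¹ r s) (W' r s) x := fun r s =>
    (differentiableAt_inv (fun r s => (h r s).differentiableAt) (hdet x) r s).hasDerivAt
  have h1 : M' * (M x)⁻¹ + M x * W' = 0 := by
    ext r s
    have h2 : HasDerivAt (fun y => (M y * (M y)⁻¹) r s) ((M' * (M x)⁻¹ + M x * W') r s) x := by
      simp only [Matrix.mul_apply, Matrix.add_apply, ← Finset.sum_add_distrib]
      exact HasDerivAt.fun_sum fun k _ => (h r k).mul (hd k s)
    have h3 : (fun y => (M y * (M y)⁻¹) r s) = fun _ => (1 : Matrix ι ι ℂ) r s := by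
      funext y; rw [Matrix.mul_nonsing_inv _ (isUnit_iff_ne_zero.2 (hdet y))]
    rw [h3] at h2
    exact h2.unique (hasDerivAt_const _ _)
  have h4 : W' = -((M x)⁻¹ * M' * (M x)⁻¹) := by
    have h5 := congrArg ((M x)⁻¹ * ·) (eq_neg_of_add_eq_zero_right h1)
    rw [← Matrix.mul_assoc, Matrix.nonsing_inv_mul _ (isUnit_iff_ne_zero.2 (hdet x)),
      Matrix.one_mul] at h5
    rw [h5, Matrix.mul_neg, Matrix.mul_assoc]
  rw [← h4]; exact hd r s

lemma hasDerivAt_bracket {M : ℝ → Matrix ι ι ℂ} {M' : Matrix ι ι ℂ} {p q : ℝ → ι → ℂ}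
    {p' q' : ι → ℂ} {x : ℝ} (h : ∀ r s, HasDerivAt (fun y => M y r s) (M' r s) x)
    (hdet : ∀ y, (M y).det ≠ 0) (hp : HasDerivAt p p' x) (hq : HasDerivAt q q' x) :
    HasDerivAt (fun y => bracket (M y)⁻¹ (p y) (q y))
      (bracket (M x)⁻¹ p' (q x) + bracket (M x)⁻¹ (p x) q' -
        bracket (M x)⁻¹ (p x) (M' *ᵥ ((M x)⁻¹ *ᵥ q x))) x := by
  have hp := hasDerivAt_pi.1 hp
  have hq := hasDerivAt_pi.1 hq
  have h1 : HasDerivAt (fun y => bracket (M y)⁻¹ (p y) (q y))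
      (∑ r, (p' r * ∑ s, (M x)⁻¹ r s * q x s + p x r *
        ∑ s, ((-((M x)⁻¹ * M' * (M x)⁻¹)) r s * q x s + (M x)⁻¹ r s * q' s))) x := by
    simp only [bracket, dotProduct, Matrix.mulVec]
    exact HasDerivAt.fun_sum fun r _ => (hp r).mul
      (HasDerivAt.fun_sum fun s _ => (hasDerivAt_inv h hdet r s).mul (hq s))
  refine h1.congr_deriv ?_
  have h2 : bracket (M x)⁻¹ (p x) (M' *ᵥ ((M x)⁻¹ *ᵥ q x)) =
      bracket ((M x)⁻¹ * M' * (M x)⁻¹) (p x) (q x) := by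
    simp only [bracket, Matrix.mulVec_mulVec, Matrix.mul_assoc]
  rw [h2]
  simp only [bracket, dotProduct, Matrix.mulVec, Finset.sum_add_distrib, mul_add, Matrix.neg_apply,
    neg_mul, Finset.sum_neg_distrib, mul_neg]
  ring

/-- The algebraic identity behind the dressing formula. -/
lemma dressing_identity {M Λ : Matrix ι ι ℂ} {φ u : ι → ℂ} {ψ : Fin N → ι → ℂ} {q : Fin N → ℂ}
    (hskew : Mᴴ = -M) (hdet : M.det ≠ 0)
    (hu : u = I • (φ ᵥ* Λ + ∑ i, star (q i) • ψ i))
    (hL : Λᴴ * M - M * Λ = Matrix.vecMulVec (star φ) φ + ∑ i, Matrix.vecMulVec (star (ψ i)) (ψ i)) :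
    I * (bracket M⁻¹ u (star φ) + bracket M⁻¹ φ (star u)) - bracket M⁻¹ φ (star φ) ^ 2 +
      ∑ i, (q i + bracket M⁻¹ (ψ i) (star φ)) * star (q i + bracket M⁻¹ (ψ i) (star φ)) -
      ∑ i, q i * star (q i) = 0 := by
  have hunit := isUnit_iff_ne_zero.2 hdet
  have hWs : (M⁻¹)ᴴ = -M⁻¹ := by
    rw [Matrix.conjTranspose_nonsing_inv, hskew]
    refine Matrix.inv_eq_right_inv ?_
    rw [neg_mul_neg, Matrix.mul_nonsing_inv _ hunit]
  set W := M⁻¹ with hW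
  have h1 : ∀ i, bracket W φ (star (ψ i)) = -star (bracket W (ψ i) (star φ)) := fun i => by
    rw [star_bracket hWs, star_star, neg_neg]
  have h2 : bracket W φ (Λᴴ *ᵥ star φ) - bracket W (φ ᵥ* Λ) (star φ) =
      bracket W φ (star φ) ^ 2 +
        ∑ i, bracket W φ (star (ψ i)) * bracket W (ψ i) (star φ) := by
    -- Multiplying the Lyapunov equation by the inverse matrix on both sides turns it into an
    -- identity between brackets, in which the rank-one terms on the right become products of two
    -- brackets.
    have h3 : W * (Λᴴ * M - M * Λ) * W = W * Λᴴ - Λ * W := by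
      rw [Matrix.mul_sub, Matrix.sub_mul, ← Matrix.mul_assoc, Matrix.mul_assoc (W * Λᴴ),
        Matrix.mul_nonsing_inv _ hunit, Matrix.mul_one, ← Matrix.mul_assoc W M Λ,
        Matrix.nonsing_inv_mul _ hunit, Matrix.one_mul]
    have h4 : bracket W φ (Λᴴ *ᵥ star φ) - bracket W (φ ᵥ* Λ) (star φ) =
        bracket (W * Λᴴ - Λ * W) φ (star φ) := by
      simp only [bracket, Matrix.sub_mulVec, dotProduct_sub, ← Matrix.mulVec_mulVec,
        Matrix.dotProduct_mulVec]
    have h5 : ∀ X : Matrix ι ι ℂ, bracket (W * X * W) φ (star φ) =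
        bracket W φ (X *ᵥ (W *ᵥ star φ)) := fun X => by
      simp only [bracket, Matrix.mulVec_mulVec, Matrix.mul_assoc]
    rw [h4, ← h3, h5, hL, Matrix.add_mulVec, Matrix.sum_mulVec, bracket_add_right,
      bracket_sum_right]
    simp only [vecMulVec_mulVec', bracket_smul_right]
    simp only [bracket]
    rw [sq]
    congr 1
    exact Finset.sum_congr rfl fun _ _ => mul_comm _ _
  have h6 : star u = -I • (Λᴴ *ᵥ star φ + ∑ i, q i • star (ψ i)) := by
    rw [hu, star_smul, star_add, Matrix.star_vecMul, star_sum]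
    simp only [star_smul, star_star]
    congr 1
    simp
  rw [h6, hu]
  simp only [bracket_smul_left, bracket_smul_right, bracket_add_left, bracket_add_right,
    bracket_sum_left, bracket_sum_right, h1]
  simp only [h1] at h2
  have h7 : ∑ i, (q i + bracket W (ψ i) (star φ)) * star (q i + bracket W (ψ i) (star φ)) =
      ∑ i, q i * star (q i) + ∑ i, star (q i) * bracket W (ψ i) (star φ)
        - ∑ i, q i * -star (bracket W (ψ i) (star φ))
        - ∑ i, -star (bracket W (ψ i) (star φ)) * bracket W (ψ i) (star φ) := by
    rw [← Finset.sum_add_distrib, ← Finset.sum_sub_distrib, ← Finset.sum_sub_distrib]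
    exact Finset.sum_congr rfl fun i _ => by rw [star_add]; ring
  rw [h7]
  linear_combination h2 + (bracket W (φ ᵥ* Λ) (star φ) +
    ∑ i, star (q i) * bracket W (ψ i) (star φ) - bracket W φ (Λᴴ *ᵥ star φ) -
    ∑ i, q i * -star (bracket W (ψ i) (star φ))) * I_sq

/-- Dressing of a solution of constant density with a matrix spectral parameter `Λ`. -/
theorem dressing_solves {q qx qxx qt : ℝ → ℝ → Fin N → ℂ} {c : ℂ} {φ u v : ℝ → ℝ → ι → ℂ}
    {ψ : Fin N → ℝ → ℝ → ι → ℂ} {M : ℝ → ℝ → Matrix ι ι ℂ} {Λ : Matrix ι ι ℂ}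
    (hqx : ∀ x t i, HasDerivAt (fun y => q y t i) (qx x t i) x)
    (hqxx : ∀ x t i, HasDerivAt (fun y => qx y t i) (qxx x t i) x)
    (hqt : ∀ x t i, HasDerivAt (fun y => q x y i) (qt x t i) t)
    (hq : ∀ x t i, I * qt x t i + 1 / 2 * qxx x t i + c * q x t i = 0)
    (hc : ∀ x t, ∑ i, q x t i * star (q x t i) = c)
    (hφx : ∀ x t, HasDerivAt (fun y => φ y t) (u x t) x)
    (hux : ∀ x t, HasDerivAt (fun y => u y t) (v x t) x)
    (hφt : ∀ x t, HasDerivAt (fun y => φ x y) ((-(I / 2)) • v x t) t)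
    (hψx : ∀ i x t, HasDerivAt (fun y => ψ i y t) ((I * q x t i) • φ x t) x)
    (hψt : ∀ i x t, HasDerivAt (fun y => ψ i x y)
      ((1 / 2 : ℂ) • (q x t i • u x t - qx x t i • φ x t) + (I * c) • ψ i x t) t)
    (hMx : ∀ x t r s, HasDerivAt (fun y => M y t r s) (-I * (star (φ x t r) * φ x t s)) x)
    (hMt : ∀ x t r s, HasDerivAt (fun y => M x y r s)
      (1 / 2 * (star (u x t r) * φ x t s - star (φ x t r) * u x t s)) t)
    (hskew : ∀ x t, (M x t)ᴴ = -M x t) (hdet : ∀ x t, (M x t).det ≠ 0)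
    (hu : ∀ x t, u x t = I • (φ x t ᵥ* Λ + ∑ i, star (q x t i) • ψ i x t))
    (hL : ∀ x t, Λᴴ * M x t - M x t * Λ = Matrix.vecMulVec (star (φ x t)) (φ x t) +
      ∑ i, Matrix.vecMulVec (star (ψ i x t)) (ψ i x t))
    (x t : ℝ) (i : Fin N) :
    I * deriv (fun y => q x y i + bracket (M x y)⁻¹ (ψ i x y) (star (φ x y))) t +
      1 / 2 * iteratedDeriv 2 (fun y => q y t i + bracket (M y t)⁻¹ (ψ i y t) (star (φ y t))) x +
      (∑ l, (q x t l + bracket (M x t)⁻¹ (ψ l x t) (star (φ x t))) *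
        star (q x t l + bracket (M x t)⁻¹ (ψ l x t) (star (φ x t)))) *
        (q x t i + bracket (M x t)⁻¹ (ψ i x t) (star (φ x t))) = 0 := by
  have hMx' : ∀ x t r s, HasDerivAt (fun y => M y t r s)
      (((-I) • Matrix.vecMulVec (star (φ x t)) (φ x t)) r s) x := hMx
  have hMt' : ∀ x t r s, HasDerivAt (fun y => M x y r s)
      (((1 / 2 : ℂ) • (Matrix.vecMulVec (star (u x t)) (φ x t) -
        Matrix.vecMulVec (star (φ x t)) (u x t))) r s) t := hMt
  -- Since the x-derivative of M has rank one, the derivative of its inverse contributes a product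
  -- of two brackets. Hence the x-derivatives needed below are again polynomials in brackets.
  have hs : ∀ x, HasDerivAt (fun y => bracket (M y t)⁻¹ (φ y t) (star (φ y t)))
      (bracket (M x t)⁻¹ (u x t) (star (φ x t)) + bracket (M x t)⁻¹ (φ x t) (star (u x t)) +
        I * bracket (M x t)⁻¹ (φ x t) (star (φ x t)) ^ 2) x := fun x => by
    refine (hasDerivAt_bracket (hMx' x t) (hdet · t) (hφx x t) (hφx x t).star).congr_deriv ?_
    rw [Matrix.smul_mulVec, vecMulVec_mulVec', bracket_smul_right, bracket_smul_right]
    simp only [bracket]; ring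
  have hr : ∀ x, HasDerivAt (fun y => bracket (M y t)⁻¹ (ψ i y t) (star (φ y t)))
      (I * (q x t i + bracket (M x t)⁻¹ (ψ i x t) (star (φ x t))) *
        bracket (M x t)⁻¹ (φ x t) (star (φ x t)) +
        bracket (M x t)⁻¹ (ψ i x t) (star (u x t))) x := fun x => by
    refine (hasDerivAt_bracket (hMx' x t) (hdet · t) (hψx i x t) (hφx x t).star).congr_deriv ?_
    rw [Matrix.smul_mulVec, vecMulVec_mulVec', bracket_smul_right, bracket_smul_right,
      bracket_smul_left]
    simp only [bracket]; ring
  have hC : ∀ x, HasDerivAt (fun y => bracket (M y t)⁻¹ (ψ i y t) (star (u y t)))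
      (I * (q x t i + bracket (M x t)⁻¹ (ψ i x t) (star (φ x t))) *
        bracket (M x t)⁻¹ (φ x t) (star (u x t)) +
        bracket (M x t)⁻¹ (ψ i x t) (star (v x t))) x := fun x => by
    refine (hasDerivAt_bracket (hMx' x t) (hdet · t) (hψx i x t) (hux x t).star).congr_deriv ?_
    rw [Matrix.smul_mulVec, vecMulVec_mulVec', bracket_smul_right, bracket_smul_right,
      bracket_smul_left]
    simp only [bracket]; ring
  have hrt : HasDerivAt (fun y => bracket (M x y)⁻¹ (ψ i x y) (star (φ x y)))
      (1 / 2 * (q x t i * bracket (M x t)⁻¹ (u x t) (star (φ x t)) -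
          qx x t i * bracket (M x t)⁻¹ (φ x t) (star (φ x t))) +
        I * c * bracket (M x t)⁻¹ (ψ i x t) (star (φ x t)) +
        I / 2 * bracket (M x t)⁻¹ (ψ i x t) (star (v x t)) -
        1 / 2 * (bracket (M x t)⁻¹ (φ x t) (star (φ x t)) *
          bracket (M x t)⁻¹ (ψ i x t) (star (u x t)) -
          bracket (M x t)⁻¹ (u x t) (star (φ x t)) *
          bracket (M x t)⁻¹ (ψ i x t) (star (φ x t)))) t := by
    refine (hasDerivAt_bracket (hMt' x t) (hdet x) (hψt i x t) (hφt x t).star).congr_deriv ?_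
    have h1 : star (-(I / 2)) = I / 2 := by
      rw [Complex.star_def, map_neg, map_div₀, Complex.conj_I, map_ofNat]
      ring
    rw [Matrix.smul_mulVec, Matrix.sub_mulVec, vecMulVec_mulVec', vecMulVec_mulVec', star_smul, h1]
    simp only [bracket_smul_right, bracket_smul_left, bracket_add_left, bracket_sub_left,
      bracket_sub_right]
    simp only [bracket]
  have hQt := ((hqt x t i).add hrt).deriv
  have hQx : deriv (fun y => q y t i + bracket (M y t)⁻¹ (ψ i y t) (star (φ y t))) = fun y =>
      qx y t i + (I * (q y t i + bracket (M y t)⁻¹ (ψ i y t) (star (φ y t))) *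
        bracket (M y t)⁻¹ (φ y t) (star (φ y t)) +
        bracket (M y t)⁻¹ (ψ i y t) (star (u y t))) :=
    funext fun y => ((hqx y t i).add (hr y)).deriv
  have hQxx := ((hqxx x t i).add (((((hqx x t i).add (hr x)).const_mul I).mul (hs x)).add
    (hC x))).deriv
  rw [iteratedDeriv_succ, iteratedDeriv_one, hQx]
  simp only [Pi.add_def, Pi.mul_def] at hQt hQxx
  rw [hQt, hQxx]
  have key := dressing_identity (hskew x t) (hdet x t) (hu x t) (hL x t)
  rw [hc] at key
  -- The left-hand side is the dressed component times the scalar identity `key`, plus the seed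
  -- equation `hq`, up to multiples of i² + 1.
  linear_combination (q x t i + bracket (M x t)⁻¹ (ψ i x t) (star (φ x t))) * key + hq x t i +
    ((q x t i + bracket (M x t)⁻¹ (ψ i x t) (star (φ x t))) *
      bracket (M x t)⁻¹ (φ x t) (star (φ x t)) ^ 2 +
      c * bracket (M x t)⁻¹ (ψ i x t) (star (φ x t)) +
      1 / 2 * bracket (M x t)⁻¹ (ψ i x t) (star (v x t))) * I_sq

end Dressing

end VNLS

end

noncomputable section
namespace VNLS
open Finset.HasAntidiagonal (antidiagonal mem_antidiagonal)
open PowerSeries (coeff)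

variable {N p : ℕ} {a b : Fin N → ℝ} {w z : ℂ} {β βw βz : ℕ → ℂ}

/-! ### The coefficients as functions of `x` and `t` -/

section Subalgebra

variable {T : Type*} {A : Subalgebra ℂ (T → ℂ)} {x t : T → ℝ}

lemma const_mem (c : ℂ) : (fun _ : T => c) ∈ A := A.algebraMap_mem c

lemma fun_sum_mem {ι : Type*} {s : Finset ι} {f : ι → T → ℂ} (h : ∀ i ∈ s, f i ∈ A) :
    (fun y => ∑ i ∈ s, f i y) ∈ A := by
  have := A.sum_mem h
  convert this using 1
  ext y; simp

lemma fun_mul_mem {f g : T → ℂ} (hf : f ∈ A) (hg : g ∈ A) : (fun y => f y * g y) ∈ A :=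
  A.mul_mem hf hg

lemma fun_add_mem {f g : T → ℂ} (hf : f ∈ A) (hg : g ∈ A) : (fun y => f y + g y) ∈ A :=
  A.add_mem hf hg

lemma coeff_pow_mem {F : T → PowerSeries ℂ} (h : ∀ n, (fun y => coeff n (F y)) ∈ A) (ν n : ℕ) :
    (fun y => coeff n (F y ^ ν)) ∈ A := by
  induction ν generalizing n with
  | zero => simp only [pow_zero]; exact const_mem _
  | succ ν ih =>
    simp only [pow_succ, PowerSeries.coeff_mul]
    exact fun_sum_mem fun kl _ => fun_mul_mem (ih _) (h _)

variable (hx : (fun y => (x y : ℂ)) ∈ A) (ht : (fun y => (t y : ℂ)) ∈ A)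
include hx ht

lemma Xcoeff_mem (k : ℕ) : (fun y => Xcoeff a b z β (x y) (t y) k) ∈ A := by
  unfold Xcoeff
  exact fun_add_mem (fun_mul_mem (const_mem _) (fun_add_mem (fun_mul_mem (const_mem _) hx)
    (fun_mul_mem (const_mem _) ht))) (const_mem _)

lemma Scoeff_mem (j : ℕ) : (fun y => Scoeff a b z β (x y) (t y) j) ∈ A := by
  unfold Scoeff powCoeff
  simp only [div_eq_mul_inv]
  refine fun_sum_mem fun ν _ => fun_mul_mem (coeff_pow_mem (fun n => ?_) ν j) (const_mem _)
  simp only [PowerSeries.coeff_mk]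
  split_ifs
  · exact const_mem _
  · exact Xcoeff_mem hx ht n

variable (hstar : ∀ f ∈ A, (fun y => star (f y)) ∈ A)
include hstar

/-- These coefficients are built from x and t by finite sums, products, constants and conjugation,
so they lie in every conjugation-stable subalgebra that contains x and t. One argument thus yields
both smoothness on the plane and subexponential growth in x. -/
lemma Hcoeff_mem (m n : ℕ) : (fun y => Hcoeff a b w z βw βz (x y) (t y) m n) ∈ A := by
  unfold Hcoeff
  exact fun_sum_mem fun l _ => fun_sum_mem fun r _ => fun_mul_mem (fun_mul_mem (const_mem _)
    (hstar _ (Scoeff_mem hx ht _))) (Scoeff_mem hx ht _)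

lemma HcoeffI_mem (i : Fin N) (m n : ℕ) :
    (fun y => HcoeffI a b w z βw βz i (x y) (t y) m n) ∈ A := by
  unfold HcoeffI
  exact fun_sum_mem fun l _ => fun_sum_mem fun r _ => fun_mul_mem (fun_mul_mem (const_mem _)
    (hstar _ (Scoeff_mem hx ht _))) (Scoeff_mem hx ht _)

end Subalgebra

/-- The smooth functions on the plane. -/
def smoothAlgebra : Subalgebra ℂ (ℝ × ℝ → ℂ) where
  carrier := {f | ContDiff ℝ ∞ f}
  mul_mem' hf hg := (Set.mem_ofPred.1 hf).mul (Set.mem_ofPred.1 hg)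
  add_mem' hf hg := (Set.mem_ofPred.1 hf).add (Set.mem_ofPred.1 hg)
  algebraMap_mem' c := (contDiff_const : ContDiff ℝ ∞ fun _ : ℝ × ℝ => c)

/-- The functions of slower than exponential growth at `+∞`. -/
def subexponential : Subalgebra ℂ (ℝ → ℂ) where
  carrier := {f | ∀ δ > 0, f =O[atTop] fun x => Real.exp (δ * x)}
  mul_mem' {f g} hf hg δ hδ := by
    refine ((hf (δ / 2) (by positivity)).mul (hg (δ / 2) (by positivity))).congr_right fun x => ?_
    rw [← Real.exp_add]; ring_nf
  add_mem' hf hg δ hδ := (hf δ hδ).add (hg δ hδ)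
  algebraMap_mem' c δ hδ := by
    refine Asymptotics.IsBigO.of_bound ‖c‖ ?_
    filter_upwards [eventually_ge_atTop 0] with x hx
    have h1 : (1 : ℝ) ≤ ‖Real.exp (δ * x)‖ := by
      rw [Real.norm_eq_abs, Real.abs_exp]; exact Real.one_le_exp (by positivity)
    exact le_mul_of_one_le_right (norm_nonneg _) h1

lemma ofReal_fst_mem : (fun y : ℝ × ℝ => (y.1 : ℂ)) ∈ smoothAlgebra :=
  (Complex.ofRealCLM.contDiff.comp contDiff_fst : ContDiff ℝ ∞ fun y : ℝ × ℝ => (y.1 : ℂ))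

lemma ofReal_snd_mem : (fun y : ℝ × ℝ => (y.2 : ℂ)) ∈ smoothAlgebra :=
  (Complex.ofRealCLM.contDiff.comp contDiff_snd : ContDiff ℝ ∞ fun y : ℝ × ℝ => (y.2 : ℂ))

lemma star_mem_smoothAlgebra (f : ℝ × ℝ → ℂ) (hf : f ∈ smoothAlgebra) :
    (fun y => star (f y)) ∈ smoothAlgebra :=
  (Complex.conjCLE.contDiff.comp (show ContDiff ℝ ∞ f from hf) :
    ContDiff ℝ ∞ fun y => star (f y))

lemma contDiff_Hcoeff (m n : ℕ) :
    ContDiff ℝ ∞ fun y : ℝ × ℝ => Hcoeff a b w z βw βz y.1 y.2 m n :=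
  Hcoeff_mem (A := smoothAlgebra) (x := Prod.fst) (t := Prod.snd)
    ofReal_fst_mem ofReal_snd_mem star_mem_smoothAlgebra m n

lemma contDiff_HcoeffI (i : Fin N) (m n : ℕ) :
    ContDiff ℝ ∞ fun y : ℝ × ℝ => HcoeffI a b w z βw βz i y.1 y.2 m n :=
  HcoeffI_mem (A := smoothAlgebra) (x := Prod.fst) (t := Prod.snd)
    ofReal_fst_mem ofReal_snd_mem star_mem_smoothAlgebra i m n

/-! ### Decay as x tends to infinity -/

lemma isBigO_Hcoeff {t : ℝ} (m n : ℕ) {δ : ℝ} (hδ : 0 < δ) :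
    (fun x => Hcoeff a b w z βw βz x t m n) =O[atTop] fun x => Real.exp (δ * x) := by
  refine Hcoeff_mem (A := subexponential) (x := id) (t := fun _ => t) ?_ (const_mem _) ?_ m n δ hδ
  · intro δ hδ
    have := (isLittleO_pow_exp_pos_mul_atTop 1 hδ).isBigO
    refine Asymptotics.IsBigO.congr_left (f₁ := fun x : ℝ => ((x ^ 1 : ℝ) : ℂ)) ?_ fun x => by simp
    refine Asymptotics.isBigO_norm_left.1 ?_
    simpa only [Complex.norm_real] using this.norm_left
  · intro f hf δ hδ
    refine (Asymptotics.isBigO_norm_left.1 ?_)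
    simp only [norm_star]
    exact (hf δ hδ).norm_left

lemma norm_exp_Xcoeff_zero {x t : ℝ} : ‖exp (Xcoeff a b z β x t 0)‖ =
    Real.exp (-z.im * x) * ‖exp (I / 2 * z ^ 2 * t + β 0)‖ := by
  have : Xcoeff a b z β x t 0 = I * z * x + (I / 2 * z ^ 2 * t + β 0) := by
    simp [Xcoeff, chiCoeff]; ring
  rw [this, exp_add, norm_mul, norm_exp]
  simp

/-- The exponential factors decay like e^(-(Im w + Im z)x), while the remaining factor grows more
slowly than e^((Im w)x); the decay e^(-(Im z)x) is left over. -/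
lemma tendsto_coeff2_gramSeries {t : ℝ} (hw : 0 < w.im) (hz : 0 < z.im) (m n : ℕ) :
    Tendsto (fun x => coeff2 m n (gramSeries a b w z βw βz x t)) atTop (𝓝 0) := by
  simp only [coeff2_gramSeries]
  have hexp : ∀ {z : ℂ} {β : ℕ → ℂ}, (fun x : ℝ => exp (Xcoeff a b z β x t 0)) =O[atTop]
      fun x : ℝ => Real.exp (-z.im * x) := by
    intro z β
    refine Asymptotics.IsBigO.of_bound ‖exp (I / 2 * z ^ 2 * t + β 0)‖ (.of_forall fun x => ?_)
    rw [norm_exp_Xcoeff_zero, mul_comm]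
    simp
  have h1 : (fun x : ℝ => star (exp (Xcoeff a b w βw x t 0))) =O[atTop]
      fun x : ℝ => Real.exp (-w.im * x) := by
    refine Asymptotics.isBigO_norm_left.1 ?_
    simp only [norm_star]
    exact hexp.norm_left
  have h2 := (h1.mul (hexp (z := z) (β := βz))).mul
    (isBigO_Hcoeff (a := a) (b := b) (w := w) (z := z) (βw := βw) (βz := βz) (t := t) m n hw)
  refine h2.trans_tendsto ?_
  have h3 : Tendsto (fun x : ℝ => Real.exp (-(z.im * x))) atTop (𝓝 0) :=
    Real.tendsto_exp_neg_atTop_nhds_zero.comp (tendsto_id.const_mul_atTop hz)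
  refine h3.congr fun x => ?_
  rw [← Real.exp_add, ← Real.exp_add]; ring_nf

lemma constantCoeff_fullSeries {x t : ℝ} :
    PowerSeries.constantCoeff (fullSeries a b z β x t) = exp (Xcoeff a b z β x t 0) := by
  rw [fullSeries, map_mul, PowerSeries.constantCoeff_C,
    ← PowerSeries.coeff_zero_eq_constantCoeff_apply, expSeries, PowerSeries.coeff_mk, Scoeff]
  simp [powCoeff]

/-- By χ^[1] = 1, the d-th power of χ̂ - z starts with ε^d with coefficient 1. Powers of χ̂ - z can
therefore isolate the highest index in a linear relation. -/
lemma coeff_chiTail_pow_mul (d : ℕ) (R : PowerSeries ℂ) :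
    (∀ n < d, coeff n (chiTail a b z ^ d * R) = 0) ∧
      coeff d (chiTail a b z ^ d * R) = PowerSeries.constantCoeff R := by
  obtain ⟨W, hW⟩ := PowerSeries.X_dvd_iff.2 (constantCoeff_chiTail (a := a) (b := b) (z := z))
  have hW0 : PowerSeries.constantCoeff W = 1 := by
    have h := congrArg (coeff 1) hW
    rw [← zero_add 1, PowerSeries.coeff_succ_X_mul, chiTail, PowerSeries.coeff_mk] at h
    simpa [chiCoeff] using h.symm
  rw [hW, mul_pow, mul_assoc]
  refine ⟨fun n hn => ?_, ?_⟩
  · rw [PowerSeries.coeff_X_pow_mul', if_neg (by omega)]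
  · rw [PowerSeries.coeff_X_pow_mul', if_pos le_rfl, Nat.sub_self,
      PowerSeries.coeff_zero_eq_constantCoeff_apply, map_mul, map_pow, hW0, one_pow, one_mul]

/-! ### Non-degeneracy of the Gram matrix -/

section family

variable {χ : Fin p → ℂ} {β : Fin p → ℕ → ℂ} {s K : Fin p → ℕ}

/-- The index `n (κ_j + 1) - s_j` that belongs to the position `(j, n)`. -/
def pos (a b : Fin N → ℝ) (χ : Fin p → ℂ) (s : Fin p → ℕ) {K : Fin p → ℕ}
    (v : Σ j : Fin p, Fin (K j)) : ℕ := (v.2 + 1) * (kappa a b (χ v.1) + 1) - s v.1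

/-- The matrix of the coefficients of `exp (ω_k* + ω_j) / (χ̂_k* - χ̂_j)`. -/
def gramMatrix (a b : Fin N → ℝ) (χ : Fin p → ℂ) (β : Fin p → ℕ → ℂ) (s K : Fin p → ℕ) (x t : ℝ) :
    Matrix (Σ j : Fin p, Fin (K j)) (Σ j : Fin p, Fin (K j)) ℂ := Matrix.of fun u v =>
  coeff2 (pos a b χ s u) (pos a b χ s v) (gramSeries a b (χ u.1) (χ v.1) (β u.1) (β v.1) x t)

lemma star_sub_ne_zero (hw : 0 < w.im) (hz : 0 < z.im) : star w - z ≠ 0 := fun h => by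
  have := congrArg Complex.im h
  simp at this
  linarith

lemma pos_injective (hs : ∀ j, s j ≤ kappa a b (χ j) + 1) {j : Fin p} {r r' : Fin (K j)}
    (h : pos a b χ s (⟨j, r⟩ : Σ j, Fin (K j)) = pos a b χ s (⟨j, r'⟩ : Σ j, Fin (K j))) :
    r = r' := by
  have h1 := hs j
  simp only [pos] at h
  have h2 : (r + 1 : ℕ) * (kappa a b (χ j) + 1) = (r' + 1) * (kappa a b (χ j) + 1) := by
    have h3 : ∀ m : ℕ, kappa a b (χ j) + 1 ≤ (m + 1) * (kappa a b (χ j) + 1) := fun m =>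
      Nat.le_mul_of_pos_left _ (Nat.succ_pos m)
    have := h3 r; have := h3 r'
    omega
  have := Nat.eq_of_mul_eq_mul_right (Nat.succ_pos _) h2
  exact Fin.ext (by omega)

/-- The functions `[ε^n] exp ω_j` at the chosen positions are linearly independent. -/
lemma linear_independence (hχ : Function.Injective χ) (hs : ∀ j, s j ≤ kappa a b (χ j) + 1)
    {c : (Σ j : Fin p, Fin (K j)) → ℂ} {t x₀ : ℝ}
    (h : ∀ x > x₀, ∑ v, coeff (pos a b χ s v) (fullSeries a b (χ v.1) (β v.1) x t) * c v = 0) :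
    c = 0 := by
  -- Each x-derivative multiplies the series by i χ̂_j, and the relation may be differentiated
  -- because it holds on an open half-line.
  have h1 : ∀ l : ℕ, ∀ x > x₀, ∑ v, coeff (pos a b χ s v) ((PowerSeries.C I *
      chiSeries a b (χ v.1)) ^ l * fullSeries a b (χ v.1) (β v.1) x t) * c v = 0 := by
    intro l
    induction l with
    | zero => simpa using h
    | succ l ih =>
      intro x hx
      have h2 : HasDerivAt (fun x => ∑ v, coeff (pos a b χ s v) ((PowerSeries.C I *
          chiSeries a b (χ v.1)) ^ l * fullSeries a b (χ v.1) (β v.1) x t) * c v)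
          (∑ v, coeff (pos a b χ s v) ((PowerSeries.C I * chiSeries a b (χ v.1)) ^ l *
            (PowerSeries.C I * chiSeries a b (χ v.1) *
              fullSeries a b (χ v.1) (β v.1) x t)) * c v) x :=
        HasDerivAt.fun_sum fun v _ =>
          ((hasCoeffDeriv_fullSeries_x.const_mul _) (pos a b χ s v)).mul_const _
      have h3 : HasDerivAt (fun x => ∑ v, coeff (pos a b χ s v) ((PowerSeries.C I *
          chiSeries a b (χ v.1)) ^ l * fullSeries a b (χ v.1) (β v.1) x t) * c v) 0 x :=
        (hasDerivAt_const x (0 : ℂ)).congr_of_eventuallyEq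
          (by filter_upwards [Ioi_mem_nhds hx] with y hy using ih y hy)
      have h4 := h2.unique h3
      simpa only [pow_succ, mul_assoc] using h4
  -- Linear combinations of the derivatives insert P(χ̂_j) for one and the same polynomial P in
  -- every block.
  have h2 : ∀ P : Polynomial ℂ, ∑ v, coeff (pos a b χ s v)
      (P.eval₂ PowerSeries.C (chiSeries a b (χ v.1)) *
        fullSeries a b (χ v.1) (β v.1) (x₀ + 1) t) * c v = 0 := by
    intro P
    induction P using Polynomial.induction_on' with
    | add P Q hP hQ =>
      simp only [Polynomial.eval₂_add, add_mul, map_add, Finset.sum_add_distrib, hP, hQ, add_zero]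
    | monomial l e =>
      have h3 := h1 l (x₀ + 1) (by linarith)
      simp only [mul_pow, ← map_pow PowerSeries.C, mul_assoc, PowerSeries.coeff_C_mul,
        ← Finset.mul_sum] at h3
      have h4 := (mul_eq_zero.1 h3).resolve_left (pow_ne_zero _ I_ne_zero)
      simp only [Polynomial.eval₂_monomial, mul_assoc, PowerSeries.coeff_C_mul, ← Finset.mul_sum,
        h4, mul_zero]
  by_contra hc
  obtain ⟨v₀, hv₀⟩ := Function.ne_iff.1 hc
  -- `v₁` has the highest position among the nonzero coefficients of its block.
  obtain ⟨v₁, hv₁, hmax⟩ := Finset.exists_max_image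
    (Finset.univ.filter fun v : Σ j : Fin p, Fin (K j) => v.1 = v₀.1 ∧ c v ≠ 0) (pos a b χ s)
    ⟨v₀, by simpa using hv₀⟩
  simp only [Finset.mem_filter, Finset.mem_univ, true_and] at hv₁ hmax
  -- `L` exceeds every position, so the factor (χ̂_j - χ_j)^L supplied by Q annihilates the terms of
  -- every other block. In the block of `v₁`, Q is a unit, and the additional power of χ̂ - χ_(v₁.1)
  -- annihilates the lower positions. Only the term of `v₁` survives.
  set L := ∑ v : Σ j : Fin p, Fin (K j), (pos a b χ s v + 1) with hL
  set Q : Polynomial ℂ := ∏ j ∈ Finset.univ.erase v₁.1,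
    (Polynomial.X - Polynomial.C (χ j)) ^ L with hQ
  have hev : ∀ (j : Fin p), ∀ y, (Polynomial.X - Polynomial.C y : Polynomial ℂ).eval₂
      PowerSeries.C (chiSeries a b (χ j)) = chiTail a b (χ j) + PowerSeries.C (χ j - y) := by
    intro j y
    rw [Polynomial.eval₂_sub, Polynomial.eval₂_X, Polynomial.eval₂_C, chiSeries_eq, map_sub]; ring
  have h3 := h2 ((Polynomial.X - Polynomial.C (χ v₁.1)) ^ pos a b χ s v₁ * Q)
  simp only [Polynomial.eval₂_mul, Polynomial.eval₂_pow, hev] at h3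
  rw [Finset.sum_eq_single v₁] at h3
  · rw [sub_self, map_zero, add_zero, mul_assoc, (coeff_chiTail_pow_mul _ _).2, map_mul,
      constantCoeff_fullSeries] at h3
    refine mul_ne_zero (mul_ne_zero ?_ (exp_ne_zero _)) hv₁.2 h3
    rw [hQ, Polynomial.eval₂_finsetProd, map_prod, Finset.prod_ne_zero_iff]
    intro j hj
    rw [Polynomial.eval₂_pow, hev, map_pow, map_add, constantCoeff_chiTail, zero_add,
      PowerSeries.constantCoeff_C]
    exact pow_ne_zero _ (sub_ne_zero.2 fun h => (Finset.ne_of_mem_erase hj) (hχ h).symm)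
  · intro v _ hv
    by_cases hj : v.1 = v₁.1
    · by_cases hcv : c v = 0
      · rw [hcv, mul_zero]
      · have hle := hmax v ⟨hj.trans hv₁.1, hcv⟩
        have hlt : pos a b χ s v < pos a b χ s v₁ := by
          refine lt_of_le_of_ne hle fun h => hv ?_
          obtain ⟨j, r⟩ := v
          obtain ⟨j₁, r₁⟩ := v₁
          simp only at hj
          subst hj
          rw [pos_injective hs h]
        rw [hj, sub_self, map_zero, add_zero, mul_assoc, (coeff_chiTail_pow_mul _ _).1 _ hlt,
          zero_mul]
    · rw [hQ, Polynomial.eval₂_finsetProd, ← Finset.mul_prod_erase _ _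
        (Finset.mem_erase.2 ⟨hj, Finset.mem_univ v.1⟩), Polynomial.eval₂_pow, hev, sub_self,
        map_zero, add_zero, mul_left_comm, mul_assoc, (coeff_chiTail_pow_mul _ _).1, zero_mul]
      have := Finset.single_le_sum (f := fun v => pos a b χ s v + 1) (fun _ _ => Nat.zero_le _)
        (Finset.mem_univ v)
      omega
  · intro h; exact absurd (Finset.mem_univ _) h

/-- The Gram matrix is invertible. -/
theorem det_gramMatrix_ne_zero (hχ : Function.Injective χ) (him : ∀ j, 0 < (χ j).im)
    (hs : ∀ j, s j ≤ kappa a b (χ j) + 1) (x t : ℝ) : (gramMatrix a b χ β s K x t).det ≠ 0 := by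
  intro hdet
  obtain ⟨c, hc0, hc⟩ := Matrix.exists_mulVec_eq_zero_iff.2 hdet
  -- The factor i compensates the -i in the derivative of the Gram matrix, so that f' = |g|².
  set f : ℝ → ℂ := fun y => ∑ u, ∑ v, star (c u) * (I * gramMatrix a b χ β s K y t u v) * c v
    with hf
  set g : ℝ → ℂ := fun y => ∑ v, coeff (pos a b χ s v) (fullSeries a b (χ v.1) (β v.1) y t) * c v
    with hg
  have hfd : ∀ y, HasDerivAt f (star (g y) * g y) y := by
    intro y
    have h1 : HasDerivAt f (∑ u, ∑ v, star (c u) * (I * (-I *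
        (star (coeff (pos a b χ s u) (fullSeries a b (χ u.1) (β u.1) y t)) *
          coeff (pos a b χ s v) (fullSeries a b (χ v.1) (β v.1) y t)))) * c v) y :=
      HasDerivAt.fun_sum fun u _ => HasDerivAt.fun_sum fun v _ =>
        (((hasDerivAt_gramSeries_x (star_sub_ne_zero (him _) (him _)) _ _).const_mul I).const_mul
          _).mul_const _
    refine h1.congr_deriv ?_
    rw [hg]
    simp only [star_sum, Finset.sum_mul, Finset.mul_sum, star_mul']
    rw [Finset.sum_comm]
    refine Finset.sum_congr rfl fun u _ => Finset.sum_congr rfl fun v _ => ?_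
    linear_combination (-(star (coeff (pos a b χ s v) (fullSeries a b (χ v.1) (β v.1) y t)) *
      star (c v) * (coeff (pos a b χ s u) (fullSeries a b (χ u.1) (β u.1) y t) * c u))) * I_sq
  have hre : ∀ y, HasDerivAt (fun y => (f y).re) (‖g y‖ ^ 2) y := by
    intro y
    have h1 := Complex.reCLM.hasFDerivAt.comp_hasDerivAt y (hfd y)
    refine h1.congr_deriv ?_
    have h2 : star (g y) * g y = ((‖g y‖ ^ 2 : ℝ) : ℂ) := by
      rw [mul_comm]; push_cast; exact Complex.mul_conj' (g y)
    rw [h2]; exact Complex.ofReal_re _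
  have hmono : Monotone fun y => (f y).re :=
    monotone_of_deriv_nonneg (fun y => (hre y).differentiableAt) fun y => by
      rw [(hre y).deriv]; positivity
  have hlim : Tendsto (fun y => (f y).re) atTop (𝓝 0) := by
    have h1 : Tendsto f atTop (𝓝 (∑ u, ∑ v, star (c u) * (I * 0) * c v)) :=
      tendsto_finsetSum _ fun u _ => tendsto_finsetSum _ fun v _ =>
        ((tendsto_const_nhds.mul ((tendsto_coeff2_gramSeries (him _) (him _) _ _).const_mul
          I)).mul_const _)
    have h2 := (Complex.continuous_re.tendsto _).comp h1
    simpa [Function.comp_def] using h2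
  have hx0 : f x = 0 := by
    have h1 : f x = I * ∑ u, star (c u) * (gramMatrix a b χ β s K x t *ᵥ c) u := by
      simp only [hf, Matrix.mulVec, dotProduct, Finset.mul_sum]
      exact Finset.sum_congr rfl fun u _ => Finset.sum_congr rfl fun v _ => by ring
    rw [h1, hc]; simp
  have hzero : ∀ y > x, g y = 0 := by
    intro y hy
    -- A monotone function with limit 0 at infinity is nonpositive; to the right of x it is also at
    -- least its value 0 at x. It is therefore constant there, and its derivative |g|² vanishes.
    have h1 : (fun y => (f y).re) =ᶠ[𝓝 y] fun _ => 0 := by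
      filter_upwards [Ioi_mem_nhds hy] with y' hy'
      refine le_antisymm (hmono.ge_of_tendsto hlim y') ?_
      have := hmono (le_of_lt (show x < y' from hy'))
      simpa [hx0] using this
    have h2 := (hre y).unique ((hasDerivAt_const y (0 : ℝ)).congr_of_eventuallyEq h1)
    simpa using h2
  exact hc0 (linear_independence hχ hs hzero)

end family

end VNLS

end

noncomputable section
namespace VNLS
open Finset.HasAntidiagonal (antidiagonal mem_antidiagonal)
open PowerSeries (coeff)

variable {N p : ℕ} {a b : Fin N → ℝ}

/-! ### The plane wave -/

lemma star_exp_I_mul (r : ℝ) : star (exp (I * r)) * exp (I * r) = 1 := by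
  have : star (exp (I * r)) = exp (-(I * r)) := by
    rw [Complex.star_def, ← Complex.exp_conj]; simp
  rw [this, ← exp_add]; simp

lemma star_phase_mul_phase (x t : ℝ) (i : Fin N) :
    star (phase a b x t i) * phase a b x t i = 1 := by
  have : phase a b x t i = exp (I * ((b i * x + (ampSq a - b i ^ 2 / 2) * t : ℝ) : ℂ)) := by
    rw [phase]; push_cast; rfl
  rw [this, star_exp_I_mul]

lemma star_planeWave_mul_planeWave (x t : ℝ) (i : Fin N) :
    star (planeWave a b x t i) * planeWave a b x t i = (a i : ℂ) ^ 2 := by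
  have h := star_phase_mul_phase (a := a) (b := b) x t i
  have h2 : star (a i : ℂ) = a i := Complex.conj_ofReal _
  rw [planeWave, star_mul', h2]
  linear_combination (a i : ℂ) ^ 2 * h

lemma hasDerivAt_planeWave_x (x t : ℝ) (i : Fin N) :
    HasDerivAt (fun y => planeWave a b y t i) (I * b i * planeWave a b x t i) x := by
  have h := (((((Complex.ofRealCLM.hasDerivAt (x := x)).const_mul (b i : ℂ)).add_const
    (((ampSq a : ℂ) - (b i : ℂ) ^ 2 / 2) * t)).const_mul I).cexp).const_mul (a i : ℂ)
  simp only [Complex.ofRealCLM_apply, Complex.ofReal_one, mul_one] at h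
  refine h.congr_deriv ?_
  rw [planeWave, phase]; ring

lemma hasDerivAt_planeWave_t (x t : ℝ) (i : Fin N) :
    HasDerivAt (fun y => planeWave a b x y i)
      (I * ((ampSq a : ℂ) - (b i : ℂ) ^ 2 / 2) * planeWave a b x t i) t := by
  have h := (((((Complex.ofRealCLM.hasDerivAt (x := t)).const_mul
    ((ampSq a : ℂ) - (b i : ℂ) ^ 2 / 2)).const_add
    ((b i : ℂ) * x)).const_mul I).cexp).const_mul (a i : ℂ)
  simp only [Complex.ofRealCLM_apply, Complex.ofReal_one, mul_one] at h
  refine h.congr_deriv ?_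
  rw [planeWave, phase]; ring

lemma contDiff_phase (i : Fin N) : ContDiff ℝ ∞ fun y : ℝ × ℝ => phase a b y.1 y.2 i := by
  have h1 : (fun y : ℝ × ℝ => I * ((b i : ℂ) * y.1 + ((ampSq a : ℂ) - (b i : ℂ) ^ 2 / 2) * y.2)) ∈
      smoothAlgebra :=
    fun_mul_mem (const_mem _) (fun_add_mem (fun_mul_mem (const_mem _) ofReal_fst_mem)
      (fun_mul_mem (const_mem _) ofReal_snd_mem))
  exact ContDiff.cexp h1

/-! ### The rational solutions -/

section family

variable {χ : Fin p → ℂ} {β : Fin p → ℕ → ℂ} {s K : Fin p → ℕ}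

/-- The matrix spectral parameter: multiplication by `λ̂_j` on the chosen coefficients. -/
def spectralMatrix (a b : Fin N → ℝ) (χ : Fin p → ℂ) (K : Fin p → ℕ) :
    Matrix (Σ j : Fin p, Fin (K j)) (Σ j : Fin p, Fin (K j)) ℂ := Matrix.of fun u v =>
  (if u = v then lam0 a b (χ v.1) else 0) +
    if u.1 = v.1 ∧ (u.2 : ℕ) + 1 = v.2 then alpha a b (χ v.1) else 0

/-- Consecutive positions in a block differ by κ + 1, so the superdiagonal entries α realise the
shift of the index caused by the monomial of λ̂. -/
lemma sum_mul_spectralMatrix (hs : ∀ j, 1 ≤ s j ∧ s j ≤ kappa a b (χ j) + 1)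
    (g : Fin p → ℕ → ℂ) (v : Σ j : Fin p, Fin (K j)) :
    ∑ u : Σ j : Fin p, Fin (K j), g u.1 (pos a b χ s u) * spectralMatrix a b χ K u v =
      lam0 a b (χ v.1) * g v.1 (pos a b χ s v) + alpha a b (χ v.1) *
        if kappa a b (χ v.1) + 1 ≤ pos a b χ s v then
          g v.1 (pos a b χ s v - (kappa a b (χ v.1) + 1)) else 0 := by
  simp only [spectralMatrix, Matrix.of_apply, mul_add, Finset.sum_add_distrib]
  congr 1
  · rw [Finset.sum_eq_single v (fun u _ hu => by rw [if_neg hu, mul_zero])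
      (fun h => absurd (Finset.mem_univ _) h), if_pos rfl, mul_comm]
  · obtain ⟨j, r, hr⟩ := v
    have hj := hs j
    rcases r with _ | r
    -- The first position of a block is κ + 1 - s, which is below κ + 1 because s ≥ 1; there the
    -- shift gives nothing.
    · rw [if_neg (by simp only [pos]; omega), mul_zero]
      refine Finset.sum_eq_zero fun u _ => ?_
      rw [if_neg (by simp), mul_zero]
    · have h3 : kappa a b (χ j) + 1 ≤ (r + 1) * (kappa a b (χ j) + 1) :=
        Nat.le_mul_of_pos_left _ (Nat.succ_pos _)
      have h4 : (r + 1 + 1) * (kappa a b (χ j) + 1) =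
          (r + 1) * (kappa a b (χ j) + 1) + (kappa a b (χ j) + 1) := by ring
      rw [if_pos (by simp only [pos]; omega),
        Finset.sum_eq_single (⟨j, r, by omega⟩ : Σ j : Fin p, Fin (K j))]
      · rw [if_pos ⟨rfl, rfl⟩, mul_comm]
        congr 2
        simp only [pos]; omega
      · rintro ⟨j', r', hr'⟩ _ hne
        rw [if_neg, mul_zero]
        rintro ⟨h1, h2⟩
        simp only at h1 h2
        subst h1
        exact hne (by congr 2; omega)
      · intro h; exact absurd (Finset.mem_univ _) h

lemma star_gramMatrix (x t : ℝ) : (gramMatrix a b χ β s K x t)ᴴ = -gramMatrix a b χ β s K x t := by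
  ext u v
  rw [Matrix.conjTranspose_apply, Matrix.neg_apply, gramMatrix, Matrix.of_apply, Matrix.of_apply,
    star_coeff2_gramSeries]

/-- The coefficients of `exp ω_j` at the chosen positions. -/
def phiVec (a b : Fin N → ℝ) (χ : Fin p → ℂ) (β : Fin p → ℕ → ℂ) (s K : Fin p → ℕ) (x t : ℝ)
    (v : Σ j : Fin p, Fin (K j)) : ℂ :=
  coeff (pos a b χ s v) (fullSeries a b (χ v.1) (β v.1) x t)

/-- The coefficients of `exp ω_j / (χ̂_j + bᵢ)` at the chosen positions. -/
def rhoVec (a b : Fin N → ℝ) (χ : Fin p → ℂ) (β : Fin p → ℕ → ℂ) (s K : Fin p → ℕ) (i : Fin N)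
    (x t : ℝ) (v : Σ j : Fin p, Fin (K j)) : ℂ :=
  coeff (pos a b χ s v) (invSeries a b (χ v.1) i * fullSeries a b (χ v.1) (β v.1) x t)

/-- The coefficients of `∂_x exp ω_j` at the chosen positions. -/
def phiVecX (a b : Fin N → ℝ) (χ : Fin p → ℂ) (β : Fin p → ℕ → ℂ) (s K : Fin p → ℕ) (x t : ℝ)
    (v : Σ j : Fin p, Fin (K j)) : ℂ :=
  coeff (pos a b χ s v)
    (PowerSeries.C I * chiSeries a b (χ v.1) * fullSeries a b (χ v.1) (β v.1) x t)

/-- The coefficients of `∂_x² exp ω_j` at the chosen positions. -/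
def phiVecXX (a b : Fin N → ℝ) (χ : Fin p → ℂ) (β : Fin p → ℕ → ℂ) (s K : Fin p → ℕ) (x t : ℝ)
    (v : Σ j : Fin p, Fin (K j)) : ℂ :=
  coeff (pos a b χ s v) (PowerSeries.C I * chiSeries a b (χ v.1) *
    (PowerSeries.C I * chiSeries a b (χ v.1) * fullSeries a b (χ v.1) (β v.1) x t))

lemma hasDerivAt_phiVec_x (x t : ℝ) : HasDerivAt (fun y => phiVec a b χ β s K y t)
    (phiVecX a b χ β s K x t) x :=
  hasDerivAt_pi.2 fun _ => hasCoeffDeriv_fullSeries_x _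

lemma hasDerivAt_phiVecX_x (x t : ℝ) : HasDerivAt (fun y => phiVecX a b χ β s K y t)
    (phiVecXX a b χ β s K x t) x :=
  hasDerivAt_pi.2 fun _ => hasCoeffDeriv_fullSeries_x.const_mul _ _

lemma hasDerivAt_phiVec_t (x t : ℝ) : HasDerivAt (fun y => phiVec a b χ β s K x y)
    ((-(I / 2)) • phiVecXX a b χ β s K x t) t := by
  refine hasDerivAt_pi.2 fun v => (hasCoeffDeriv_fullSeries_t _).congr_deriv ?_
  rw [Pi.smul_apply, smul_eq_mul, phiVecXX, ← PowerSeries.coeff_C_mul]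
  congr 1
  have h : PowerSeries.C (I / 2) = PowerSeries.C (-(I / 2)) * PowerSeries.C I * PowerSeries.C I := by
    rw [← map_mul, ← map_mul]; congr 1
    linear_combination (I / 2) * I_sq
  rw [h]; ring

variable (hb : ∀ j i, χ j + b i ≠ 0)
include hb

/-- The derivative inserts i χ̂, and χ̂/(χ̂ + b) = 1 - b/(χ̂ + b). -/
lemma hasDerivAt_rhoVec_x (i : Fin N) (x t : ℝ) : HasDerivAt (fun y => rhoVec a b χ β s K i y t)
    (I • phiVec a b χ β s K x t - (I * b i) • rhoVec a b χ β s K i x t) x := by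
  refine hasDerivAt_pi.2 fun v => (hasCoeffDeriv_fullSeries_x.const_mul _ _).congr_deriv ?_
  rw [Pi.sub_apply, Pi.smul_apply, Pi.smul_apply, smul_eq_mul, smul_eq_mul, phiVec, rhoVec,
    ← PowerSeries.coeff_C_mul, ← PowerSeries.coeff_C_mul, ← map_sub]
  congr 1
  have h := chiSeries_add_mul_invSeries (a := a) (hb v.1 i)
  rw [map_mul]
  linear_combination (PowerSeries.C I * fullSeries a b (χ v.1) (β v.1) x t) * h

/-- The derivative inserts (i/2) χ̂², and χ̂²/(χ̂ + b) = χ̂ - b + b²/(χ̂ + b). -/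
lemma hasDerivAt_rhoVec_t (i : Fin N) (x t : ℝ) : HasDerivAt (fun y => rhoVec a b χ β s K i x y)
    ((1 / 2 : ℂ) • phiVecX a b χ β s K x t - (I / 2 * b i) • phiVec a b χ β s K x t +
      (I / 2 * b i ^ 2) • rhoVec a b χ β s K i x t) t := by
  refine hasDerivAt_pi.2 fun v => (hasCoeffDeriv_fullSeries_t.const_mul _ _).congr_deriv ?_
  rw [Pi.add_apply, Pi.sub_apply, Pi.smul_apply, Pi.smul_apply, Pi.smul_apply, smul_eq_mul,
    smul_eq_mul, smul_eq_mul, phiVec, rhoVec, phiVecX,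
    ← PowerSeries.coeff_C_mul, ← PowerSeries.coeff_C_mul, ← PowerSeries.coeff_C_mul, ← map_sub,
    ← map_add]
  congr 1
  have h := chiSeries_add_mul_invSeries (a := a) (hb v.1 i)
  have h3 : PowerSeries.C (I / 2) = PowerSeries.C (1 / 2) * PowerSeries.C I := by
    rw [← map_mul]; congr 1; ring
  rw [map_mul, map_mul, map_pow, h3]
  linear_combination (PowerSeries.C (1 / 2) * PowerSeries.C I *
    (chiSeries a b (χ v.1) - PowerSeries.C (b i : ℂ)) * fullSeries a b (χ v.1) (β v.1) x t) * h

variable (hκ : ∀ j, 1 ≤ kappa a b (χ j)) (hs : ∀ j, 1 ≤ s j ∧ s j ≤ kappa a b (χ j) + 1)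
include hκ hs

/-- This is the first row of the Lax equation in x with λ replaced by the matrix Λ: it follows from
χ̂ = λ̂ + ∑ aᵢ²/(χ̂ + bᵢ) by taking coefficients, where aᵢ² = |qᵢ|². -/
lemma phiVecX_eq (x t : ℝ) : phiVecX a b χ β s K x t =
    I • (phiVec a b χ β s K x t ᵥ* spectralMatrix a b χ K +
      ∑ i, star (planeWave a b x t i) • (planeWave a b x t i • rhoVec a b χ β s K i x t)) := by
  ext v
  have h1 : (phiVec a b χ β s K x t ᵥ* spectralMatrix a b χ K) v = coeff (pos a b χ s v)
      (lamSeries a b (χ v.1) * fullSeries a b (χ v.1) (β v.1) x t) := by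
    rw [coeff_lamSeries]
    exact sum_mul_spectralMatrix hs (fun j n => coeff n (fullSeries a b (χ j) (β j) x t)) v
  simp only [Pi.smul_apply, Pi.add_apply, Finset.sum_apply, smul_eq_mul, h1, ← mul_assoc,
    star_planeWave_mul_planeWave]
  have h2 : chiSeries a b (χ v.1) = lamSeries a b (χ v.1) +
      ∑ i, PowerSeries.C ((a i : ℂ) ^ 2) * invSeries a b (χ v.1) i := by
    rw [← (chiSeries_spec (hb v.1) (hκ v.1)).2, sub_add_cancel]
  rw [phiVecX, mul_assoc, PowerSeries.coeff_C_mul, h2, add_mul, map_add, Finset.sum_mul, map_sum]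
  congr 2
  refine Finset.sum_congr rfl fun i _ => ?_
  rw [mul_assoc, PowerSeries.coeff_C_mul, rhoVec]

/-- The coefficients of the Lyapunov equation for series are read off at the chosen positions, where
multiplication by λ̂_j acts as Λ on the columns and multiplication by λ̂_k* as its adjoint on the
rows. -/
lemma gramMatrix_lyapunov (him : ∀ j, 0 < (χ j).im) (x t : ℝ) :
    (spectralMatrix a b χ K)ᴴ * gramMatrix a b χ β s K x t -
        gramMatrix a b χ β s K x t * spectralMatrix a b χ K =
      Matrix.vecMulVec (star (phiVec a b χ β s K x t)) (phiVec a b χ β s K x t) +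
      ∑ i, Matrix.vecMulVec (star (planeWave a b x t i • rhoVec a b χ β s K i x t))
        (planeWave a b x t i • rhoVec a b χ β s K i x t) := by
  ext u v
  have h1 : (gramMatrix a b χ β s K x t * spectralMatrix a b χ K) u v =
      coeff2 (pos a b χ s u) (pos a b χ s v) (outer2 (lamSeries a b (χ v.1)) *
        gramSeries a b (χ u.1) (χ v.1) (β u.1) (β v.1) x t) := by
    rw [coeff2_lamSeries_outer]
    exact sum_mul_spectralMatrix hs (fun j n => coeff2 (pos a b χ s u) n
      (gramSeries a b (χ u.1) (χ j) (β u.1) (β j) x t)) v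
  have h2 : ((spectralMatrix a b χ K)ᴴ * gramMatrix a b χ β s K x t) u v =
      coeff2 (pos a b χ s u) (pos a b χ s v) (inner1 (bar (lamSeries a b (χ u.1))) *
        gramSeries a b (χ u.1) (χ v.1) (β u.1) (β v.1) x t) := by
    rw [coeff2_lamSeries_inner]
    have h3 := congrArg star (sum_mul_spectralMatrix (K := K) hs (fun j n => star (coeff2 n
      (pos a b χ s v) (gramSeries a b (χ j) (χ v.1) (β j) (β v.1) x t))) u)
    simp only [star_sum, star_add, star_mul', star_star] at h3
    rw [Matrix.mul_apply]
    simp only [Matrix.conjTranspose_apply]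
    refine Eq.trans (Finset.sum_congr rfl fun w _ => mul_comm _ _) (h3.trans ?_)
    split_ifs <;> simp
  rw [Matrix.sub_apply, h1, h2, ← coeff2_sub, ← sub_mul, lamSeries_mul_gramSeries (hb u.1) (hκ u.1)
    (hb v.1) (hκ v.1) (star_sub_ne_zero (him _) (him _)), coeff2_add, coeff2_inner1_mul_outer2,
    coeff2_sum, Matrix.add_apply, Matrix.sum_apply, coeff_bar]
  congr 1
  refine Finset.sum_congr rfl fun i _ => ?_
  rw [coeff2_C_mul, coeff2_inner1_mul_outer2, coeff_bar, ← star_planeWave_mul_planeWave x t i,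
    Matrix.vecMulVec_apply, star_smul]
  simp only [Pi.smul_apply, Pi.star_apply, smul_eq_mul, rhoVec]
  ring

omit hb hκ hs in
lemma det_mul_mul_entries {ι : Type*} [Fintype ι] [DecidableEq ι] (c d : ι → ℂ) (G : Matrix ι ι ℂ) :
    (Matrix.of fun u v => c u * d v * G u v).det = (∏ u, c u) * (∏ u, d u) * G.det := by
  have : (Matrix.of fun u v => c u * d v * G u v) = Matrix.diagonal c * G * Matrix.diagonal d := by
    ext u v
    rw [Matrix.mul_diagonal, Matrix.diagonal_mul, Matrix.of_apply]; ring
  rw [this, Matrix.det_mul, Matrix.det_mul, Matrix.det_diagonal, Matrix.det_diagonal]; ring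

/-- The normalisation `exp X_j^[0]`. -/
def expZero (a b : Fin N → ℝ) (χ : Fin p → ℂ) (β : Fin p → ℕ → ℂ) (x t : ℝ) (j : Fin p) : ℂ :=
  exp (Xcoeff a b (χ j) (β j) x t 0)

omit hb hκ hs in
lemma gramMatrix_eq (x t : ℝ) : gramMatrix a b χ β s K x t = Matrix.of fun u v =>
    star (expZero a b χ β x t u.1) * expZero a b χ β x t v.1 * Gmat a b χ β s K x t u v := by
  ext u v
  rw [gramMatrix, Matrix.of_apply, Matrix.of_apply, coeff2_gramSeries]
  rfl

omit hb hκ hs in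
lemma det_gramMatrix_eq (x t : ℝ) : (gramMatrix a b χ β s K x t).det =
    (∏ u : Σ j : Fin p, Fin (K j), star (expZero a b χ β x t u.1)) *
      (∏ u : Σ j : Fin p, Fin (K j), expZero a b χ β x t u.1) * (Gmat a b χ β s K x t).det := by
  rw [gramMatrix_eq, ← det_mul_mul_entries]

omit hκ hs in
-- Up to the diagonal normalisations exp X^[0], which cancel in the quotient, the two matrices
-- differ by the rank-one matrix φ*ρᵢ. The matrix determinant lemma then gives the quotient of
-- determinants as 1 + ρᵢ M⁻¹ φ*.
lemma rogueWave_eq (him : ∀ j, 0 < (χ j).im)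
    {x t : ℝ} (hdet : (gramMatrix a b χ β s K x t).det ≠ 0) (i : Fin N) :
    rogueWave a b χ β s K x t i = planeWave a b x t i +
      bracket (gramMatrix a b χ β s K x t)⁻¹ (planeWave a b x t i • rhoVec a b χ β s K i x t)
        (star (phiVec a b χ β s K x t)) := by
  have h1 : gramMatrix a b χ β s K x t + Matrix.replicateCol Unit (star (phiVec a b χ β s K x t)) *
      Matrix.replicateRow Unit (rhoVec a b χ β s K i x t) = Matrix.of fun u v =>
      star (expZero a b χ β x t u.1) * expZero a b χ β x t v.1 * GmatI a b χ β s K i x t u v := by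
    ext u v
    refine Eq.trans ?_ (coeff2_gramSeriesI i (hb v.1 i) (star_sub_ne_zero (him u.1) (him v.1))
      (pos a b χ s u) (pos a b χ s v)).symm
    simp [Matrix.mul_apply, gramMatrix, phiVec, rhoVec]
  have h2 := Matrix.det_add_replicateCol_mul_replicateRow (ι := Unit)
    (isUnit_iff_ne_zero.2 hdet) (star (phiVec a b χ β s K x t)) (rhoVec a b χ β s K i x t)
  rw [h1, det_mul_mul_entries, det_gramMatrix_eq] at h2
  have h3 : (1 + Matrix.replicateRow Unit (rhoVec a b χ β s K i x t) *
      (gramMatrix a b χ β s K x t)⁻¹ *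
      Matrix.replicateCol Unit (star (phiVec a b χ β s K x t))).det =
      1 + bracket (gramMatrix a b χ β s K x t)⁻¹ (rhoVec a b χ β s K i x t)
        (star (phiVec a b χ β s K x t)) := by
    rw [Matrix.det_unique, Matrix.add_apply, Matrix.mul_assoc, bracket]
    simp [Matrix.mul_apply, dotProduct, Matrix.mulVec]
  rw [h3] at h2
  rw [det_gramMatrix_eq] at hdet
  have h4 := right_ne_zero_of_mul hdet
  have h5 := left_ne_zero_of_mul hdet
  rw [rogueWave, bracket_smul_left, planeWave]
  have h6 : (GmatI a b χ β s K i x t).det / (Gmat a b χ β s K x t).det =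
      1 + bracket (gramMatrix a b χ β s K x t)⁻¹ (rhoVec a b χ β s K i x t)
        (star (phiVec a b χ β s K x t)) := by
    rw [div_eq_iff h4]
    refine mul_left_cancel₀ h5 ?_
    rw [h2]; ring
  rw [h6]; ring

omit hb hκ hs in
lemma det_mem {ι : Type*} [Fintype ι] [DecidableEq ι] {T : Type*} {A : Subalgebra ℂ (T → ℂ)}
    {M : T → Matrix ι ι ℂ} (h : ∀ u v, (fun y => M y u v) ∈ A) : (fun y => (M y).det) ∈ A := by
  simp only [Matrix.det_apply']
  refine fun_sum_mem fun σ _ => fun_mul_mem (const_mem _) ?_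
  have := A.prod_mem (t := Finset.univ) fun u _ => h (σ u) u
  convert this using 1
  ext y; simp

/-- The quotients of determinants solve the vector nonlinear Schrödinger equation. -/
theorem solvesVNLSE_rogueWave (hχ : Function.Injective χ) (him : ∀ j, 0 < (χ j).im) :
    SolvesVNLSE (rogueWave a b χ β s K) := by
  have hdet := det_gramMatrix_ne_zero (a := a) (b := b) (β := β) (K := K) hχ him fun j => (hs j).2
  refine ⟨fun i => ?_, fun x t i => ?_⟩
  · have h1 : ContDiff ℝ ∞ fun y : ℝ × ℝ => (GmatI a b χ β s K i y.1 y.2).det :=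
      det_mem (A := smoothAlgebra) fun u v => contDiff_HcoeffI _ _ _
    have h2 : ContDiff ℝ ∞ fun y : ℝ × ℝ => (Gmat a b χ β s K y.1 y.2).det :=
      det_mem (A := smoothAlgebra) fun u v => contDiff_Hcoeff _ _
    have h3 : ∀ y : ℝ × ℝ, (Gmat a b χ β s K y.1 y.2).det ≠ 0 := fun y => by
      have := hdet y.1 y.2
      rw [det_gramMatrix_eq] at this
      exact right_ne_zero_of_mul this
    simp only [rogueWave, div_eq_mul_inv]
    exact (contDiff_const.mul (h1.mul (h2.inv h3))).mul (contDiff_phase i)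
  · have h := dressing_solves (q := planeWave a b)
      (qx := fun x t i => I * b i * planeWave a b x t i)
      (qxx := fun x t i => I * b i * (I * b i * planeWave a b x t i))
      (qt := fun x t i => I * ((ampSq a : ℂ) - (b i : ℂ) ^ 2 / 2) * planeWave a b x t i)
      (c := ampSq a) (φ := phiVec a b χ β s K) (u := phiVecX a b χ β s K)
      (v := phiVecXX a b χ β s K)
      (ψ := fun i x t => planeWave a b x t i • rhoVec a b χ β s K i x t)
      (M := gramMatrix a b χ β s K) (Λ := spectralMatrix a b χ K)
      hasDerivAt_planeWave_x (fun x t i => (hasDerivAt_planeWave_x x t i).const_mul _)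
      hasDerivAt_planeWave_t
      (fun x t i => by linear_combination (ampSq a : ℂ) * planeWave a b x t i * I_sq)
      (fun x t => by
        rw [ampSq]; push_cast
        exact Finset.sum_congr rfl fun l _ => by rw [mul_comm, star_planeWave_mul_planeWave])
      hasDerivAt_phiVec_x hasDerivAt_phiVecX_x hasDerivAt_phiVec_t
      (fun i x t => by
        refine ((hasDerivAt_planeWave_x x t i).smul (hasDerivAt_rhoVec_x hb i x t)).congr_deriv ?_
        ext v
        simp only [Pi.add_apply, Pi.sub_apply, Pi.smul_apply, smul_eq_mul]
        ring)
      (fun i x t => by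
        refine ((hasDerivAt_planeWave_t x t i).smul (hasDerivAt_rhoVec_t hb i x t)).congr_deriv ?_
        ext v
        simp only [Pi.add_apply, Pi.sub_apply, Pi.smul_apply, smul_eq_mul]
        ring)
      (fun x t u v => hasDerivAt_gramSeries_x (star_sub_ne_zero (him _) (him _)) _ _)
      (fun x t u v => hasDerivAt_gramSeries_t (star_sub_ne_zero (him _) (him _)) _ _)
      star_gramMatrix hdet (phiVecX_eq hb hκ hs) (gramMatrix_lyapunov hb hκ hs him) x t i
    simpa only [rogueWave_eq hb him (hdet _ _)] using h

end family

end VNLS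

end

noncomputable section
namespace VNLS
open Finset.HasAntidiagonal (antidiagonal mem_antidiagonal)
open PowerSeries (coeff)

variable {N p : ℕ} {a b : Fin N → ℝ} {w z : ℂ} {β βw βz : ℕ → ℂ} {r : ℝ}

/-! ### Evaluation at small parameters -/

/-- A radius at which all the series at the root `z` converge absolutely. -/
structure GoodRadius (a b : Fin N → ℝ) (z : ℂ) (β : ℕ → ℂ) (r : ℝ) : Prop where
  pos : 0 < r
  chi : AbsConv (chiTail a b z) r
  lt : ∀ i, majorant (chiTail a b z) r < ‖z + b i‖
  beta : AbsConv (PowerSeries.mk β) r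

lemma eventually_goodRadius (hb : ∀ i, z + b i ≠ 0) (hκ : 1 ≤ kappa a b z)
    (hβ : ∃ ρ > 0, AbsConv (PowerSeries.mk β) ρ) :
    ∀ᶠ r in 𝓝[>] (0 : ℝ), GoodRadius a b z β r := by
  obtain ⟨⟨r, hr, hchi⟩, -⟩ := chiSeries_spec (a := a) hb hκ
  obtain ⟨ρ, hρ, hbeta⟩ := hβ
  have h1 : ∀ᶠ r' in 𝓝[>] (0 : ℝ), ∀ i, majorant (chiTail a b z) r' < ‖z + b i‖ :=
    eventually_all.2 fun i => (hchi.tendsto_majorant constantCoeff_chiTail hr).eventually_lt_const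
      (norm_pos_iff.2 (hb i))
  filter_upwards [h1, Ioc_mem_nhdsGT hr, Ioc_mem_nhdsGT hρ] with r' h1 h2 h3
  exact ⟨h2.1, hchi.mono h2.1.le h2.2, h1, hbeta.mono h3.1.le h3.2⟩

lemma evalAt_chiSeries (ε : ℂ) : evalAt (chiSeries a b z) ε = chiHat a b z ε := by
  simp only [evalAt, chiSeries, PowerSeries.coeff_mk, chiHat]

lemma summable_exp_majorant {f : PowerSeries ℂ} : Summable fun ν : ℕ =>
    ‖1 / (ν.factorial : ℂ)‖ * majorant f r ^ ν := by
  refine (Real.summable_pow_div_factorial (majorant f r)).congr fun ν => ?_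
  rw [norm_div, norm_one, Complex.norm_natCast]; ring

namespace GoodRadius

variable (h : GoodRadius a b z β r) {ε : ℂ}
include h

lemma chiSeries : AbsConv (chiSeries a b z) r := by
  rw [chiSeries_eq]; exact (absConv_C z r).add h.chi h.pos.le

lemma invSeries (i : Fin N) : AbsConv (invSeries a b z i) r := by
  rw [invSeries_eq]
  exact h.chi.geom constantCoeff_chiTail h.pos.le (h.lt i)

/-- The formal inverse converges too, so evaluating the formal identity shows at once that χ̂ + bᵢ
does not vanish and what its inverse is. -/
lemma chiHat_add_mul (i : Fin N) (hε : ‖ε‖ ≤ r) :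
    (chiHat a b z ε + b i) * evalAt (VNLS.invSeries a b z i) ε = 1 := by
  have hb : z + b i ≠ 0 := norm_pos_iff.1 ((majorant_nonneg h.pos.le).trans_lt (h.lt i))
  have h1 := congrArg (evalAt · ε) (chiSeries_add_mul_invSeries (a := a) hb)
  rw [(h.chiSeries.add (absConv_C _ _) h.pos.le).evalAt_mul (h.invSeries i) hε,
    h.chiSeries.evalAt_add (absConv_C _ _) hε, evalAt_C, evalAt_one, evalAt_chiSeries] at h1
  exact h1

lemma chiHat_add_ne_zero (i : Fin N) (hε : ‖ε‖ ≤ r) : chiHat a b z ε + b i ≠ 0 :=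
  left_ne_zero_of_mul_eq_one (h.chiHat_add_mul i hε)

lemma evalAt_invSeries (i : Fin N) (hε : ‖ε‖ ≤ r) :
    evalAt (VNLS.invSeries a b z i) ε = (chiHat a b z ε + b i)⁻¹ :=
  eq_inv_of_mul_eq_one_right (h.chiHat_add_mul i hε)

lemma lamHat_eq (hκ : 1 ≤ kappa a b z) (hε : ‖ε‖ ≤ r) : lamHat a b z ε =
    chiHat a b z ε - ∑ i, (a i : ℂ) ^ 2 / (chiHat a b z ε + b i) := by
  have hb : ∀ i, z + b i ≠ 0 := fun i =>
    norm_pos_iff.1 ((majorant_nonneg h.pos.le).trans_lt (h.lt i))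
  have hs : ∀ i ∈ (Finset.univ : Finset (Fin N)),
      AbsConv (PowerSeries.C ((a i : ℂ) ^ 2) * VNLS.invSeries a b z i) r :=
    fun i _ => (absConv_C _ _).mul (h.invSeries i) h.pos.le
  have h1 := congrArg (evalAt · ε) (chiSeries_spec (a := a) hb hκ).2
  rw [h.chiSeries.evalAt_sub (absConv_sum _ hs h.pos.le) hε, evalAt_sum _ hs hε, lamSeries,
    (absConv_C _ _).evalAt_add (absConv_monomial _ _ _) hε, evalAt_C, evalAt_monomial,
    evalAt_chiSeries] at h1
  rw [lamHat, ← h1]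
  congr 1
  refine Finset.sum_congr rfl fun i _ => ?_
  rw [(absConv_C _ _).evalAt_mul (h.invSeries i) hε, evalAt_C, h.evalAt_invSeries i hε,
    div_eq_mul_inv]

lemma Xcoeff (x t : ℝ) : AbsConv (PowerSeries.mk (Xcoeff a b z β x t)) r := by
  rw [mk_Xcoeff]
  exact ((((absConv_C _ _).mul h.chiSeries h.pos.le).add
    ((absConv_C _ _).mul (h.chiSeries.pow h.pos.le 2) h.pos.le) h.pos.le).add h.beta h.pos.le)

lemma phaseTail (x t : ℝ) : AbsConv (phaseTail a b z β x t) r := by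
  rw [phaseTail_eq]
  exact (h.Xcoeff x t).sub (absConv_C _ _) h.pos.le

lemma omegaHat_eq (x t : ℝ) (hε : ‖ε‖ ≤ r) : omegaHat a b z β ε x t =
    VNLS.Xcoeff a b z β x t 0 + evalAt (VNLS.phaseTail a b z β x t) ε := by
  have h1 := (absConv_C (I * x) r).mul h.chiSeries h.pos.le
  have h2 := (absConv_C (I / 2 * t) r).mul (h.chiSeries.pow h.pos.le 2) h.pos.le
  rw [phaseTail_eq, (h.Xcoeff x t).evalAt_sub (absConv_C _ _) hε, evalAt_C, mk_Xcoeff,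
    (h1.add h2 h.pos.le).evalAt_add h.beta hε, h1.evalAt_add h2 hε,
    (absConv_C _ _).evalAt_mul h.chiSeries hε,
    (absConv_C _ _).evalAt_mul (h.chiSeries.pow h.pos.le 2) hε, evalAt_C, evalAt_C,
    h.chiSeries.evalAt_pow hε, evalAt_chiSeries, omegaHat]
  simp only [evalAt, PowerSeries.coeff_mk]
  ring

lemma expSeries (x t : ℝ) : AbsConv (expSeries a b z β x t) r := by
  rw [expSeries_eq]
  exact (h.phaseTail x t).seriesComp constantCoeff_phaseTail h.pos.le (summable_exp_majorant)

lemma exp_omegaHat (x t : ℝ) (hε : ‖ε‖ ≤ r) : exp (omegaHat a b z β ε x t) =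
    exp (VNLS.Xcoeff a b z β x t 0) * evalAt (VNLS.expSeries a b z β x t) ε := by
  have h1 := hasSum_evalAt_seriesComp (h.phaseTail x t) constantCoeff_phaseTail hε
    (summable_exp_majorant)
  have h2 : HasSum (fun ν : ℕ => 1 / (ν.factorial : ℂ) *
      evalAt (VNLS.phaseTail a b z β x t) ε ^ ν) (exp (evalAt (VNLS.phaseTail a b z β x t) ε)) := by
    rw [Complex.exp_eq_exp_ℂ]
    have h3 := NormedSpace.expSeries_div_hasSum_exp (evalAt (VNLS.phaseTail a b z β x t) ε)
    simpa only [div_eq_inv_mul, mul_one] using h3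
  rw [h.omegaHat_eq x t hε, exp_add, expSeries_eq, h1.unique h2]

lemma fullSeries (x t : ℝ) : AbsConv (fullSeries a b z β x t) r :=
  (absConv_C _ _).mul (h.expSeries x t) h.pos.le

lemma evalAt_fullSeries (x t : ℝ) (hε : ‖ε‖ ≤ r) :
    evalAt (VNLS.fullSeries a b z β x t) ε = exp (omegaHat a b z β ε x t) := by
  rw [VNLS.fullSeries, (absConv_C _ _).evalAt_mul (h.expSeries x t) hε, evalAt_C,
    h.exp_omegaHat x t hε]

end GoodRadius

end VNLS

end

noncomputable section
namespace VNLS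
open Finset.HasAntidiagonal (antidiagonal mem_antidiagonal)
open PowerSeries (coeff)

variable {N p : ℕ} {a b : Fin N → ℝ} {w z : ℂ} {β βw βz : ℕ → ℂ} {r : ℝ}

/-! ### Averages over roots of unity -/

lemma sum_primitiveRoot_pow {μ : ℂ} {k : ℕ} (hμ : IsPrimitiveRoot μ k) (d : ℕ) :
    ∑ n ∈ Finset.range k, (μ ^ n) ^ d = if k ∣ d then (k : ℂ) else 0 := by
  simp only [← pow_mul, mul_comm _ d]
  simp only [pow_mul]
  split_ifs with h
  · rw [hμ.pow_eq_one_iff_dvd d |>.2 h]; simp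
  · have h1 : μ ^ d - 1 ≠ 0 := sub_ne_zero.2 fun h2 => h ((hμ.pow_eq_one_iff_dvd d).1 h2)
    refine (mul_eq_zero.1 ?_).resolve_left h1
    rw [mul_geom_sum, ← pow_mul, mul_comm d, pow_mul, hμ.pow_eq_one, one_pow, sub_self]

/-- The average over the rotations of the parameter picks out every `k`-th coefficient. -/
lemma AbsConv.hasSum_average {f : PowerSeries ℂ} (hf : AbsConv f r) {μ ε : ℂ} {k s : ℕ}
    (hμ : IsPrimitiveRoot μ k) (hk : 0 < k) (hs : 1 ≤ s ∧ s ≤ k) (hε0 : ε ≠ 0) (hε : ‖ε‖ ≤ r) :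
    HasSum (fun n => coeff ((n + 1) * k - s) f * ε ^ (n * k))
      (1 / (k * ε ^ k) * ∑ n ∈ Finset.range k, (μ ^ n * ε) ^ s * evalAt f (μ ^ n * ε)) := by
  have hk0 : (k : ℂ) ≠ 0 := Nat.cast_ne_zero.2 hk.ne'
  have hμ1 : ‖μ‖ = 1 := hμ.norm'_eq_one hk.ne'
  have h1 : HasSum (fun m => 1 / (k * ε ^ k) * ∑ n ∈ Finset.range k,
      (μ ^ n * ε) ^ s * (coeff m f * (μ ^ n * ε) ^ m))
      (1 / (k * ε ^ k) * ∑ n ∈ Finset.range k, (μ ^ n * ε) ^ s * evalAt f (μ ^ n * ε)) := by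
    refine (hasSum_sum fun n _ => HasSum.mul_left _ (hf.hasSum ?_)).mul_left _
    rw [norm_mul, norm_pow, hμ1, one_pow, one_mul]; exact hε
  have h2 : ∀ m, 1 / (k * ε ^ k) * ∑ n ∈ Finset.range k,
      (μ ^ n * ε) ^ s * (coeff m f * (μ ^ n * ε) ^ m) =
      1 / (k * ε ^ k) * (coeff m f * ε ^ (s + m)) * if k ∣ s + m then (k : ℂ) else 0 := by
    intro m
    rw [← sum_primitiveRoot_pow hμ, Finset.mul_sum, Finset.mul_sum]
    refine Finset.sum_congr rfl fun n _ => ?_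
    rw [mul_pow, mul_pow, pow_add, pow_add]; ring
  simp only [h2] at h1
  have hle : ∀ m : ℕ, k ≤ (m + 1) * k := fun m => Nat.le_mul_of_pos_left _ (Nat.succ_pos m)
  have hinj : Function.Injective fun n : ℕ => (n + 1) * k - s := by
    intro m n hmn
    have h4 := hle m
    have := hs.2
    have h5 := hle n
    have h6 : (m + 1) * k = (n + 1) * k := by
      simp only at hmn; omega
    simpa using Nat.eq_of_mul_eq_mul_right hk h6
  -- Only the exponents with k ∣ s + m survive the average. As s ≥ 1, the multiple 0 is excluded, so
  -- these are m = (n+1)k - s with n ≥ 0.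
  rw [← hinj.hasSum_iff] at h1
  · convert h1 using 1
    funext n
    have h3 : s + ((n + 1) * k - s) = (n + 1) * k := by have := hle n; have := hs.2; omega
    rw [Function.comp, h3, if_pos (Dvd.intro_left _ rfl), add_mul, one_mul, pow_add]
    field_simp
  · intro m hm
    rw [if_neg, mul_zero]
    rintro ⟨c, hc⟩
    rcases c with _ | c
    · rw [mul_zero] at hc
      have := hs.1; omega
    · refine hm ⟨c, ?_⟩
      have h3 : (c + 1) * k = s + m := by rw [hc, mul_comm]
      simp only; omega

lemma isPrimitiveRoot_muRoot : IsPrimitiveRoot (muRoot a b z) (kappa a b z + 1) := by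
  have h := Complex.isPrimitiveRoot_exp (kappa a b z + 1) (Nat.succ_ne_zero _)
  rwa [Nat.cast_add, Nat.cast_one] at h

lemma norm_muRoot_pow_mul (n : ℕ) (ε : ℂ) : ‖muRoot a b z ^ n * ε‖ = ‖ε‖ := by
  rw [norm_mul, norm_pow, isPrimitiveRoot_muRoot.norm'_eq_one (Nat.succ_ne_zero _), one_pow,
    one_mul]

/-- λ̂ depends only on ε^(κ+1). All the rotated solutions therefore share one spectral parameter,
and their average still solves the Lax pair. -/
lemma lamHat_muRoot_pow_mul (n : ℕ) (ε : ℂ) :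
    lamHat a b z (muRoot a b z ^ n * ε) = lamHat a b z ε := by
  rw [lamHat, lamHat, mul_pow, ← pow_mul, mul_comm n, pow_mul, isPrimitiveRoot_muRoot.pow_eq_one,
    one_pow, one_mul]

/-- The averaged solution is thus a power series in ε^(κ+1) whose coefficients are those of exp ω at
the positions used in the Gram matrix. -/
lemma GoodRadius.hasSum_psiRed_inl (h : GoodRadius a b z β r) {s : ℕ} {ε : ℂ}
    (hs : 1 ≤ s ∧ s ≤ kappa a b z + 1) (hε0 : ε ≠ 0) (hε : ‖ε‖ ≤ r) (x t : ℝ) :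
    HasSum (fun n => coeff ((n + 1) * (kappa a b z + 1) - s) (VNLS.fullSeries a b z β x t) *
      ε ^ (n * (kappa a b z + 1))) (psiRed a b z β s ε x t (Sum.inl ())) := by
  convert (h.fullSeries x t).hasSum_average isPrimitiveRoot_muRoot (Nat.succ_pos _) hs hε0 hε using 1
  rw [psiRed, Nat.cast_add, Nat.cast_one]
  congr 1
  refine Finset.sum_congr rfl fun n _ => ?_
  rw [h.evalAt_fullSeries x t ((norm_muRoot_pow_mul n ε).trans_le hε)]
  rfl

lemma GoodRadius.hasSum_psiRed_inr (h : GoodRadius a b z β r) {s : ℕ} {ε : ℂ}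
    (hs : 1 ≤ s ∧ s ≤ kappa a b z + 1) (hε0 : ε ≠ 0) (hε : ‖ε‖ ≤ r) (x t : ℝ) (i : Fin N) :
    HasSum (fun n => coeff ((n + 1) * (kappa a b z + 1) - s)
      (VNLS.invSeries a b z i * VNLS.fullSeries a b z β x t) *
      ε ^ (n * (kappa a b z + 1))) (psiRed a b z β s ε x t (Sum.inr i)) := by
  convert ((h.invSeries i).mul (h.fullSeries x t) h.pos.le).hasSum_average
    isPrimitiveRoot_muRoot (Nat.succ_pos _) hs hε0 hε using 1
  rw [psiRed, Nat.cast_add, Nat.cast_one]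
  congr 1
  refine Finset.sum_congr rfl fun n _ => ?_
  have h1 := (norm_muRoot_pow_mul (a := a) (b := b) (z := z) n ε).trans_le hε
  rw [(h.invSeries i).evalAt_mul (h.fullSeries x t) h1, h.evalAt_fullSeries x t h1,
    h.evalAt_invSeries i h1, mul_comm (_⁻¹), ← div_eq_mul_inv]
  rfl

/-! ### Solutions of the Lax pair -/

lemma matQ_mulVec (v f : Fin N → ℂ) (e : Unit → ℂ) : matQ v *ᵥ Sum.elim e f =
    Sum.elim (fun _ => ∑ j, star (v j) * f j) (fun i => v i * e ()) := by
  rw [matQ, Matrix.fromBlocks_mulVec]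
  ext (i | i) <;> simp [Matrix.mulVec, dotProduct]

lemma sigma3_mulVec (f : Fin N → ℂ) (e : Unit → ℂ) :
    sigma3 *ᵥ Sum.elim e f = Sum.elim e (-f) := by
  rw [sigma3, Matrix.fromBlocks_mulVec]
  ext (i | i) <;> simp [Matrix.neg_mulVec]

lemma laxU_mulVec (lam : ℂ) (v f : Fin N → ℂ) (e : Unit → ℂ) : laxU lam v *ᵥ Sum.elim e f =
    Sum.elim (fun _ => I * (lam * e () + ∑ j, star (v j) * f j)) (fun i => I * (v i * e ())) := by
  rw [laxU, Matrix.smul_mulVec, Matrix.add_mulVec, Matrix.smul_mulVec, Matrix.add_mulVec,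
    Matrix.one_mulVec, sigma3_mulVec, matQ_mulVec]
  ext (i | i)
  · simp; ring
  · simp

lemma laxV_mulVec (a : Fin N → ℝ) (lam : ℂ) (v vx f : Fin N → ℂ) (e : Unit → ℂ) :
    laxV a lam v vx *ᵥ Sum.elim e f =
    Sum.elim (fun _ => I * (lam ^ 2 / 2 * e () + lam / 2 * (∑ j, star (v j) * f j) -
        1 / 2 * (∑ j, star (v j) * (v j * e ()) + I * ∑ j, star (vx j) * f j) + ampSq a * e ()))
      (fun i => I * (lam / 2 * (v i * e ()) +
        1 / 2 * (v i * (∑ j, star (v j) * f j) + I * (vx i * e ())) + ampSq a * f i)) := by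
  have h1 : sigma3 *ᵥ (Sum.elim (fun _ => ∑ j, star (v j) * (v j * e ()))
      (fun i => v i * ∑ j, star (v j) * f j) +
      I • Sum.elim (fun _ => ∑ j, star (vx j) * f j) (fun i => vx i * e ())) =
      Sum.elim (fun _ => ∑ j, star (v j) * (v j * e ()) + I * ∑ j, star (vx j) * f j)
        (-fun i => v i * (∑ j, star (v j) * f j) + I * (vx i * e ())) := by
    rw [← sigma3_mulVec]
    congr 1
    ext (i | i) <;> rfl
  rw [laxV, Matrix.smul_mulVec, Matrix.add_mulVec, Matrix.sub_mulVec, Matrix.add_mulVec,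
    Matrix.smul_mulVec, Matrix.smul_mulVec, Matrix.smul_mulVec, Matrix.smul_mulVec,
    Matrix.add_mulVec, ← Matrix.mulVec_mulVec, Matrix.add_mulVec, ← Matrix.mulVec_mulVec,
    Matrix.smul_mulVec, Matrix.one_mulVec, sigma3_mulVec, matQ_mulVec, matQ_mulVec, matQ_mulVec,
    h1]
  ext (i | i)
  · simp only [Pi.smul_apply, Pi.add_apply, Pi.sub_apply, Sum.elim_inl, smul_eq_mul]
    ring
  · simp only [Pi.smul_apply, Pi.add_apply, Pi.sub_apply, Pi.neg_apply, Sum.elim_inr, smul_eq_mul]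
    ring

lemma SolvesLax.sum {q : ℝ → ℝ → Fin N → ℂ} {lam : ℂ} {ι : Type*} (s : Finset ι) (c : ι → ℂ)
    {Φ : ι → ℝ → ℝ → Unit ⊕ Fin N → ℂ} (h : ∀ i ∈ s, SolvesLax a q lam (Φ i)) :
    SolvesLax a q lam (fun x t => ∑ i ∈ s, c i • Φ i x t) := by
  intro x t
  simp only [Matrix.mulVec_sum, Matrix.mulVec_smul]
  exact ⟨HasDerivAt.fun_sum fun i hi => ((h i hi) x t).1.const_smul (c i),
    HasDerivAt.fun_sum fun i hi => ((h i hi) x t).2.const_smul (c i)⟩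

/-- The characteristic equation enters as q†ψ = (X - λ)φ. The term with q_x reduces to it by b/(X +
b) = 1 - X/(X + b) together with the constant density |a|². -/
lemma solvesLax_exp {X B lam : ℂ} (hX : ∀ i, X + b i ≠ 0)
    (hlam : lam = X - ∑ i, (a i : ℂ) ^ 2 / (X + b i)) :
    SolvesLax a (planeWave a b) lam (fun x t =>
      Sum.elim (fun _ => exp (I * (X * x + (1 / 2) * X ^ 2 * t) + B)) (fun i =>
        planeWave a b x t i * (exp (I * (X * x + (1 / 2) * X ^ 2 * t) + B) / (X + b i)))) := by
  intro x t
  have hEx : HasDerivAt (fun y : ℝ => exp (I * (X * y + (1 / 2) * X ^ 2 * t) + B))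
      (I * X * exp (I * (X * x + (1 / 2) * X ^ 2 * t) + B)) x := by
    have h := (((((Complex.ofRealCLM.hasDerivAt (x := x)).const_mul X).add_const
      ((1 / 2) * X ^ 2 * t)).const_mul I).add_const B).cexp
    simp only [Complex.ofRealCLM_apply, Complex.ofReal_one, mul_one] at h
    refine h.congr_deriv ?_
    ring
  have hEt : HasDerivAt (fun y : ℝ => exp (I * (X * x + (1 / 2) * X ^ 2 * y) + B))
      (I / 2 * X ^ 2 * exp (I * (X * x + (1 / 2) * X ^ 2 * t) + B)) t := by
    have h := (((((Complex.ofRealCLM.hasDerivAt (x := t)).const_mul ((1 / 2) * X ^ 2)).const_add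
      (X * x)).const_mul I).add_const B).cexp
    simp only [Complex.ofRealCLM_apply, Complex.ofReal_one, mul_one] at h
    refine h.congr_deriv ?_
    ring
  set E := exp (I * (X * x + (1 / 2) * X ^ 2 * t) + B) with hE
  have hS : ∑ j, star (planeWave a b x t j) * (planeWave a b x t j * (E / (X + b j))) =
      (X - lam) * E := by
    rw [hlam, sub_sub_cancel, Finset.sum_mul]
    refine Finset.sum_congr rfl fun j _ => ?_
    rw [← mul_assoc, star_planeWave_mul_planeWave]; ring
  have hA : ∑ j, star (planeWave a b x t j) * (planeWave a b x t j * E) = ampSq a * E := by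
    rw [ampSq, Complex.ofReal_sum, Finset.sum_mul]
    refine Finset.sum_congr rfl fun j _ => ?_
    rw [← mul_assoc, star_planeWave_mul_planeWave]; push_cast; ring
  have hSx : I * ∑ j, star (I * b j * planeWave a b x t j) *
      (planeWave a b x t j * (E / (X + b j))) = (ampSq a - X * (X - lam)) * E := by
    rw [sub_mul, mul_assoc, ← hS, ← hA, Finset.mul_sum, Finset.mul_sum, ← Finset.sum_sub_distrib]
    refine Finset.sum_congr rfl fun j _ => ?_
    have h1 : star (I * (b j : ℂ)) = -(I * b j) := by simp
    rw [star_mul', h1]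
    have h2 : E = E / (X + b j) * (X + b j) := (div_mul_cancel₀ _ (hX j)).symm
    linear_combination (-(b j : ℂ) * star (planeWave a b x t j) * planeWave a b x t j *
      (E / (X + b j))) * I_sq - star (planeWave a b x t j) * planeWave a b x t j * h2
  constructor
  · rw [laxU_mulVec]
    refine hasDerivAt_pi.2 fun c => ?_
    rcases c with c | i
    · refine hEx.congr_deriv ?_
      simp only [Sum.elim_inl]
      rw [hS]; ring
    · refine ((hasDerivAt_planeWave_x x t i).mul (hEx.div_const (X + b i))).congr_deriv ?_
      simp only [Sum.elim_inr]
      have h2 : E = E / (X + b i) * (X + b i) := (div_mul_cancel₀ _ (hX i)).symm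
      change I * b i * planeWave a b x t i * (E / (X + b i)) +
        planeWave a b x t i * (I * X * E / (X + b i)) = _
      linear_combination -(I * planeWave a b x t i) * h2
  · simp only [(hasDerivAt_planeWave_x _ _ _).deriv]
    rw [laxV_mulVec]
    refine hasDerivAt_pi.2 fun c => ?_
    rcases c with c | i
    · refine hEt.congr_deriv ?_
      simp only [Sum.elim_inl]
      rw [hS, hSx, hA]; ring
    · refine ((hasDerivAt_planeWave_t x t i).mul (hEt.div_const (X + b i))).congr_deriv ?_
      simp only [Sum.elim_inr]
      rw [hS]
      have h2 : E = E / (X + b i) * (X + b i) := (div_mul_cancel₀ _ (hX i)).symm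
      change I * ((ampSq a : ℂ) - (b i : ℂ) ^ 2 / 2) * planeWave a b x t i * (E / (X + b i)) +
        planeWave a b x t i * (I / 2 * X ^ 2 * E / (X + b i)) = _
      linear_combination -(I * planeWave a b x t i * b i * E / 2) * I_sq -
        (planeWave a b x t i * I * (X - b i) / 2) * h2

lemma GoodRadius.solvesLax_Psi (h : GoodRadius a b z β r) (hκ : 1 ≤ kappa a b z) (s : ℕ) {ε : ℂ}
    (hε : ‖ε‖ ≤ r) : SolvesLax a (planeWave a b) (lamHat a b z ε) (Psi a b z β s ε) := by
  have h1 := SolvesLax.sum (a := a) (q := planeWave a b) (lam := lamHat a b z ε)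
    (Finset.range (kappa a b z + 1)) (fun n => (1 / (((kappa a b z : ℂ) + 1) *
      ε ^ (kappa a b z + 1))) * (muRoot a b z ^ n * ε) ^ s)
    (fun n _ => solvesLax_exp (B := ∑' k, β k * (muRoot a b z ^ n * ε) ^ k)
      (fun i => h.chiHat_add_ne_zero i ((norm_muRoot_pow_mul n ε).trans_le hε))
      ((lamHat_muRoot_pow_mul n ε).symm.trans
        (h.lamHat_eq hκ ((norm_muRoot_pow_mul n ε).trans_le hε))))
  convert h1 using 1
  funext x t c
  rcases c with c | i
  · simp only [Psi, psiRed, phiRed, Sum.elim_inl, omegaHat, Finset.sum_apply, Pi.smul_apply,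
      smul_eq_mul, Finset.mul_sum]
    exact Finset.sum_congr rfl fun n _ => by ring
  · simp only [Psi, psiRed, phiRed, Sum.elim_inr, omegaHat, Finset.sum_apply, Pi.smul_apply,
      smul_eq_mul, Finset.mul_sum]
    exact Finset.sum_congr rfl fun n _ => by ring

end VNLS

end

noncomputable section
namespace VNLS
open Finset.HasAntidiagonal (antidiagonal mem_antidiagonal)
open PowerSeries (coeff)

variable {N p : ℕ} {a b : Fin N → ℝ} {w z : ℂ} {β βw βz : ℕ → ℂ} {r : ℝ}

lemma hasSum_of_eq {ι : Type*} {f g : ι → ℂ} {F : ℂ} (hf : HasSum f F) (h : ∀ i, f i = g i) :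
    HasSum g F := by
  rwa [← funext h]

lemma hasSum_mul_prod {f g : ℕ → ℂ} {F G : ℂ} (hf : HasSum f F) (hg : HasSum g G) :
    HasSum (fun e : ℕ × ℕ => f e.1 * g e.2) (F * G) := by
  have h1 : Summable fun n => ‖f n‖ := hf.summable.norm
  have h2 : Summable fun n => ‖g n‖ := hg.summable.norm
  exact HasSum.mul hf hg (summable_mul_of_summable_norm h1 h2)

/-! ### Solutions of a Lyapunov recursion -/

section lyapunov

variable {g R : ℕ → ℕ → ℂ} {d c₁ c₂ σ τ : ℂ} {ρ₁ ρ₂ C : ℝ}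

/-- Induction on m + n. In the weighted norm the two preceding entries contribute at most half of
‖d‖ times the bound, and 2C/‖d‖ is the value that reproduces itself: C + (‖d‖/2)(2C/‖d‖) = ‖d‖
(2C/‖d‖). -/
lemma norm_le_of_lyapunov (hd : d ≠ 0) (h : ∀ m n, d * g m n +
      c₁ * (if m = 0 then 0 else g (m - 1) n) - c₂ * (if n = 0 then 0 else g m (n - 1)) = R m n)
    (hρ₁ : 0 ≤ ρ₁) (hρ₂ : 0 ≤ ρ₂) (hC : ∀ m n, ‖R m n‖ * (ρ₁ ^ m * ρ₂ ^ n) ≤ C)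
    (hsmall : ‖c₁‖ * ρ₁ + ‖c₂‖ * ρ₂ ≤ ‖d‖ / 2) (m n : ℕ) :
    ‖g m n‖ * (ρ₁ ^ m * ρ₂ ^ n) ≤ 2 * C / ‖d‖ := by
  have hd' : 0 < ‖d‖ := norm_pos_iff.2 hd
  have hC0 : 0 ≤ C := (by positivity : 0 ≤ ‖R 0 0‖ * (ρ₁ ^ 0 * ρ₂ ^ 0)).trans (hC 0 0)
  have hM : 0 ≤ 2 * C / ‖d‖ := by positivity
  induction hk : m + n using Nat.strong_induction_on generalizing m n with
  | _ k ih =>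
    have h1 : ‖if m = 0 then 0 else g (m - 1) n‖ * (ρ₁ ^ m * ρ₂ ^ n) ≤ ρ₁ * (2 * C / ‖d‖) := by
      rcases m with _ | m
      · simp only [if_true, norm_zero, zero_mul]; positivity
      · have := ih (m + n) (by omega) m n rfl
        simp only [Nat.add_sub_cancel, if_neg (Nat.succ_ne_zero m)]
        calc _ = ρ₁ * (‖g m n‖ * (ρ₁ ^ m * ρ₂ ^ n)) := by ring
          _ ≤ _ := by gcongr
    have h2 : ‖if n = 0 then 0 else g m (n - 1)‖ * (ρ₁ ^ m * ρ₂ ^ n) ≤ ρ₂ * (2 * C / ‖d‖) := by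
      rcases n with _ | n
      · simp only [if_true, norm_zero, zero_mul]; positivity
      · have := ih (m + n) (by omega) m n rfl
        simp only [Nat.add_sub_cancel, if_neg (Nat.succ_ne_zero n)]
        calc _ = ρ₂ * (‖g m n‖ * (ρ₁ ^ m * ρ₂ ^ n)) := by ring
          _ ≤ _ := by gcongr
    have h3 : ‖d‖ * ‖g m n‖ ≤ ‖R m n‖ + ‖c₁‖ * ‖if m = 0 then 0 else g (m - 1) n‖ +
        ‖c₂‖ * ‖if n = 0 then 0 else g m (n - 1)‖ := by
      rw [← norm_mul, ← norm_mul, ← norm_mul]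
      have h4 : d * g m n = R m n - c₁ * (if m = 0 then 0 else g (m - 1) n) +
          c₂ * (if n = 0 then 0 else g m (n - 1)) := by rw [← h]; ring
      rw [h4]
      exact (norm_add_le _ _).trans (add_le_add_left (norm_sub_le _ _) _)
    rw [le_div_iff₀ hd']
    have h5 : (0 : ℝ) ≤ ρ₁ ^ m * ρ₂ ^ n := by positivity
    have h6 := mul_le_mul_of_nonneg_right h3 h5
    have h7 := mul_le_mul_of_nonneg_left h1 (norm_nonneg c₁)
    have h8 := mul_le_mul_of_nonneg_left h2 (norm_nonneg c₂)
    have h9 := mul_le_mul_of_nonneg_right hsmall hM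
    have h10 : ‖d‖ / 2 * (2 * C / ‖d‖) = C := by field_simp
    linarith [hC m n]

lemma summable_norm_of_le (hρ₁ : 0 < ρ₁) (hρ₂ : 0 < ρ₂)
    (hC : ∀ m n, ‖g m n‖ * (ρ₁ ^ m * ρ₂ ^ n) ≤ C) (hσ : ‖σ‖ < ρ₁) (hτ : ‖τ‖ < ρ₂) :
    Summable fun e : ℕ × ℕ => ‖g e.1 e.2 * σ ^ e.1 * τ ^ e.2‖ := by
  have h1 : ∀ {ρ : ℝ} {σ : ℂ}, 0 < ρ → ‖σ‖ < ρ → Summable fun n : ℕ => (‖σ‖ / ρ) ^ n :=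
    fun hρ hσ => summable_geometric_of_lt_one (by positivity) ((div_lt_one hρ).2 hσ)
  refine Summable.of_nonneg_of_le (fun _ => norm_nonneg _) (fun e => ?_)
    (((h1 hρ₁ hσ).mul_of_nonneg (h1 hρ₂ hτ) (fun _ => by simp only [Pi.zero_apply]; positivity)
      (fun _ => by simp only [Pi.zero_apply]; positivity)).mul_left C)
  rw [norm_mul, norm_mul, norm_pow, norm_pow]
  calc _ = ‖g e.1 e.2‖ * (ρ₁ ^ e.1 * ρ₂ ^ e.2) * ((‖σ‖ / ρ₁) ^ e.1 * (‖τ‖ / ρ₂) ^ e.2) := by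
        rw [div_pow, div_pow]; field_simp
    _ ≤ _ := mul_le_mul_of_nonneg_right (hC _ _) (by positivity)

lemma sub_ne_zero_of_small (hd : d ≠ 0) (hσ : ‖σ‖ ≤ ρ₁) (hτ : ‖τ‖ ≤ ρ₂)
    (hsmall : ‖c₁‖ * ρ₁ + ‖c₂‖ * ρ₂ ≤ ‖d‖ / 2) : d + c₁ * σ - c₂ * τ ≠ 0 := by
  intro h
  have hd' : 0 < ‖d‖ := norm_pos_iff.2 hd
  have h1 : d = c₂ * τ - c₁ * σ := by linear_combination h
  have h2 : ‖d‖ ≤ ‖c₂‖ * ‖τ‖ + ‖c₁‖ * ‖σ‖ := by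
    rw [← norm_mul, ← norm_mul]; conv_lhs => rw [h1]
    exact norm_sub_le _ _
  have h3 := mul_le_mul_of_nonneg_left hσ (norm_nonneg c₁)
  have h4 := mul_le_mul_of_nonneg_left hτ (norm_nonneg c₂)
  linarith

/-- The shifts of the indices multiply the sum G by σ and τ, so the recursion sums to (d + c₁σ -
c₂τ) G = S. -/
lemma hasSum_of_lyapunov (h : ∀ m n, d * g m n +
      c₁ * (if m = 0 then 0 else g (m - 1) n) - c₂ * (if n = 0 then 0 else g m (n - 1)) = R m n)
    (hg : Summable fun e : ℕ × ℕ => ‖g e.1 e.2 * σ ^ e.1 * τ ^ e.2‖)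
    (hne : d + c₁ * σ - c₂ * τ ≠ 0) {S : ℂ}
    (hR : HasSum (fun e : ℕ × ℕ => R e.1 e.2 * σ ^ e.1 * τ ^ e.2) S) :
    HasSum (fun e : ℕ × ℕ => g e.1 e.2 * σ ^ e.1 * τ ^ e.2) (S / (d + c₁ * σ - c₂ * τ)) := by
  obtain ⟨G, hG⟩ := hg.of_norm
  have h1 : HasSum (fun e : ℕ × ℕ => (if e.1 = 0 then 0 else g (e.1 - 1) e.2) * σ ^ e.1 * τ ^ e.2)
      (σ * G) := by
    have hinj : Function.Injective fun e : ℕ × ℕ => (e.1 + 1, e.2) := fun e e' he => by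
      simp only [Prod.mk.injEq, Nat.add_right_cancel_iff] at he; exact Prod.ext he.1 he.2
    refine (hinj.hasSum_iff fun e he => ?_).1 ?_
    · rcases e with ⟨_ | m, n⟩
      · simp
      · exact absurd ⟨(m, n), rfl⟩ he
    · refine hasSum_of_eq (hG.mul_left σ) fun e => ?_
      simp only [Function.comp, Nat.add_sub_cancel, if_neg (Nat.succ_ne_zero _), pow_succ]
      ring
  have h2 : HasSum (fun e : ℕ × ℕ => (if e.2 = 0 then 0 else g e.1 (e.2 - 1)) * σ ^ e.1 * τ ^ e.2)
      (τ * G) := by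
    have hinj : Function.Injective fun e : ℕ × ℕ => (e.1, e.2 + 1) := fun e e' he => by
      simp only [Prod.mk.injEq, Nat.add_right_cancel_iff] at he; exact Prod.ext he.1 he.2
    refine (hinj.hasSum_iff fun e he => ?_).1 ?_
    · rcases e with ⟨m, _ | n⟩
      · simp
      · exact absurd ⟨(m, n), rfl⟩ he
    · refine hasSum_of_eq (hG.mul_left τ) fun e => ?_
      simp only [Function.comp, Nat.add_sub_cancel, if_neg (Nat.succ_ne_zero _), pow_succ]
      ring
  have h3 := ((hG.mul_left d).add (h1.mul_left c₁)).sub (h2.mul_left c₂)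
  have h4 : d * G + c₁ * (σ * G) - c₂ * (τ * G) = S := by
    refine h3.unique (hasSum_of_eq hR fun e => ?_)
    rw [← h]; ring
  have h5 : S / (d + c₁ * σ - c₂ * τ) = G := by
    rw [div_eq_iff hne, ← h4]; ring
  rw [h5]
  exact hG

end lyapunov

/-! ### The generating functions of the entries -/

/-- The selected coefficients of a series. -/
def entry (k s : ℕ) (f : PowerSeries ℂ) (n : ℕ) : ℂ := coeff ((n + 1) * k - s) f

lemma AbsConv.norm_entry_le {f : PowerSeries ℂ} (hf : AbsConv f r) (hr : 0 < r) {k s : ℕ}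
    (hs : s ≤ k) (n : ℕ) : ‖entry k s f n‖ * (r ^ k) ^ n ≤ majorant f r / r ^ (k - s) := by
  have h1 : ‖coeff ((n + 1) * k - s) f‖ * r ^ ((n + 1) * k - s) ≤ majorant f r :=
    hf.le_tsum _ fun _ _ => by positivity
  have h2 : (n + 1) * k - s = k * n + (k - s) := by
    rw [add_mul, one_mul, mul_comm, Nat.add_sub_assoc hs]
  rw [le_div_iff₀ (pow_pos hr _), mul_assoc, ← pow_mul, ← pow_add, ← h2]
  exact h1

/-- The selected coefficients of `exp (ω_k* + ω_j) / (χ̂_k* - χ̂_j)`. -/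
def gramEntry (a b : Fin N → ℝ) (w z : ℂ) (βw βz : ℕ → ℂ) (sw sz : ℕ) (x t : ℝ) (m n : ℕ) : ℂ :=
  coeff2 ((m + 1) * (kappa a b w + 1) - sw) ((n + 1) * (kappa a b z + 1) - sz)
    (gramSeries a b w z βw βz x t)

section

variable {sw sz : ℕ} {x t : ℝ}

/-- The shift by κ + 1 is exactly the step between consecutive selected positions. At index 0 the
position lies below κ + 1, because s ≥ 1, and the shifted term is absent. -/
lemma gramEntry_lyapunov (hb : ∀ i, w + b i ≠ 0) (hκ : 1 ≤ kappa a b w)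
    (hb' : ∀ i, z + b i ≠ 0) (hκ' : 1 ≤ kappa a b z) (hwz : star w - z ≠ 0)
    (hsw : 1 ≤ sw ∧ sw ≤ kappa a b w + 1) (hsz : 1 ≤ sz ∧ sz ≤ kappa a b z + 1) (m n : ℕ) :
    (star (lam0 a b w) - lam0 a b z) * gramEntry a b w z βw βz sw sz x t m n +
        star (alpha a b w) * (if m = 0 then 0 else gramEntry a b w z βw βz sw sz x t (m - 1) n) -
        alpha a b z * (if n = 0 then 0 else gramEntry a b w z βw βz sw sz x t m (n - 1)) =
      star (entry (kappa a b w + 1) sw (fullSeries a b w βw x t) m) *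
          entry (kappa a b z + 1) sz (fullSeries a b z βz x t) n +
        ∑ i, (a i : ℂ) ^ 2 *
          (star (entry (kappa a b w + 1) sw (invSeries a b w i * fullSeries a b w βw x t) m) *
          entry (kappa a b z + 1) sz (invSeries a b z i * fullSeries a b z βz x t) n) := by
  have h1 := congrArg (coeff2 ((m + 1) * (kappa a b w + 1) - sw)
    ((n + 1) * (kappa a b z + 1) - sz))
    (lamSeries_mul_gramSeries (a := a) (βw := βw) (βz := βz) (x := x) (t := t) hb hκ hb' hκ' hwz)
  rw [sub_mul, coeff2_sub, coeff2_lamSeries_inner, coeff2_lamSeries_outer, coeff2_add,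
    coeff2_inner1_mul_outer2, coeff2_sum, coeff_bar] at h1
  simp only [coeff2_C_mul, coeff2_inner1_mul_outer2, coeff_bar] at h1
  have key : ∀ {k s : ℕ} (F : ℕ → ℂ), 1 ≤ s → s ≤ k → ∀ m, (if k ≤ (m + 1) * k - s then
      F ((m + 1) * k - s - k) else 0) = if m = 0 then 0 else F ((m - 1 + 1) * k - s) := by
    intro k s F h1 h2 m
    rcases m with _ | m
    · rw [if_pos rfl, if_neg]; omega
    · have h3 : k ≤ (m + 1) * k := Nat.le_mul_of_pos_left _ (Nat.succ_pos m)
      have h4 : (m + 1 + 1) * k = (m + 1) * k + k := by ring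
      rw [if_neg (Nat.succ_ne_zero m), if_pos (by omega), Nat.add_sub_cancel]
      congr 1; omega
  rw [key (fun m' => coeff2 m' ((n + 1) * (kappa a b z + 1) - sz)
      (gramSeries a b w z βw βz x t)) hsw.1 hsw.2,
    key (fun n' => coeff2 ((m + 1) * (kappa a b w + 1) - sw) n'
      (gramSeries a b w z βw βz x t)) hsz.1 hsz.2] at h1
  refine Eq.trans ?_ h1
  simp only [gramEntry]
  ring

/-- Each summand -aᵢ²/(z + bᵢ) has a nonnegative imaginary part. Hence λ^[0] is in the upper
half-plane, and the difference λ_k^[0]* - λ_j^[0] that heads the recursion does not vanish. -/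
lemma lam0_im_pos (hz : 0 < z.im) : 0 < (lam0 a b z).im := by
  rw [lam0, Complex.sub_im, Complex.im_sum, sub_pos]
  refine lt_of_le_of_lt (Finset.sum_nonpos fun i _ => ?_) hz
  rw [← Complex.ofReal_pow, div_eq_mul_inv, Complex.im_ofReal_mul, Complex.inv_im]
  have h1 : (z + b i).im = z.im := by simp
  rw [h1]
  exact mul_nonpos_of_nonneg_of_nonpos (sq_nonneg _)
    (div_nonpos_of_nonpos_of_nonneg (neg_nonpos.2 hz.le) (Complex.normSq_nonneg _))

lemma hasSum_entry_mul_entry {f g : PowerSeries ℂ} {F G ε η : ℂ}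
    (hf : HasSum (fun m => entry (kappa a b w + 1) sw f m * ε ^ (m * (kappa a b w + 1))) F)
    (hg : HasSum (fun n => entry (kappa a b z + 1) sz g n * η ^ (n * (kappa a b z + 1))) G) :
    HasSum (fun e : ℕ × ℕ => star (entry (kappa a b w + 1) sw f e.1) *
      entry (kappa a b z + 1) sz g e.2 * (star ε ^ (kappa a b w + 1)) ^ e.1 *
        (η ^ (kappa a b z + 1)) ^ e.2) (star F * G) := by
  refine hasSum_of_eq (hasSum_mul_prod hf.star hg) fun e => ?_
  rw [star_mul', star_pow, mul_comm e.1, mul_comm e.2, pow_mul, pow_mul]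
  ring

/-! ### Generating functions for a pair of roots -/

/-- A radius at which the entries for the pair of roots `w`, `z` are generated. -/
structure PairRadius (a b : Fin N → ℝ) (w z : ℂ) (βw βz : ℕ → ℂ) (r : ℝ) : Prop where
  left : GoodRadius a b w βw r
  right : GoodRadius a b z βz r
  small : ‖star (alpha a b w)‖ * r ^ (kappa a b w + 1) + ‖alpha a b z‖ * r ^ (kappa a b z + 1) ≤
    ‖star (lam0 a b w) - lam0 a b z‖ / 2

namespace PairRadius

variable (h : PairRadius a b w z βw βz r) (hw : 0 < w.im) (hz : 0 < z.im)
  (hκ : 1 ≤ kappa a b w) (hκ' : 1 ≤ kappa a b z)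
  (hsw : 1 ≤ sw ∧ sw ≤ kappa a b w + 1) (hsz : 1 ≤ sz ∧ sz ≤ kappa a b z + 1) {ε η : ℂ}

include h hw hz in
lemma lamHat_sub_ne_zero (hε : ‖ε‖ ≤ r) (hη : ‖η‖ ≤ r) :
    star (lamHat a b w ε) - lamHat a b z η ≠ 0 := by
  have h1 := sub_ne_zero_of_small (d := star (lam0 a b w) - lam0 a b z) (c₁ := star (alpha a b w))
    (c₂ := alpha a b z) (σ := star ε ^ (kappa a b w + 1)) (τ := η ^ (kappa a b z + 1))
    (star_sub_ne_zero (lam0_im_pos hw) (lam0_im_pos hz))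
    (by rw [norm_pow, norm_star]; exact pow_le_pow_left₀ (norm_nonneg _) hε _)
    (by rw [norm_pow]; exact pow_le_pow_left₀ (norm_nonneg _) hη _) h.small
  convert h1 using 1
  rw [lamHat, lamHat, star_add, star_mul', star_pow]
  ring

include h hw hz hκ hκ' hsw hsz in
-- The right-hand side of the recursion is a finite sum of products of coefficients of convergent
-- series. Its geometric bound passes to the entries, so the convergence of the two-variable kernel
-- never has to be studied directly.
lemma exists_norm_gramEntry_le (x t : ℝ) : ∃ C : ℝ, ∀ m n,
    ‖gramEntry a b w z βw βz sw sz x t m n‖ *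
      ((r ^ (kappa a b w + 1)) ^ m * (r ^ (kappa a b z + 1)) ^ n) ≤ C := by
  have hr := h.left.pos
  have key : ∀ {f g : PowerSeries ℂ}, AbsConv f r → AbsConv g r → ∃ C : ℝ, ∀ m n,
      ‖star (entry (kappa a b w + 1) sw f m) * entry (kappa a b z + 1) sz g n‖ *
        ((r ^ (kappa a b w + 1)) ^ m * (r ^ (kappa a b z + 1)) ^ n) ≤ C := by
    intro f g hf hg
    refine ⟨majorant f r / r ^ (kappa a b w + 1 - sw) * (majorant g r / r ^ (kappa a b z + 1 - sz)),
      fun m n => ?_⟩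
    rw [norm_mul, norm_star, mul_mul_mul_comm]
    exact mul_le_mul (hf.norm_entry_le hr hsw.2 m) (hg.norm_entry_le hr hsz.2 n) (by positivity)
      (div_nonneg (majorant_nonneg hr.le) (by positivity))
  obtain ⟨C₀, hC₀⟩ := key (h.left.fullSeries x t) (h.right.fullSeries x t)
  have h1 := fun i => key ((h.left.invSeries i).mul (h.left.fullSeries x t) hr.le)
    ((h.right.invSeries i).mul (h.right.fullSeries x t) hr.le)
  choose C hC using h1
  refine ⟨_, norm_le_of_lyapunov (star_sub_ne_zero (lam0_im_pos hw) (lam0_im_pos hz))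
    (gramEntry_lyapunov (add_ofReal_ne_zero hw <| b ·) hκ (add_ofReal_ne_zero hz <| b ·) hκ'
      (star_sub_ne_zero hw hz) hsw hsz)
    (by positivity) (by positivity) (C := C₀ + ∑ i, ‖(a i : ℂ) ^ 2‖ * C i) (fun m n => ?_) h.small⟩
  refine (mul_le_mul_of_nonneg_right ((norm_add_le _ _).trans
    (add_le_add_right (norm_sum_le _ _) _)) (by positivity)).trans ?_
  rw [add_mul, Finset.sum_mul]
  refine add_le_add (hC₀ m n) (Finset.sum_le_sum fun i _ => ?_)
  rw [norm_mul, mul_assoc]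
  exact mul_le_mul_of_nonneg_left (hC i m n) (norm_nonneg _)

include h hw hz hκ hκ' hsw hsz in
-- The right-hand side of the recursion sums to φ*φ + ∑ aᵢ² ψ*ψ, which is Ψ_k†Ψ_j since the plane
-- wave has the moduli aᵢ; the factor in front sums to λ̂_k* - λ̂_j.
lemma hasSum_gramEntry (hε0 : ε ≠ 0) (hε : ‖ε‖ < r) (hη0 : η ≠ 0) (hη : ‖η‖ < r) (x t : ℝ) :
    HasSum (fun e : ℕ × ℕ => gramEntry a b w z βw βz sw sz x t e.1 e.2 *
        (star ε ^ (kappa a b w + 1)) ^ e.1 * (η ^ (kappa a b z + 1)) ^ e.2)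
      ((star (Psi a b w βw sw ε x t) ⬝ᵥ Psi a b z βz sz η x t) /
        (star (lamHat a b w ε) - lamHat a b z η)) := by
  have hr := h.left.pos
  obtain ⟨C, hC⟩ := h.exists_norm_gramEntry_le hw hz hκ hκ' hsw hsz x t
  have hd : star (lamHat a b w ε) - lamHat a b z η = (star (lam0 a b w) - lam0 a b z) +
      star (alpha a b w) * star ε ^ (kappa a b w + 1) - alpha a b z * η ^ (kappa a b z + 1) := by
    rw [lamHat, lamHat, star_add, star_mul', star_pow]; ring
  have hne := h.lamHat_sub_ne_zero hw hz hε.le hη.le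
  rw [hd] at hne ⊢
  refine hasSum_of_lyapunov (gramEntry_lyapunov (add_ofReal_ne_zero hw <| b ·) hκ
    (add_ofReal_ne_zero hz <| b ·) hκ' (star_sub_ne_zero hw hz) hsw hsz)
    (summable_norm_of_le (pow_pos hr _) (pow_pos hr _) hC
      (by rw [norm_pow, norm_star]; exact pow_lt_pow_left₀ hε (norm_nonneg _) (Nat.succ_ne_zero _))
      (by rw [norm_pow]; exact pow_lt_pow_left₀ hη (norm_nonneg _) (Nat.succ_ne_zero _))) hne ?_
  have h1 := hasSum_entry_mul_entry (h.left.hasSum_psiRed_inl hsw hε0 hε.le x t)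
    (h.right.hasSum_psiRed_inl hsz hη0 hη.le x t)
  have h2 := fun i => hasSum_entry_mul_entry
    (h.left.hasSum_psiRed_inr hsw hε0 hε.le x t i) (h.right.hasSum_psiRed_inr hsz hη0 hη.le x t i)
  have h3 := h1.add (hasSum_sum (s := Finset.univ) fun i _ => (h2 i).mul_left ((a i : ℂ) ^ 2))
  convert h3 using 1
  · funext e
    rw [add_mul, add_mul, Finset.sum_mul, Finset.sum_mul]
    simp only [mul_assoc]
  · rw [dotProduct, Fintype.sum_sum_type]
    congr 1
    · simp [Psi]
    · refine Finset.sum_congr rfl fun i _ => ?_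
      rw [← star_planeWave_mul_planeWave x t i]
      simp only [Psi, Pi.star_apply, Sum.elim_inr, star_mul']
      ring

end PairRadius

end

end VNLS

end

noncomputable section
namespace VNLS
open Finset.HasAntidiagonal (antidiagonal mem_antidiagonal)
open PowerSeries (coeff)

variable {N p : ℕ} {a b : Fin N → ℝ} {w z : ℂ} {β βw βz : ℕ → ℂ} {r : ℝ}

/-! ### Common radii and the normalised expansions -/

section

variable {sw sz : ℕ} {x t : ℝ} {ε η : ℂ}

lemma eventually_pairRadius (hw : 0 < w.im) (hz : 0 < z.im)
    (hκ : 1 ≤ kappa a b w) (hκ' : 1 ≤ kappa a b z)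
    (hβw : ∃ ρ > 0, AbsConv (PowerSeries.mk βw) ρ) (hβz : ∃ ρ > 0, AbsConv (PowerSeries.mk βz) ρ) :
    ∀ᶠ r in 𝓝[>] (0 : ℝ), PairRadius a b w z βw βz r := by
  have hd : 0 < ‖star (lam0 a b w) - lam0 a b z‖ / 2 := half_pos (norm_pos_iff.2
    (star_sub_ne_zero (lam0_im_pos hw) (lam0_im_pos hz)))
  have hc : Continuous fun r : ℝ => ‖star (alpha a b w)‖ * r ^ (kappa a b w + 1) +
      ‖alpha a b z‖ * r ^ (kappa a b z + 1) := by fun_prop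
  have h1 := ((hc.tendsto' 0 0 (by simp)).mono_left
    (nhdsWithin_le_nhds (s := Set.Ioi 0))).eventually_le_const hd
  filter_upwards [h1, eventually_goodRadius (add_ofReal_ne_zero hw <| b ·) hκ hβw,
    eventually_goodRadius (add_ofReal_ne_zero hz <| b ·) hκ' hβz] with r h1 h2 h3
  exact ⟨h2, h3, h1⟩

lemma exp_neg_mul_gramEntry (m n : ℕ) :
    exp (-(star (Xcoeff a b w βw x t 0) + Xcoeff a b z βz x t 0)) *
      gramEntry a b w z βw βz sw sz x t m n =
    Hcoeff a b w z βw βz x t ((m + 1) * (kappa a b w + 1) - sw)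
      ((n + 1) * (kappa a b z + 1) - sz) := by
  rw [gramEntry, coeff2_gramSeries, ← mul_assoc, Complex.star_def,
    ← Complex.exp_conj, ← exp_add, ← exp_add, neg_add_cancel, exp_zero, one_mul]

lemma exp_neg_mul_gramEntry_add {i : Fin N} (hb : z + b i ≠ 0) (hwz : star w - z ≠ 0) (m n : ℕ) :
    exp (-(star (Xcoeff a b w βw x t 0) + Xcoeff a b z βz x t 0)) *
      (gramEntry a b w z βw βz sw sz x t m n +
        star (entry (kappa a b w + 1) sw (fullSeries a b w βw x t) m) *
          entry (kappa a b z + 1) sz (invSeries a b z i * fullSeries a b z βz x t) n) =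
    HcoeffI a b w z βw βz i x t ((m + 1) * (kappa a b w + 1) - sw)
      ((n + 1) * (kappa a b z + 1) - sz) := by
  rw [gramEntry, entry, entry, ← coeff2_gramSeriesI i hb hwz, ← mul_assoc, Complex.star_def,
    ← Complex.exp_conj, ← exp_add, ← exp_add, neg_add_cancel, exp_zero, one_mul]

namespace PairRadius

variable (h : PairRadius a b w z βw βz r) (hw : 0 < w.im) (hz : 0 < z.im)
  (hκ : 1 ≤ kappa a b w) (hκ' : 1 ≤ kappa a b z)
  (hsw : 1 ≤ sw ∧ sw ≤ kappa a b w + 1) (hsz : 1 ≤ sz ∧ sz ≤ kappa a b z + 1)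
  (hε0 : ε ≠ 0) (hε : ‖ε‖ < r) (hη0 : η ≠ 0) (hη : ‖η‖ < r)

include h hw hz hκ hκ' hsw hsz hε0 hε hη0 hη

lemma hasSum_Hcoeff (x t : ℝ) :
    HasSum (fun e : ℕ × ℕ => Hcoeff a b w z βw βz x t ((e.1 + 1) * (kappa a b w + 1) - sw)
        ((e.2 + 1) * (kappa a b z + 1) - sz) *
        star ε ^ (e.1 * (kappa a b w + 1)) * η ^ (e.2 * (kappa a b z + 1)))
      (exp (-(star (Xcoeff a b w βw x t 0) + Xcoeff a b z βz x t 0)) *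
        ((star (Psi a b w βw sw ε x t) ⬝ᵥ Psi a b z βz sz η x t) /
          (star (lamHat a b w ε) - lamHat a b z η))) := by
  refine hasSum_of_eq ((h.hasSum_gramEntry hw hz hκ hκ' hsw hsz hε0 hε hη0 hη x t).mul_left _)
    fun e => ?_
  rw [← exp_neg_mul_gramEntry, mul_comm e.1, mul_comm e.2, pow_mul, pow_mul]
  ring

lemma hasSum_HcoeffI (x t : ℝ) (i : Fin N) :
    HasSum (fun e : ℕ × ℕ => HcoeffI a b w z βw βz i x t ((e.1 + 1) * (kappa a b w + 1) - sw)
        ((e.2 + 1) * (kappa a b z + 1) - sz) *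
        star ε ^ (e.1 * (kappa a b w + 1)) * η ^ (e.2 * (kappa a b z + 1)))
      (exp (-(star (Xcoeff a b w βw x t 0) + Xcoeff a b z βz x t 0)) *
        ((star (Psi a b w βw sw ε x t) ⬝ᵥ Psi a b z βz sz η x t) /
          (star (lamHat a b w ε) - lamHat a b z η) +
        star (psiRed a b w βw sw ε x t (Sum.inl ())) * psiRed a b z βz sz η x t (Sum.inr i))) := by
  have h1 := hasSum_entry_mul_entry (h.left.hasSum_psiRed_inl hsw hε0 hε.le x t)
    (h.right.hasSum_psiRed_inr hsz hη0 hη.le x t i)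
  refine hasSum_of_eq (((h.hasSum_gramEntry hw hz hκ hκ' hsw hsz hε0 hε hη0 hη x t).add h1).mul_left
    _) fun e => ?_
  rw [← exp_neg_mul_gramEntry_add (add_ofReal_ne_zero hz (b i)) (star_sub_ne_zero hw hz),
    mul_comm e.1, mul_comm e.2, pow_mul, pow_mul]
  ring

end PairRadius

end

/-! ### Divided differences -/

/-- The divided difference of `X ^ n` at the nodes `τ 0, …, τ l`. -/
def divDiff (τ : ℕ → ℂ) : ℕ → ℕ → ℂ
  | 0, l => if l = 0 then 1 else 0
  | n + 1, l => τ l * divDiff τ n l + if l = 0 then 0 else divDiff τ n (l - 1)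

/-- The Newton basis polynomial `∏_{i<l} (X - τ i)`. -/
def newton (τ : ℕ → ℂ) (l : ℕ) (X : ℂ) : ℂ := ∏ i ∈ Finset.range l, (X - τ i)

lemma newton_eq_zero {τ : ℕ → ℂ} {l r : ℕ} (h : r < l) : newton τ l (τ r) = 0 :=
  Finset.prod_eq_zero (Finset.mem_range.2 h) (sub_self _)

/-- This is Newton interpolation, exact at the nodes. The recursion of `divDiff` comes from X N_l =
N_(l+1) + τ_l N_l, and the overflow N_K vanishes at the nodes with index below K. -/
lemma sum_divDiff_mul_newton (τ : ℕ → ℂ) {K r : ℕ} (h : r < K) (n : ℕ) :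
    ∑ l ∈ Finset.range K, divDiff τ n l * newton τ l (τ r) = τ r ^ n := by
  induction n with
  | zero =>
    rw [Finset.sum_eq_single 0]
    · simp [divDiff, newton]
    · intro l _ hl; simp [divDiff, hl]
    · intro h0; exact absurd (Finset.mem_range.2 (by omega)) h0
  | succ n ih =>
    have h1 : ∑ l ∈ Finset.range K, divDiff τ n l * newton τ (l + 1) (τ r) =
        ∑ l ∈ Finset.range K, (if l = 0 then 0 else divDiff τ n (l - 1)) * newton τ l (τ r) := by
      obtain ⟨K, rfl⟩ : ∃ K', K = K' + 1 := ⟨K - 1, by omega⟩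
      rw [Finset.sum_range_succ, newton_eq_zero h, mul_zero, add_zero, Finset.sum_range_succ']
      simp
    have h2 : ∀ l, newton τ (l + 1) (τ r) = τ r * newton τ l (τ r) - τ l * newton τ l (τ r) := by
      intro l; rw [newton, Finset.prod_range_succ, ← newton]; ring
    have h3 : ∑ l ∈ Finset.range K, divDiff τ (n + 1) l * newton τ l (τ r) =
        ∑ l ∈ Finset.range K, τ l * divDiff τ n l * newton τ l (τ r) +
          ∑ l ∈ Finset.range K, divDiff τ n l * newton τ (l + 1) (τ r) := by
      rw [h1, ← Finset.sum_add_distrib]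
      exact Finset.sum_congr rfl fun l _ => by rw [divDiff, add_mul]
    rw [h3, ← Finset.sum_add_distrib, pow_succ, ← ih, Finset.sum_mul]
    exact Finset.sum_congr rfl fun l _ => by rw [h2]; ring

/-- Weighted by η^l, each of the two terms of the recursion is at most η (2η)^n, which accounts for
the factor 2 in every step. -/
lemma norm_divDiff_le {τ : ℕ → ℂ} {η : ℝ} (hη : 0 < η) (h : ∀ l, ‖τ l‖ ≤ η) (n l : ℕ) :
    ‖divDiff τ n l‖ ≤ (2 * η) ^ n / η ^ l := by
  rw [le_div_iff₀ (pow_pos hη _)]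
  induction n generalizing l with
  | zero =>
    rcases l with _ | l <;> simp [divDiff]
  | succ n ih =>
    have h1 : ‖if l = 0 then 0 else divDiff τ n (l - 1)‖ * η ^ l ≤ η * (2 * η) ^ n := by
      rcases l with _ | l
      · simp; positivity
      · have := mul_le_mul_of_nonneg_left (ih l) hη.le
        simp only [Nat.add_sub_cancel, if_neg (Nat.succ_ne_zero l), pow_succ]
        linarith
    have h2 : ‖τ l * divDiff τ n l‖ * η ^ l ≤ η * (2 * η) ^ n := by
      rw [norm_mul, mul_assoc]
      exact mul_le_mul (h l) (ih l) (by positivity) hη.le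
    calc ‖divDiff τ (n + 1) l‖ * η ^ l ≤ (‖τ l * divDiff τ n l‖ +
          ‖if l = 0 then 0 else divDiff τ n (l - 1)‖) * η ^ l := by
          rw [divDiff]; gcongr; exact norm_add_le _ _
      _ ≤ (2 * η) ^ (n + 1) := by rw [pow_succ]; linarith

lemma tendsto_divDiff {T : Type*} {F : Filter T} {τ : T → ℕ → ℂ}
    (h : ∀ l, Tendsto (fun y => τ y l) F (𝓝 0)) (n l : ℕ) :
    Tendsto (fun y => divDiff (τ y) n l) F (𝓝 (if n = l then 1 else 0)) := by
  induction n generalizing l with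
  | zero => simpa only [divDiff, eq_comm (a := l)] using tendsto_const_nhds
  | succ n ih =>
    have h1 : Tendsto (fun y => if l = 0 then 0 else divDiff (τ y) n (l - 1)) F
        (𝓝 (if n + 1 = l then 1 else 0)) := by
      rcases l with _ | l
      · simpa using tendsto_const_nhds
      · simpa using ih l
    simpa only [divDiff, zero_mul, zero_add] using ((h l).mul (ih l)).add h1

lemma det_newton_ne_zero {K : ℕ} {τ : ℕ → ℂ} (h : ∀ i j, i < j → j < K → τ i ≠ τ j) :
    (Matrix.of fun l r : Fin K => newton τ l (τ r)).det ≠ 0 := by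
  have h1 : (Matrix.of fun l r : Fin K => newton τ l (τ r)).IsUpperTriangular :=
    fun i j hij => newton_eq_zero hij
  rw [Matrix.det_of_isUpperTriangular h1]
  refine Finset.prod_ne_zero_iff.2 fun l _ => ?_
  rw [Matrix.of_apply, newton]
  refine Finset.prod_ne_zero_iff.2 fun i hi => ?_
  exact sub_ne_zero.2 (h i l (Finset.mem_range.1 hi) l.2).symm

end VNLS

end

noncomputable section
namespace VNLS
open Finset.HasAntidiagonal (antidiagonal mem_antidiagonal)
open PowerSeries (coeff)

variable {N p : ℕ} {K : Fin p → ℕ}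

/-! ### Confluence of the spectral parameters -/

/-- The values of the Newton basis polynomials at the nodes. -/
def newtonMatrix (K : Fin p → ℕ) (T : Fin p → ℕ → ℂ) :
    Matrix (Σ j : Fin p, Fin (K j)) (Σ j : Fin p, Fin (K j)) ℂ :=
  Matrix.blockDiagonal' fun j => Matrix.of fun l r : Fin (K j) => newton (T j) l (T j r)

/-- The vector whose combinations with the Newton basis are the values of the series `∑ f_n τ^n`
at the nodes. -/
def reducedVec (K : Fin p → ℕ) (f : Fin p → ℕ → ℂ) (T : Fin p → ℕ → ℂ)
    (u : Σ j : Fin p, Fin (K j)) : ℂ :=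
  ∑' n, f u.1 n * divDiff (T u.1) n u.2

/-- The matrix whose combinations with the Newton basis are the values of the double series
`∑ g_{mn} σ*^m τ^n` at the nodes. -/
def reducedMat (K : Fin p → ℕ) (g : Fin p → Fin p → ℕ → ℕ → ℂ) (T : Fin p → ℕ → ℂ) :
    Matrix (Σ j : Fin p, Fin (K j)) (Σ j : Fin p, Fin (K j)) ℂ := Matrix.of fun u v =>
  ∑' e : ℕ × ℕ, g u.1 v.1 e.1 e.2 * (star (divDiff (T u.1) e.1 u.2) * divDiff (T v.1) e.2 v.2)

lemma sum_mul_newtonMatrix (T : Fin p → ℕ → ℂ) (F : (Σ j : Fin p, Fin (K j)) → ℂ)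
    (v : Σ j : Fin p, Fin (K j)) : ∑ u, F u * newtonMatrix K T u v =
      ∑ l : Fin (K v.1), F ⟨v.1, l⟩ * newton (T v.1) l (T v.1 v.2) := by
  rw [Fintype.sum_sigma, Finset.sum_eq_single v.1]
  · refine Finset.sum_congr rfl fun l _ => ?_
    rw [newtonMatrix]
    congr 1
    exact Matrix.blockDiagonal'_apply_eq
      (fun j => Matrix.of fun l r : Fin (K j) => newton (T j) l (T j r)) v.1 l v.2
  · intro j _ hj
    refine Finset.sum_eq_zero fun l _ => ?_
    rw [newtonMatrix]
    exact mul_eq_zero_of_right _ (Matrix.blockDiagonal'_apply_ne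
      (fun j => Matrix.of fun l r : Fin (K j) => newton (T j) l (T j r)) l v.2 hj)
  · simp

lemma det_newtonMatrix_ne_zero {T : Fin p → ℕ → ℂ}
    (h : ∀ j i l, i < l → l < K j → T j i ≠ T j l) : (newtonMatrix K T).det ≠ 0 := by
  intro h0
  obtain ⟨c, hc, h1⟩ := Matrix.exists_vecMul_eq_zero_iff.2 h0
  refine hc (funext fun u => ?_)
  have h2 : (fun l => c ⟨u.1, l⟩) = 0 := by
    refine Matrix.eq_zero_of_vecMul_eq_zero (det_newton_ne_zero (h u.1)) (funext fun r => ?_)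
    exact (sum_mul_newtonMatrix T c ⟨u.1, r⟩).symm.trans (congrFun h1 ⟨u.1, r⟩)
  exact congrFun h2 u.2

/-! ### Dominated convergence of divided differences -/

section bounds

variable {f : ℕ → ℂ} {g : ℕ → ℕ → ℂ} {σ τ : ℕ → ℂ} {ρ ρ' C : ℝ}

/-- Nodes of size at most ρ/4 make the growth rate of divided differences ρ/2, which leaves the
summable factor 2^(-n) against coefficients bounded by C ρ^(-n). -/
lemma norm_divDiff_mul_pow_le (hρ : 0 < ρ) (hτ : ∀ l, ‖τ l‖ ≤ ρ / 4) (n l : ℕ) :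
    ‖divDiff τ n l‖ ≤ ρ ^ n * ((1 / 2) ^ n / (ρ / 4) ^ l) := by
  refine (norm_divDiff_le (by positivity) hτ n l).trans_eq ?_
  rw [show 2 * (ρ / 4) = ρ * (1 / 2) by ring, mul_pow, mul_div_assoc]

lemma norm_mul_divDiff_le (hρ : 0 < ρ) (hf : ∀ n, ‖f n‖ * ρ ^ n ≤ C) (hτ : ∀ l, ‖τ l‖ ≤ ρ / 4)
    (n l : ℕ) : ‖f n * divDiff τ n l‖ ≤ C * ((1 / 2) ^ n / (ρ / 4) ^ l) := by
  rw [norm_mul]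
  calc _ ≤ ‖f n‖ * (ρ ^ n * ((1 / 2) ^ n / (ρ / 4) ^ l)) :=
        mul_le_mul_of_nonneg_left (norm_divDiff_mul_pow_le hρ hτ n l) (norm_nonneg _)
    _ = ‖f n‖ * ρ ^ n * ((1 / 2) ^ n / (ρ / 4) ^ l) := by ring
    _ ≤ _ := mul_le_mul_of_nonneg_right (hf n) (by positivity)

lemma norm_mul_star_divDiff_mul_divDiff_le (hρ : 0 < ρ) (hρ' : 0 < ρ')
    (hg : ∀ m n, ‖g m n‖ * (ρ ^ m * ρ' ^ n) ≤ C) (hσ : ∀ l, ‖σ l‖ ≤ ρ / 4)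
    (hτ : ∀ l, ‖τ l‖ ≤ ρ' / 4) (m n k l : ℕ) :
    ‖g m n * (star (divDiff σ m k) * divDiff τ n l)‖ ≤
      C * (((1 / 2) ^ m / (ρ / 4) ^ k) * ((1 / 2) ^ n / (ρ' / 4) ^ l)) := by
  rw [norm_mul, norm_mul, norm_star]
  calc _ ≤ ‖g m n‖ * ((ρ ^ m * ((1 / 2) ^ m / (ρ / 4) ^ k)) *
        (ρ' ^ n * ((1 / 2) ^ n / (ρ' / 4) ^ l))) :=
        mul_le_mul_of_nonneg_left (mul_le_mul (norm_divDiff_mul_pow_le hρ hσ m k)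
          (norm_divDiff_mul_pow_le hρ' hτ n l) (norm_nonneg _) (by positivity)) (norm_nonneg _)
    _ = ‖g m n‖ * (ρ ^ m * ρ' ^ n) *
        (((1 / 2) ^ m / (ρ / 4) ^ k) * ((1 / 2) ^ n / (ρ' / 4) ^ l)) := by ring
    _ ≤ _ := mul_le_mul_of_nonneg_right (hg m n) (by positivity)

lemma summable_bound (C : ℝ) (l : ℕ) : Summable fun n : ℕ => C * ((1 / 2) ^ n / (ρ / 4) ^ l) :=
  (summable_geometric_two.div_const _).mul_left _

lemma summable_bound_prod (C : ℝ) (hρ : 0 < ρ) (hρ' : 0 < ρ') (k l : ℕ) :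
    Summable fun e : ℕ × ℕ =>
      C * (((1 / 2) ^ e.1 / (ρ / 4) ^ k) * ((1 / 2) ^ e.2 / (ρ' / 4) ^ l)) :=
  ((summable_geometric_two.div_const _).mul_of_nonneg (summable_geometric_two.div_const _)
    (fun _ => by simp only [Pi.zero_apply]; positivity)
    (fun _ => by simp only [Pi.zero_apply]; positivity)).mul_left _

/-- As the nodes merge at 0, the divided difference of each monomial tends to its l-th coefficient,
and the majorant is uniform in the nodes. -/
lemma tendsto_tsum_divDiff {S : Type*} {F : Filter S} {τ : S → ℕ → ℂ} (hρ : 0 < ρ)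
    (hf : ∀ n, ‖f n‖ * ρ ^ n ≤ C) (hτ : ∀ᶠ y in F, ∀ l, ‖τ y l‖ ≤ ρ / 4)
    (hτ0 : ∀ l, Tendsto (fun y => τ y l) F (𝓝 0)) (l : ℕ) :
    Tendsto (fun y => ∑' n, f n * divDiff (τ y) n l) F (𝓝 (f l)) := by
  have h1 : ∑' n, f n * (if n = l then 1 else 0) = f l := by
    rw [tsum_eq_single l fun n hn => by rw [if_neg hn, mul_zero], if_pos rfl, mul_one]
  rw [← h1]
  exact tendsto_tsum_of_dominated_convergence (summable_bound (ρ := ρ) C l)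
    (fun n => (tendsto_divDiff hτ0 n l).const_mul _)
    (hτ.mono fun y hy n => norm_mul_divDiff_le hρ hf hy n l)

lemma tendsto_tsum_star_divDiff_mul_divDiff {S : Type*} {F : Filter S} {σ τ : S → ℕ → ℂ}
    (hρ : 0 < ρ) (hρ' : 0 < ρ') (hg : ∀ m n, ‖g m n‖ * (ρ ^ m * ρ' ^ n) ≤ C)
    (hσ : ∀ᶠ y in F, ∀ l, ‖σ y l‖ ≤ ρ / 4) (hτ : ∀ᶠ y in F, ∀ l, ‖τ y l‖ ≤ ρ' / 4)
    (hσ0 : ∀ l, Tendsto (fun y => σ y l) F (𝓝 0))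
    (hτ0 : ∀ l, Tendsto (fun y => τ y l) F (𝓝 0)) (k l : ℕ) :
    Tendsto (fun y => ∑' e : ℕ × ℕ, g e.1 e.2 *
      (star (divDiff (σ y) e.1 k) * divDiff (τ y) e.2 l)) F (𝓝 (g k l)) := by
  have h1 : ∑' e : ℕ × ℕ, g e.1 e.2 * (star (if e.1 = k then 1 else 0) *
      (if e.2 = l then 1 else 0)) = g k l := by
    rw [tsum_eq_single (k, l)]
    · simp
    · rintro ⟨m, n⟩ hmn
      by_cases h2 : m = k
      · have h3 : n ≠ l := fun h3 => hmn (by rw [h2, h3])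
        simp [h3]
      · simp [h2]
  rw [← h1]
  exact tendsto_tsum_of_dominated_convergence (summable_bound_prod C hρ hρ' k l)
    (fun e => ((tendsto_divDiff hσ0 e.1 k).star.mul (tendsto_divDiff hτ0 e.2 l)).const_mul _)
    (by filter_upwards [hσ, hτ] with y h2 h3 e
        exact norm_mul_star_divDiff_mul_divDiff_le hρ hρ' hg h2 h3 e.1 e.2 k l)

end bounds

/-! ### Newton interpolation of the dressing data -/

section reduction

variable {T : Fin p → ℕ → ℂ} {ρ : Fin p → ℝ}

lemma reducedVec_vecMul {f : Fin p → ℕ → ℂ} (hρ : ∀ j, 0 < ρ j)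
    (hf : ∀ j, ∃ C, ∀ n, ‖f j n‖ * ρ j ^ n ≤ C) (hT : ∀ j l, ‖T j l‖ ≤ ρ j / 4)
    {y : (Σ j : Fin p, Fin (K j)) → ℂ}
    (hy : ∀ v : Σ j : Fin p, Fin (K j), HasSum (fun n => f v.1 n * T v.1 v.2 ^ n) (y v)) :
    reducedVec K f T ᵥ* newtonMatrix K T = y := by
  ext v
  rw [Matrix.vecMul, dotProduct, sum_mul_newtonMatrix]
  obtain ⟨C, hC⟩ := hf v.1
  have h1 : ∀ l : Fin (K v.1), Summable fun n => f v.1 n * divDiff (T v.1) n l := fun l =>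
    Summable.of_norm_bounded (summable_bound (ρ := ρ v.1) C l) fun n =>
      norm_mul_divDiff_le (hρ _) hC (hT _) n l
  have h2 := hasSum_sum (s := Finset.univ) fun (l : Fin (K v.1)) _ =>
    (h1 l).hasSum.mul_right (newton (T v.1) l (T v.1 v.2))
  refine h2.unique (hasSum_of_eq (hy v) fun n => ?_)
  rw [← sum_divDiff_mul_newton (T v.1) v.2.2 n, Finset.sum_range, Finset.mul_sum]
  exact Finset.sum_congr rfl fun l _ => (mul_assoc _ _ _).symm

/-- Newton interpolation is applied termwise in both variables. The factor that degenerates when the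
nodes merge is thereby split off as a congruence, and the middle matrix keeps a finite limit. -/
lemma conjTranspose_mul_reducedMat_mul {g : Fin p → Fin p → ℕ → ℕ → ℂ} (hρ : ∀ j, 0 < ρ j)
    (hg : ∀ k j, ∃ C, ∀ m n, ‖g k j m n‖ * (ρ k ^ m * ρ j ^ n) ≤ C)
    (hT : ∀ j l, ‖T j l‖ ≤ ρ j / 4)
    {M : Matrix (Σ j : Fin p, Fin (K j)) (Σ j : Fin p, Fin (K j)) ℂ}
    (hM : ∀ u v : Σ j : Fin p, Fin (K j), HasSum (fun e : ℕ × ℕ => g u.1 v.1 e.1 e.2 *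
      star (T u.1 u.2) ^ e.1 * T v.1 v.2 ^ e.2) (M u v)) :
    (newtonMatrix K T)ᴴ * reducedMat K g T * newtonMatrix K T = M := by
  ext u v
  obtain ⟨C, hC⟩ := hg u.1 v.1
  have h0 : ((newtonMatrix K T)ᴴ * reducedMat K g T * newtonMatrix K T) u v =
      ∑ l : Fin (K v.1), ∑ k : Fin (K u.1), reducedMat K g T ⟨u.1, k⟩ ⟨v.1, l⟩ *
        (star (newton (T u.1) k (T u.1 u.2)) * newton (T v.1) l (T v.1 v.2)) := by
    rw [Matrix.mul_apply, sum_mul_newtonMatrix]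
    refine Finset.sum_congr rfl fun l _ => ?_
    have h3 := congrArg star (sum_mul_newtonMatrix T
      (fun w => star (reducedMat K g T w ⟨v.1, l⟩)) u)
    simp only [star_sum, star_mul', star_star] at h3
    rw [Matrix.mul_apply]
    simp only [Matrix.conjTranspose_apply, mul_comm (star _)]
    rw [h3, Finset.sum_mul]
    exact Finset.sum_congr rfl fun k _ => by ring
  rw [h0]
  have h1 : ∀ (k : Fin (K u.1)) (l : Fin (K v.1)), HasSum (fun e : ℕ × ℕ => g u.1 v.1 e.1 e.2 *
      (star (divDiff (T u.1) e.1 k) * divDiff (T v.1) e.2 l))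
      (reducedMat K g T ⟨u.1, k⟩ ⟨v.1, l⟩) := fun k l =>
    (Summable.of_norm_bounded (summable_bound_prod C (hρ u.1) (hρ v.1) k l) fun e =>
      norm_mul_star_divDiff_mul_divDiff_le (hρ _) (hρ _) hC (hT _) (hT _) e.1 e.2 k l).hasSum
  have h2 := hasSum_sum (s := Finset.univ) fun (l : Fin (K v.1)) _ =>
    hasSum_sum (s := Finset.univ) fun (k : Fin (K u.1)) _ => (h1 k l).mul_right
      (star (newton (T u.1) k (T u.1 u.2)) * newton (T v.1) l (T v.1 v.2))
  refine h2.unique (hasSum_of_eq (hM u v) fun e => ?_)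
  rw [← star_pow, ← sum_divDiff_mul_newton (T u.1) u.2.2 e.1,
    ← sum_divDiff_mul_newton (T v.1) v.2.2 e.2, Finset.sum_range, Finset.sum_range, star_sum,
    Finset.mul_sum]
  refine Finset.sum_congr rfl fun l _ => ?_
  rw [Finset.mul_sum, Finset.sum_mul]
  refine Finset.sum_congr rfl fun k _ => ?_
  rw [star_mul']
  ring

end reduction

/-- The dressing term is unchanged by an invertible change of basis in the family of Lax solutions,
so the degenerating Newton factors drop out before the limit is taken. -/
lemma bracket_congruence {ι : Type*} [Fintype ι] [DecidableEq ι] {V : Matrix ι ι ℂ}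
    (hV : V.det ≠ 0) (G : Matrix ι ι ℂ) (u v : ι → ℂ) :
    bracket (Vᴴ * G * V)⁻¹ (u ᵥ* V) (star (v ᵥ* V)) = bracket G⁻¹ u (star v) := by
  have h1 : IsUnit V.det := isUnit_iff_ne_zero.2 hV
  have h2 : IsUnit Vᴴ.det := by
    rw [Matrix.det_conjTranspose]; exact h1.star
  rw [bracket, bracket, Matrix.star_vecMul, Matrix.mul_inv_rev, Matrix.mul_inv_rev,
    Matrix.mulVec_mulVec, ← Matrix.dotProduct_mulVec, Matrix.mulVec_mulVec]
  congr 2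
  rw [mul_assoc, mul_assoc, Matrix.nonsing_inv_mul _ h2, mul_one, ← mul_assoc,
    Matrix.mul_nonsing_inv _ h1, one_mul]

section

variable {ι S : Type*} [Fintype ι] [DecidableEq ι] {F : Filter S} {M : S → Matrix ι ι ℂ}
  {G : Matrix ι ι ℂ} {u v : S → ι → ℂ} {u₀ v₀ : ι → ℂ}

lemma tendsto_matrix_inv (hG : G.det ≠ 0) (hM : Tendsto M F (𝓝 G)) :
    Tendsto (fun y => (M y)⁻¹) F (𝓝 G⁻¹) := by
  have h1 : ContinuousAt (fun M : Matrix ι ι ℂ => M.det) G :=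
    continuous_id.matrix_det.continuousAt
  have h2 : ContinuousAt (fun M : Matrix ι ι ℂ => M.adjugate) G :=
    continuous_id.matrix_adjugate.continuousAt
  have h3 := h1.inv₀ hG
  have h4 : Tendsto (fun M : Matrix ι ι ℂ => (M.det)⁻¹ • M.adjugate) (𝓝 G)
    (𝓝 ((G.det)⁻¹ • G.adjugate)) := h3.smul h2
  have h5 := h4.comp hM
  simp only [Matrix.inv_def, Ring.inverse_eq_inv']
  exact h5

omit [DecidableEq ι] in
lemma tendsto_bracket (hM : Tendsto M F (𝓝 G)) (hu : Tendsto u F (𝓝 u₀))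
    (hv : Tendsto v F (𝓝 v₀)) :
    Tendsto (fun y => bracket (M y) (u y) (star (v y))) F (𝓝 (bracket G u₀ (star v₀))) := by
  have h1 : Continuous fun q : Matrix ι ι ℂ × (ι → ℂ) × (ι → ℂ) =>
      q.2.1 ⬝ᵥ q.1 *ᵥ star q.2.2 :=
    Continuous.dotProduct (by fun_prop) (Continuous.matrix_mulVec (by fun_prop) (by fun_prop))
  have h2 : Tendsto (fun y => (M y, u y, v y)) F (𝓝 (G, u₀, v₀)) :=
    hM.prodMk_nhds (hu.prodMk_nhds hv)
  have h3 := (h1.tendsto (G, u₀, v₀)).comp h2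
  exact h3

end

end VNLS

end

noncomputable section
namespace VNLS
open Finset.HasAntidiagonal (antidiagonal mem_antidiagonal)
open PowerSeries (coeff)

variable {N p : ℕ} {a b : Fin N → ℝ} {χ : Fin p → ℂ} {β : Fin p → ℕ → ℂ} {s K : Fin p → ℕ}

/-! ### The limit of the dressed plane waves -/

/-- The nodes `ε_{j,r}^(κ_j+1)`, extended by zero. -/
def node (a b : Fin N → ℝ) (χ : Fin p → ℂ) (K : Fin p → ℕ) (ε : (Σ j : Fin p, Fin (K j)) → ℂ)
    (j : Fin p) (l : ℕ) : ℂ :=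
  if hl : l < K j then ε ⟨j, l, hl⟩ ^ (kappa a b (χ j) + 1) else 0

lemma node_coe (ε : (Σ j : Fin p, Fin (K j)) → ℂ) (u : Σ j : Fin p, Fin (K j)) :
    node a b χ K ε u.1 u.2 = ε u ^ (kappa a b (χ u.1) + 1) := dif_pos u.2.2

lemma tendsto_node (j : Fin p) (l : ℕ) :
    Tendsto (fun ε => node a b χ K ε j l) (𝓝[admissible a b χ K] 0) (𝓝 0) := by
  unfold node
  split_ifs with hl
  · have h1 : Continuous fun ε : (Σ j : Fin p, Fin (K j)) → ℂ =>
        ε ⟨j, l, hl⟩ ^ (kappa a b (χ j) + 1) := by fun_prop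
    exact (h1.tendsto' 0 0 (by simp)).mono_left nhdsWithin_le_nhds
  · exact tendsto_const_nhds

lemma eventually_norm_node_le {ρ : Fin p → ℝ} (hρ : ∀ j, 0 < ρ j) :
    ∀ᶠ ε in 𝓝[admissible a b χ K] 0, ∀ j l, ‖node a b χ K ε j l‖ ≤ ρ j := by
  have h1 : ∀ᶠ ε in 𝓝[admissible a b χ K] 0, ∀ u : Σ j : Fin p, Fin (K j),
      ‖node a b χ K ε u.1 u.2‖ ≤ ρ u.1 := eventually_all.2 fun u => by
    have h2 := (tendsto_node (a := a) (b := b) (χ := χ) (K := K) u.1 u.2).norm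
    rw [norm_zero] at h2
    exact h2.eventually_le_const (hρ u.1)
  filter_upwards [h1] with ε h1 j l
  by_cases hl : l < K j
  · exact h1 ⟨j, l, hl⟩
  · rw [node, dif_neg hl, norm_zero]; exact (hρ j).le

lemma det_newtonMatrix_node_ne_zero {ε : (Σ j : Fin p, Fin (K j)) → ℂ}
    (hε : ε ∈ admissible a b χ K) : (newtonMatrix K (node a b χ K ε)).det ≠ 0 := by
  refine det_newtonMatrix_ne_zero fun j i l hil hl => ?_
  rw [node, node, dif_pos hl, dif_pos (hil.trans hl)]
  exact hε.2 j _ _ fun h => hil.ne (congrArg Fin.val h)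

lemma dress_eq {ι : Type*} [Fintype ι] [DecidableEq ι] (q : Fin N → ℂ) (lam : ι → ℂ)
    (y : ι → Unit ⊕ Fin N → ℂ) (i : Fin N) : dress q lam y i = q i +
      bracket (dressM lam y)⁻¹ (fun v => y v (Sum.inr i)) (star fun v => y v (Sum.inl ())) := by
  rw [dress, bracket]
  congr 1
  refine Finset.sum_congr rfl fun u _ => ?_
  rw [Matrix.mulVec, dotProduct, Finset.mul_sum]
  exact Finset.sum_congr rfl fun v _ => mul_assoc _ _ _

/-- For distinct nodes, the dressing data are the reduced vectors and the reduced matrix transformed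
by the Newton matrix, and the bracket does not see this transformation. The reduced objects converge
to coefficients at the chosen positions, and the inverse is continuous there because the limiting
Gram matrix is invertible. -/
lemma tendsto_dressedPlaneWave {r : ℝ} (hr : 0 < r)
    (h : ∀ k j, PairRadius a b (χ k) (χ j) (β k) (β j) r) (hχ : Function.Injective χ)
    (him : ∀ j, 0 < (χ j).im) (hκ : ∀ j, 1 ≤ kappa a b (χ j))
    (hs : ∀ j, 1 ≤ s j ∧ s j ≤ kappa a b (χ j) + 1) (x t : ℝ) (i : Fin N) :
    Tendsto (fun ε => dressedPlaneWave a b χ β s K ε x t i) (𝓝[admissible a b χ K] 0)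
      (𝓝 (rogueWave a b χ β s K x t i)) := by
  have hdet := det_gramMatrix_ne_zero (a := a) (b := b) (β := β) (K := K) hχ him
    (fun j => (hs j).2) x t
  rw [rogueWave_eq (fun j => (add_ofReal_ne_zero (him j) <| b ·)) him hdet]
  obtain ⟨ρ, hρ⟩ : ∃ ρ : Fin p → ℝ, ρ = fun j => r ^ (kappa a b (χ j) + 1) := ⟨_, rfl⟩
  have hρ0 : ∀ j, 0 < ρ j := fun j => by rw [hρ]; positivity
  obtain ⟨g, hg⟩ : ∃ g : Fin p → Fin p → ℕ → ℕ → ℂ, g = fun k j =>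
    gramEntry a b (χ k) (χ j) (β k) (β j) (s k) (s j) x t := ⟨_, rfl⟩
  obtain ⟨f₀, hf₀⟩ : ∃ f₀ : Fin p → ℕ → ℂ, f₀ = fun j =>
    entry (kappa a b (χ j) + 1) (s j) (fullSeries a b (χ j) (β j) x t) := ⟨_, rfl⟩
  obtain ⟨f₁, hf₁⟩ : ∃ f₁ : Fin p → ℕ → ℂ, f₁ = fun j n => planeWave a b x t i *
    entry (kappa a b (χ j) + 1) (s j) (invSeries a b (χ j) i * fullSeries a b (χ j) (β j) x t) n :=
    ⟨_, rfl⟩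
  have hgC : ∀ k j, ∃ C, ∀ m n, ‖g k j m n‖ * (ρ k ^ m * ρ j ^ n) ≤ C := fun k j => by
    rw [hg, hρ]
    exact (h k j).exists_norm_gramEntry_le (him k) (him j) (hκ k) (hκ j) (hs k) (hs j) x t
  have hf₀C : ∀ j, ∃ C, ∀ n, ‖f₀ j n‖ * ρ j ^ n ≤ C := fun j => by
    rw [hf₀, hρ]
    exact ⟨_, ((h j j).left.fullSeries x t).norm_entry_le hr (hs j).2⟩
  have hf₁C : ∀ j, ∃ C, ∀ n, ‖f₁ j n‖ * ρ j ^ n ≤ C := fun j => by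
    rw [hf₁, hρ]
    have h1 := (((h j j).left.invSeries i).mul ((h j j).left.fullSeries x t) hr.le).norm_entry_le hr
      (hs j).2
    exact ⟨_, fun n => (congrArg (· * _) (norm_mul _ _)).trans_le ((mul_assoc _ _ _).trans_le
      (mul_le_mul_of_nonneg_left (h1 n) (norm_nonneg _)))⟩
  have hT := eventually_norm_node_le (a := a) (b := b) (χ := χ) (K := K) (ρ := fun j => ρ j / 4)
    fun j => by have := hρ0 j; positivity
  have hεr : ∀ᶠ ε in 𝓝[admissible a b χ K] (0 : (Σ j : Fin p, Fin (K j)) → ℂ), ∀ u, ‖ε u‖ < r := by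
    refine eventually_all.2 fun u => ?_
    have h1 : Continuous fun ε : (Σ j : Fin p, Fin (K j)) → ℂ => ‖ε u‖ := by fun_prop
    exact ((h1.tendsto' 0 0 (by simp)).mono_left nhdsWithin_le_nhds).eventually_lt_const hr
  have hvec : ∀ {f : Fin p → ℕ → ℂ}, (∀ j, ∃ C, ∀ n, ‖f j n‖ * ρ j ^ n ≤ C) →
      Tendsto (fun ε => reducedVec K f (node a b χ K ε)) (𝓝[admissible a b χ K] 0)
        (𝓝 fun u : Σ j : Fin p, Fin (K j) => f u.1 u.2) := fun {f} hf =>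
    tendsto_pi_nhds.2 fun u => by
      obtain ⟨C, hC⟩ := hf u.1
      exact tendsto_tsum_divDiff (hρ0 u.1) hC (hT.mono fun ε hε => hε u.1) (tendsto_node u.1) u.2
  have hmat : Tendsto (fun ε => reducedMat K g (node a b χ K ε)) (𝓝[admissible a b χ K] 0)
      (𝓝 (gramMatrix a b χ β s K x t)) :=
    tendsto_pi_nhds.2 fun u => tendsto_pi_nhds.2 fun v => by
      obtain ⟨C, hC⟩ := hgC u.1 v.1
      have h1 := tendsto_tsum_star_divDiff_mul_divDiff (hρ0 u.1) (hρ0 v.1) hC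
        (hT.mono fun ε hε => hε u.1) (hT.mono fun ε hε => hε v.1) (tendsto_node u.1)
        (tendsto_node v.1) u.2 v.2
      rw [hg] at h1 ⊢
      exact h1
  have h1 := (tendsto_bracket (tendsto_matrix_inv hdet hmat) (hvec hf₁C) (hvec hf₀C)).const_add
    (planeWave a b x t i)
  have h2 : (fun u : Σ j : Fin p, Fin (K j) => f₁ u.1 u.2) =
      planeWave a b x t i • rhoVec a b χ β s K i x t := by rw [hf₁]; rfl
  have h3 : (fun u : Σ j : Fin p, Fin (K j) => f₀ u.1 u.2) = phiVec a b χ β s K x t := by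
    rw [hf₀]; rfl
  rw [h2, h3] at h1
  refine h1.congr' ?_
  filter_upwards [hT, hεr, self_mem_nhdsWithin] with ε hT hεr hadm
  rw [dressedPlaneWave, dress_eq]
  -- The admissibility condition enters in two ways: nonzero parameters make the averages
  -- expandable, and distinct powers ε^(κ+1) within a block make the Newton matrix invertible.
  have h4 := conjTranspose_mul_reducedMat_mul (K := K) hρ0 hgC hT
    (M := dressM (fun u => lamHat a b (χ u.1) (ε u))
      (fun u => Psi a b (χ u.1) (β u.1) (s u.1) (ε u) x t)) fun u v => by
    refine hasSum_of_eq ((h u.1 v.1).hasSum_gramEntry (him _) (him _) (hκ _) (hκ _) (hs _) (hs _)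
      (hadm.1 u) (hεr u) (hadm.1 v) (hεr v) x t) fun e => ?_
    rw [node_coe, node_coe, star_pow, hg]
  have h5 := reducedVec_vecMul (K := K) hρ0 hf₀C hT
    (y := fun v => Psi a b (χ v.1) (β v.1) (s v.1) (ε v) x t (Sum.inl ())) fun v => by
    refine hasSum_of_eq ((h v.1 v.1).left.hasSum_psiRed_inl (hs _) (hadm.1 v) (hεr v).le x t)
      fun n => ?_
    rw [node_coe, hf₀, mul_comm n, pow_mul]
    rfl
  have h6 := reducedVec_vecMul (K := K) hρ0 hf₁C hT
    (y := fun v => Psi a b (χ v.1) (β v.1) (s v.1) (ε v) x t (Sum.inr i)) fun v => by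
    refine hasSum_of_eq (((h v.1 v.1).left.hasSum_psiRed_inr (hs _) (hadm.1 v) (hεr v).le x t
      i).mul_left (planeWave a b x t i)) fun n => ?_
    rw [node_coe, hf₁, mul_comm n, pow_mul, ← mul_assoc]
    rfl
  rw [← h4, ← h5, ← h6, bracket_congruence (det_newtonMatrix_node_ne_zero hadm)]

end VNLS

end

/-! ### The theorem -/

theorem mainTheorem1 {N p : ℕ} (a b : Fin N → ℝ)
    (χ : Fin p → ℂ) (hχ_inj : Function.Injective χ)
    (hχ_root : ∀ j, (discPoly a b).IsRoot (χ j)) (hχ_im : ∀ j, 0 < (χ j).im)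
    (β : Fin p → ℕ → ℂ) (s K : Fin p → ℕ)
    (hs : ∀ j, 1 ≤ s j ∧ s j ≤ kappa a b (χ j) + 1) :
    -- the series `χ̂_j` converge and are roots of the characteristic equation at `λ̂_j`
    (∃ R > 0, ∀ (j : Fin p) (ε : ℂ), ‖ε‖ < R →
      Summable (fun m => ‖chiCoeff a b (χ j) m * ε ^ m‖) ∧
      (∀ i, chiHat a b (χ j) ε + b i ≠ 0) ∧
      charLHS a b (lamHat a b (χ j) ε) (chiHat a b (χ j) ε) = 0) ∧
    -- for convergent parameter series, the formula is the limit of the dressed plane waves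
    ((∀ j, ∃ ρ > 0, Summable fun k => ‖β j k‖ * ρ ^ k) →
      (∃ R > 0,
        (∀ (j : Fin p) (ε : ℂ), ε ≠ 0 → ‖ε‖ < R →
          SolvesLax a (planeWave a b) (lamHat a b (χ j) ε) (Psi a b (χ j) (β j) (s j) ε)) ∧
        (∀ (k j : Fin p) (ε η : ℂ) (x t : ℝ), ε ≠ 0 → ‖ε‖ < R → η ≠ 0 → ‖η‖ < R →
          star (lamHat a b (χ k) ε) - lamHat a b (χ j) η ≠ 0 ∧
          HasSum
            (fun e : ℕ × ℕ => Gcoeff a b χ β s k j x t (e.1 + 1) (e.2 + 1) *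
              star ε ^ (e.1 * (kappa a b (χ k) + 1)) * η ^ (e.2 * (kappa a b (χ j) + 1)))
            (Complex.exp (-(star (Xcoeff a b (χ k) (β k) x t 0) + Xcoeff a b (χ j) (β j) x t 0)) *
              ((star (Psi a b (χ k) (β k) (s k) ε x t) ⬝ᵥ Psi a b (χ j) (β j) (s j) η x t) /
                (star (lamHat a b (χ k) ε) - lamHat a b (χ j) η))) ∧
          ∀ i : Fin N, HasSum
            (fun e : ℕ × ℕ => GcoeffI a b χ β s k j i x t (e.1 + 1) (e.2 + 1) *
              star ε ^ (e.1 * (kappa a b (χ k) + 1)) * η ^ (e.2 * (kappa a b (χ j) + 1)))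
            (Complex.exp (-(star (Xcoeff a b (χ k) (β k) x t 0) + Xcoeff a b (χ j) (β j) x t 0)) *
              ((star (Psi a b (χ k) (β k) (s k) ε x t) ⬝ᵥ Psi a b (χ j) (β j) (s j) η x t) /
                  (star (lamHat a b (χ k) ε) - lamHat a b (χ j) η) +
                star (psiRed a b (χ k) (β k) (s k) ε x t (Sum.inl ())) *
                  psiRed a b (χ j) (β j) (s j) η x t (Sum.inr i))))) ∧
      ∀ (x t : ℝ) (i : Fin N),
        Tendsto (fun ε => dressedPlaneWave a b χ β s K ε x t i)
          (𝓝[admissible a b χ K] 0) (𝓝 (rogueWave a b χ β s K x t i))) ∧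
    -- the denominator never vanishes, and the formula gives solutions of the equation
    (∀ x t : ℝ, (Gmat a b χ β s K x t).det ≠ 0) ∧
    SolvesVNLSE (rogueWave a b χ β s K) := by
  have hκ : ∀ j, 1 ≤ kappa a b (χ j) := fun j => one_le_kappa (hχ_root j)
  have hb : ∀ j i, χ j + b i ≠ 0 := fun j i => add_ofReal_ne_zero (hχ_im j) (b i)
  refine ⟨?_, fun hβ => ?_, fun x t => ?_, solvesVNLSE_rogueWave hb hκ hs hχ_inj hχ_im⟩
  -- The series χ̂ do not involve the parameters, so the radius is taken with all β equal to 0, and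
  -- no assumption on the given β is needed.
  · obtain ⟨r, h, hr⟩ := ((eventually_all.2 fun j => eventually_goodRadius (hb j) (hκ j)
      (β := 0) ⟨1, one_pos, absConv_zero 1⟩).and self_mem_nhdsWithin).exists
    refine ⟨r, hr, fun j ε hε => ⟨?_, fun i => (h j).chiHat_add_ne_zero i hε.le, ?_⟩⟩
    · simpa [chiSeries] using (h j).chiSeries.summable_norm hε.le
    · rw [charLHS, (h j).lamHat_eq (hκ j) hε.le]
      ring
  · have hβ' : ∀ j, ∃ ρ > 0, AbsConv (PowerSeries.mk (β j)) ρ := fun j => by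
      obtain ⟨ρ, hρ, h⟩ := hβ j
      exact ⟨ρ, hρ, by simpa [AbsConv] using h⟩
    -- There are finitely many pairs of roots, so one radius serves all of them.
    obtain ⟨r, h, hr⟩ := ((eventually_all.2 fun k => eventually_all.2 fun j =>
      eventually_pairRadius (hχ_im k) (hχ_im j) (hκ k) (hκ j) (hβ' k) (hβ' j)).and
        self_mem_nhdsWithin).exists
    refine ⟨⟨r, hr, fun j ε hε0 hε => (h j j).left.solvesLax_Psi (hκ j) (s j) hε.le,
      fun k j ε η x t hε0 hε hη0 hη => ⟨?_, ?_, fun i => ?_⟩⟩,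
      tendsto_dressedPlaneWave hr h hχ_inj hχ_im hκ hs⟩
    · exact (h k j).lamHat_sub_ne_zero (hχ_im k) (hχ_im j) hε.le hη.le
    · exact (h k j).hasSum_Hcoeff (hχ_im k) (hχ_im j) (hκ k) (hκ j) (hs k) (hs j) hε0 hε hη0 hη x t
    · exact (h k j).hasSum_HcoeffI (hχ_im k) (hχ_im j) (hκ k) (hκ j) (hs k) (hs j) hε0 hε hη0 hη
        x t i
  · have h1 := det_gramMatrix_ne_zero (a := a) (b := b) (β := β) (K := K) hχ_inj hχ_im
      (fun j => (hs j).2) x t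
    rw [det_gramMatrix_eq] at h1
    exact right_ne_zero_of_mul h1
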